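/- Let $1\le m\le n$ be integers, $R>0$, and let $\mathbb K$ be $\mathbb R$ or $\mathbb C$. Let $X=\{x\in\mathbb R^n:|x|<R\}$, $\mu=x_1^2+\cdots+x_m^2$ and $Y=\mu^{-1}(0)\cap X$. Let $\mathcal A_\mu(X)$ be the differential graded algebra of smooth $\mathbb K$-valued differential forms $\omega$ on $X\smallsetminus Y$ such that, for some integer $N\ge 0$, $\mu^N\omega$ extends to a smooth form on $X$, with the wedge product and the de Rham differential, and let $H(\mathcal A_\mu(X))$ be its cohomology algebra. Let $\bigwedge(t_1,\dots,t_k)$ be the exterior algebra over $\mathbb K$ on generators $t_1,\dots,t_k$, graded by the degrees of the generators. (i) If $m$ is odd, then $\alpha=d\mu/\mu$ is a closed element of $\mathcal A_\mu(X)$ and there is an isomorphism of graded algebras $$H(\mathcal A_\mu(X))\cong\bigwedge(\bar\alpha),\qquad \deg\bar\alpha=1,$$ in which the generator $\bar\alpha$ corresponds to the class of $\alpha$. (ii) If $m$ is even, then $\alpha=d\mu/\mu$ and $$\beta=\sum_{i=1}^m(-1)^{i-1}\,\frac{x_i\,dx_1\wedge\cdots\wedge\widehat{dx_i}\wedge\cdots\wedge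 dx_m}{(x_1^2+\cdots+x_m^2)^{m/2}}$$ are closed elements of $\mathcal A_\mu(X)$ and there is an isomorphism of graded algebras $$H(\mathcal A_\mu(X))\cong\bigwedge(\bar\alpha,\bar\beta),\qquad \deg\bar\alpha=1,\quad\deg\bar\beta=m-1,$$ in which the generators $\bar\alpha,\bar\beta$ correspond to the classes of $\alpha$ and $\beta$. Moreover, for $m$ even, the $(m-1)$-form $\beta$ is the basic representative of a rotation invariant volume form on the $(m-1)$-dimensional real projective space, in the following sense. It is basic: $\iota_V\beta=0$ and $L_V\beta=0$ for the Euler field $V=\sum_{i=1}^m x_i\,\partial/\partial x_i$ and for $V=\partial/\partial x_j$, $m<j\le n$. It satisfies $g^*\beta=\beta$ for every $g\in\mathrm{SO}(m)$ acting on $(x_1,\dots,x_m)$ (in particular for the antipodal map $g=-1$). It is nowhere zero, as $$\alpha\wedge\beta=2\mu^{-m/2}\,dx_1\wedge\cdots\wedge dx_m.$$ -/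

import Mathlib

open scoped TensorProduct ContDiff

noncomputable section

namespace LocalDeRham

/-! ### Smooth functions on an open subset of `ℝⁿ` -/

/-- `extend f` is a function on `U`, continued by zero to `ℝⁿ`. -/
def extend {𝕜 : Type*} [RCLike 𝕜] {n : ℕ} {U : TopologicalSpace.Opens (EuclideanSpace ℝ (Fin n))}
    (f : U → 𝕜) : EuclideanSpace ℝ (Fin n) → 𝕜 :=
  Function.extend Subtype.val f 0

theorem extend_coe {𝕜 : Type*} [RCLike 𝕜] {n : ℕ}
    {U : TopologicalSpace.Opens (EuclideanSpace ℝ (Fin n))} (f : U → 𝕜) (x : U) :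
    extend f (x : EuclideanSpace ℝ (Fin n)) = f x :=
  Subtype.val_injective.extend_apply f 0 x

theorem contDiffOn_extend_of_eq {𝕜 : Type*} [RCLike 𝕜] {n : ℕ}
    {U : TopologicalSpace.Opens (EuclideanSpace ℝ (Fin n))} {f : U → 𝕜}
    {g : EuclideanSpace ℝ (Fin n) → 𝕜} (hg : ContDiffOn ℝ ∞ g U) (h : ∀ x : U, f x = g x) :
    ContDiffOn ℝ ∞ (extend f) U :=
  hg.congr fun x hx => (extend_coe f ⟨x, hx⟩).trans (h ⟨x, hx⟩)

/-- `C^∞(U, 𝕜)`: the algebra of smooth `𝕜`-valued functions on the open set `U ⊆ ℝⁿ`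
(smooth over `ℝ`; `𝕜` is `ℝ` or `ℂ`). -/
def Smooth (𝕜 : Type*) [RCLike 𝕜] {n : ℕ}
    (U : TopologicalSpace.Opens (EuclideanSpace ℝ (Fin n))) : Subalgebra 𝕜 (U → 𝕜) where
  carrier := {f | ContDiffOn ℝ ∞ (extend f) U}
  mul_mem' {f g} hf hg := contDiffOn_extend_of_eq (ContDiffOn.mul hf hg) fun x => by
    simp [extend_coe]
  add_mem' {f g} hf hg := contDiffOn_extend_of_eq (ContDiffOn.add hf hg) fun x => by
    simp [extend_coe]
  algebraMap_mem' c := contDiffOn_extend_of_eq (g := fun _ => c) contDiffOn_const fun x => by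
    simp

/-- The smooth function on `U` given by a formula on `ℝⁿ` that is smooth on `U`. -/
def Smooth.mk {𝕜 : Type*} [RCLike 𝕜] {n : ℕ}
    {U : TopologicalSpace.Opens (EuclideanSpace ℝ (Fin n))}
    (g : EuclideanSpace ℝ (Fin n) → 𝕜) (hg : ContDiffOn ℝ ∞ g U) : Smooth 𝕜 U :=
  ⟨fun x => g x, contDiffOn_extend_of_eq hg fun _ => rfl⟩

theorem differentiableAt_extend {𝕜 : Type*} [RCLike 𝕜] {n : ℕ}
    {U : TopologicalSpace.Opens (EuclideanSpace ℝ (Fin n))} (f : Smooth 𝕜 U) (x : U) :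
    DifferentiableAt ℝ (extend f.1) (x : EuclideanSpace ℝ (Fin n)) :=
  (f.2.contDiffAt (U.isOpen.mem_nhds x.2)).differentiableAt (by simp)

/-- Two functions on `ℝⁿ` that agree on `U` have the same derivative at the points of `U`. -/
theorem fderiv_eq_of_eq {𝕜 : Type*} [RCLike 𝕜] {n : ℕ}
    {U : TopologicalSpace.Opens (EuclideanSpace ℝ (Fin n))}
    {g h : EuclideanSpace ℝ (Fin n) → 𝕜} (H : ∀ x : U, g x = h x) (x : U) :
    fderiv ℝ g (x : EuclideanSpace ℝ (Fin n)) = fderiv ℝ h x :=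
  Filter.EventuallyEq.fderiv_eq <|
    Filter.eventually_of_mem (U.isOpen.mem_nhds x.2) fun y hy => H ⟨y, hy⟩

/-- The partial derivative `∂/∂x_i : C^∞(U) → C^∞(U)`. -/
def pderiv (𝕜 : Type*) [RCLike 𝕜] {n : ℕ}
    (U : TopologicalSpace.Opens (EuclideanSpace ℝ (Fin n))) (i : Fin n) :
    Smooth 𝕜 U →ₗ[𝕜] Smooth 𝕜 U where
  toFun f := Smooth.mk (fun x => fderiv ℝ (extend f.1) x (EuclideanSpace.single i 1))
    ((ContDiffOn.fderiv_of_isOpen f.2 U.isOpen (m := ∞) (by simp)).clm_apply contDiffOn_const)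
  map_add' f g := by
    ext x
    have h : fderiv ℝ (extend (f + g).1) (x : EuclideanSpace ℝ (Fin n)) =
        fderiv ℝ (extend f.1 + extend g.1) x :=
      fderiv_eq_of_eq (fun y => by simp [extend_coe]) x
    simp only [Smooth.mk]
    rw [h, fderiv_add (differentiableAt_extend f x) (differentiableAt_extend g x)]
    rfl
  map_smul' c f := by
    ext x
    have h : fderiv ℝ (extend (c • f).1) (x : EuclideanSpace ℝ (Fin n)) =
        fderiv ℝ (c • extend f.1) x :=
      fderiv_eq_of_eq (fun y => by simp [extend_coe]) x
    simp only [Smooth.mk]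
    rw [h, fderiv_const_smul (differentiableAt_extend f x)]
    rfl

theorem pderiv_mul {𝕜 : Type*} [RCLike 𝕜] {n : ℕ}
    {U : TopologicalSpace.Opens (EuclideanSpace ℝ (Fin n))} (i : Fin n) (f g : Smooth 𝕜 U) :
    pderiv 𝕜 U i (f * g) = pderiv 𝕜 U i f * g + f * pderiv 𝕜 U i g := by
  ext x
  have h : fderiv ℝ (extend (f * g).1) (x : EuclideanSpace ℝ (Fin n)) =
      fderiv ℝ (extend f.1 * extend g.1) x :=
    fderiv_eq_of_eq (fun y => by simp [extend_coe]) x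
  change fderiv ℝ (extend (f * g).1) (x : EuclideanSpace ℝ (Fin n)) (EuclideanSpace.single i 1) =
    fderiv ℝ (extend f.1) (x : EuclideanSpace ℝ (Fin n)) (EuclideanSpace.single i 1) * g.1 x +
    f.1 x * fderiv ℝ (extend g.1) (x : EuclideanSpace ℝ (Fin n)) (EuclideanSpace.single i 1)
  rw [h, fderiv_mul (differentiableAt_extend f x) (differentiableAt_extend g x)]
  simp [extend_coe]
  ring

theorem pderiv_comm {𝕜 : Type*} [RCLike 𝕜] {n : ℕ}
    {U : TopologicalSpace.Opens (EuclideanSpace ℝ (Fin n))} (i j : Fin n) (f : Smooth 𝕜 U) :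
    pderiv 𝕜 U i (pderiv 𝕜 U j f) = pderiv 𝕜 U j (pderiv 𝕜 U i f) := by
  ext x
  have hf : ContDiffAt ℝ ∞ (extend f.1) (x : EuclideanSpace ℝ (Fin n)) :=
    f.2.contDiffAt (U.isOpen.mem_nhds x.2)
  have hd : DifferentiableAt ℝ (fderiv ℝ (extend f.1)) (x : EuclideanSpace ℝ (Fin n)) :=
    (hf.fderiv_right (m := ∞) (by simp)).differentiableAt (by simp)
  have key : ∀ k l : Fin n, (pderiv 𝕜 U k (pderiv 𝕜 U l f)).1 x =
      fderiv ℝ (fderiv ℝ (extend f.1)) (x : EuclideanSpace ℝ (Fin n))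
        (EuclideanSpace.single k 1) (EuclideanSpace.single l 1) := fun k l => by
    change fderiv ℝ (extend (pderiv 𝕜 U l f).1) (x : EuclideanSpace ℝ (Fin n)) _ = _
    rw [fderiv_eq_of_eq (g := extend (pderiv 𝕜 U l f).1) (h := fun y => fderiv ℝ (extend f.1) y (EuclideanSpace.single l 1))
      (fun y => extend_coe _ y) x, fderiv_clm_apply hd (differentiableAt_const _)]
    simp
  rw [key, key]
  exact (hf.isSymmSndFDerivAt (by
    rw [minSmoothness_of_isRCLikeNormedField]
    exact WithTop.coe_le_coe.mpr (le_top : (2 : ℕ∞) ≤ ⊤))).eq _ _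

/-- Restriction of smooth functions to a smaller open set. -/
def restrictFun (𝕜 : Type*) [RCLike 𝕜] {n : ℕ}
    {U V : TopologicalSpace.Opens (EuclideanSpace ℝ (Fin n))} (h : U ≤ V) :
    Smooth 𝕜 V →ₐ[𝕜] Smooth 𝕜 U where
  toFun f := ⟨fun x => f.1 ⟨x, h x.2⟩, contDiffOn_extend_of_eq (ContDiffOn.mono f.2 h)
    fun x => (extend_coe f.1 ⟨x, h x.2⟩).symm⟩
  map_one' := rfl
  map_mul' _ _ := rfl
  map_zero' := rfl
  map_add' _ _ := rfl
  commutes' _ := rfl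

theorem pderiv_restrictFun {𝕜 : Type*} [RCLike 𝕜] {n : ℕ}
    {U V : TopologicalSpace.Opens (EuclideanSpace ℝ (Fin n))} (h : U ≤ V) (i : Fin n)
    (f : Smooth 𝕜 V) :
    pderiv 𝕜 U i (restrictFun 𝕜 h f) = restrictFun 𝕜 h (pderiv 𝕜 V i f) := by
  ext x
  have e : fderiv ℝ (extend (restrictFun 𝕜 h f).1) (x : EuclideanSpace ℝ (Fin n)) =
      fderiv ℝ (extend f.1) x :=
    fderiv_eq_of_eq (fun y => (extend_coe _ y).trans (extend_coe f.1 ⟨y, h y.2⟩).symm) x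
  change fderiv ℝ (extend (restrictFun 𝕜 h f).1) (x : EuclideanSpace ℝ (Fin n)) _ =
    fderiv ℝ (extend f.1) (x : EuclideanSpace ℝ (Fin n)) _
  rw [e]

/-! ### Differential forms on an open subset of `ℝⁿ` -/

/-- The exterior algebra `⋀(dx_1, …, dx_n)` with constant coefficients. -/
abbrev ConstForms (𝕜 : Type*) [RCLike 𝕜] (n : ℕ) : Type _ := ExteriorAlgebra 𝕜 (Fin n → 𝕜)

/-- `dx_i`. -/
def dx (𝕜 : Type*) [RCLike 𝕜] {n : ℕ} (i : Fin n) : ConstForms 𝕜 n :=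
  ExteriorAlgebra.ι 𝕜 (Pi.single i 1)

/-- The algebra of smooth differential forms on the open set `U ⊆ ℝⁿ`,
`Ω(U) = C^∞(U) ⊗ ⋀(dx_1, …, dx_n)`; an element is a sum `∑_I f_I dx_I`, and the product is the
wedge product. -/
abbrev Forms (𝕜 : Type*) [RCLike 𝕜] {n : ℕ}
    (U : TopologicalSpace.Opens (EuclideanSpace ℝ (Fin n))) : Type _ :=
  Smooth 𝕜 U ⊗[𝕜] ConstForms 𝕜 n

instance Forms.instRing (𝕜 : Type*) [RCLike 𝕜] {n : ℕ}
    (U : TopologicalSpace.Opens (EuclideanSpace ℝ (Fin n))) : Ring (Forms 𝕜 U) :=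
  Algebra.TensorProduct.instRing

instance Forms.instAddCommGroup (𝕜 : Type*) [RCLike 𝕜] {n : ℕ}
    (U : TopologicalSpace.Opens (EuclideanSpace ℝ (Fin n))) : AddCommGroup (Forms 𝕜 U) :=
  (Forms.instRing 𝕜 U).toAddCommGroup

instance Forms.instAlgebra (𝕜 : Type*) [RCLike 𝕜] {n : ℕ}
    (U : TopologicalSpace.Opens (EuclideanSpace ℝ (Fin n))) : Algebra 𝕜 (Forms 𝕜 U) :=
  Algebra.TensorProduct.leftAlgebra

/-- The subspace `Ω^k(U)` of forms of degree `k`. -/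
def Forms.degree (𝕜 : Type*) [RCLike 𝕜] {n : ℕ}
    (U : TopologicalSpace.Opens (EuclideanSpace ℝ (Fin n))) (k : ℕ) : Submodule 𝕜 (Forms 𝕜 U) :=
  LinearMap.range (LinearMap.lTensor (Smooth 𝕜 U) (⋀[𝕜]^k (Fin n → 𝕜)).subtype)

/-- A smooth function, as a form of degree zero. -/
def Forms.ofFun {𝕜 : Type*} [RCLike 𝕜] {n : ℕ}
    {U : TopologicalSpace.Opens (EuclideanSpace ℝ (Fin n))} (f : Smooth 𝕜 U) : Forms 𝕜 U :=
  f ⊗ₜ[𝕜] 1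

theorem Forms.ofFun_mul_comm {𝕜 : Type*} [RCLike 𝕜] {n : ℕ}
    {U : TopologicalSpace.Opens (EuclideanSpace ℝ (Fin n))} (f : Smooth 𝕜 U) (ξ : Forms 𝕜 U) :
    Forms.ofFun f * ξ = ξ * Forms.ofFun f :=
  Algebra.commutes (R := Smooth 𝕜 U) f ξ

/-- The exterior derivative, `d (∑_I f_I dx_I) = ∑_I ∑_i (∂f_I/∂x_i) dx_i ∧ dx_I`. -/
def d (𝕜 : Type*) [RCLike 𝕜] {n : ℕ}
    (U : TopologicalSpace.Opens (EuclideanSpace ℝ (Fin n))) : Forms 𝕜 U →ₗ[𝕜] Forms 𝕜 U :=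
  ∑ i : Fin n, TensorProduct.map (pderiv 𝕜 U i) (LinearMap.mulLeft 𝕜 (dx 𝕜 i))

theorem d_tmul {𝕜 : Type*} [RCLike 𝕜] {n : ℕ}
    {U : TopologicalSpace.Opens (EuclideanSpace ℝ (Fin n))} (f : Smooth 𝕜 U)
    (u : ConstForms 𝕜 n) :
    d 𝕜 U (f ⊗ₜ[𝕜] u) = ∑ i : Fin n, pderiv 𝕜 U i f ⊗ₜ[𝕜] (dx 𝕜 i * u) := by
  simp [d, LinearMap.sum_apply]

theorem dx_mul_dx {𝕜 : Type*} [RCLike 𝕜] {n : ℕ} (i j : Fin n) :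
    dx 𝕜 i * dx 𝕜 j = -(dx 𝕜 j * dx 𝕜 i) :=
  eq_neg_of_add_eq_zero_left (ExteriorAlgebra.ι_add_mul_swap _ _)

theorem d_d {𝕜 : Type*} [RCLike 𝕜] {n : ℕ}
    {U : TopologicalSpace.Opens (EuclideanSpace ℝ (Fin n))} (ξ : Forms 𝕜 U) :
    d 𝕜 U (d 𝕜 U ξ) = 0 := by
  induction ξ using TensorProduct.induction_on with
  | zero => simp
  | add a b ha hb => rw [map_add, map_add, ha, hb, add_zero]
  | tmul f u =>
    have h : d 𝕜 U (d 𝕜 U (f ⊗ₜ[𝕜] u)) = -d 𝕜 U (d 𝕜 U (f ⊗ₜ[𝕜] u)) := by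
      conv_lhs => rw [d_tmul, map_sum]
      conv_rhs => rw [d_tmul, map_sum]
      simp only [d_tmul]
      conv_lhs => rw [Finset.sum_comm]
      rw [← Finset.sum_neg_distrib]
      refine Finset.sum_congr rfl fun i _ => ?_
      rw [← Finset.sum_neg_distrib]
      refine Finset.sum_congr rfl fun j _ => ?_
      rw [pderiv_comm, ← mul_assoc, ← mul_assoc, dx_mul_dx, neg_mul, TensorProduct.tmul_neg]
    have h2 : (2 : 𝕜) • d 𝕜 U (d 𝕜 U (f ⊗ₜ[𝕜] u)) = 0 := by
      rw [two_smul]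
      exact eq_neg_iff_add_eq_zero.mp h
    exact (smul_eq_zero.mp h2).resolve_left two_ne_zero

/-- The sign automorphism: multiplication by `(-1)^k` on forms of degree `k`. -/
def Forms.sign (𝕜 : Type*) [RCLike 𝕜] {n : ℕ}
    (U : TopologicalSpace.Opens (EuclideanSpace ℝ (Fin n))) : Forms 𝕜 U →ₐ[𝕜] Forms 𝕜 U :=
  Algebra.TensorProduct.map (AlgHom.id 𝕜 (Smooth 𝕜 U)) CliffordAlgebra.involute

theorem Forms.sign_tmul {𝕜 : Type*} [RCLike 𝕜] {n : ℕ}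
    {U : TopologicalSpace.Opens (EuclideanSpace ℝ (Fin n))} (f : Smooth 𝕜 U)
    (u : ConstForms 𝕜 n) :
    Forms.sign 𝕜 U (f ⊗ₜ[𝕜] u) = f ⊗ₜ[𝕜] (CliffordAlgebra.involute u) := by
  simp [Forms.sign]

theorem Forms.sign_sign {𝕜 : Type*} [RCLike 𝕜] {n : ℕ}
    {U : TopologicalSpace.Opens (EuclideanSpace ℝ (Fin n))} (ξ : Forms 𝕜 U) :
    Forms.sign 𝕜 U (Forms.sign 𝕜 U ξ) = ξ := by
  induction ξ using TensorProduct.induction_on with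
  | zero => simp
  | tmul f u => rw [sign_tmul, sign_tmul, CliffordAlgebra.involute_involute]
  | add a b ha hb => rw [map_add, map_add, ha, hb]

theorem involute_dx {𝕜 : Type*} [RCLike 𝕜] {n : ℕ} (i : Fin n) :
    CliffordAlgebra.involute (dx 𝕜 i) = -dx 𝕜 i :=
  CliffordAlgebra.involute_ι _

theorem dx_mul {𝕜 : Type*} [RCLike 𝕜] {n : ℕ} (i : Fin n) (u : ConstForms 𝕜 n) :
    dx 𝕜 i * u = CliffordAlgebra.involute u * dx 𝕜 i := by
  induction u using ExteriorAlgebra.induction with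
  | algebraMap r => rw [AlgHom.commutes, Algebra.commutes]
  | ι v =>
    rw [show CliffordAlgebra.involute (ExteriorAlgebra.ι 𝕜 v) = -ExteriorAlgebra.ι 𝕜 v from
      CliffordAlgebra.involute_ι _, neg_mul, eq_neg_iff_add_eq_zero]
    exact ExteriorAlgebra.ι_add_mul_swap _ _
  | mul a b ha hb => rw [← mul_assoc, ha, mul_assoc, hb, map_mul, mul_assoc]
  | add a b ha hb => rw [mul_add, ha, hb, map_add, add_mul]

/-- The graded Leibniz rule. -/
theorem d_mul {𝕜 : Type*} [RCLike 𝕜] {n : ℕ}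
    {U : TopologicalSpace.Opens (EuclideanSpace ℝ (Fin n))} (ξ η : Forms 𝕜 U) :
    d 𝕜 U (ξ * η) = d 𝕜 U ξ * η + Forms.sign 𝕜 U ξ * d 𝕜 U η := by
  induction ξ using TensorProduct.induction_on with
  | zero => simp
  | add a b ha hb => simp only [add_mul, map_add, ha, hb]; abel
  | tmul f u =>
    induction η using TensorProduct.induction_on with
    | zero => simp
    | add a b ha hb => simp only [mul_add, map_add, ha, hb]; abel
    | tmul g v =>
      rw [Algebra.TensorProduct.tmul_mul_tmul, d_tmul, d_tmul, d_tmul, Forms.sign_tmul,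
        Finset.sum_mul, Finset.mul_sum, ← Finset.sum_add_distrib]
      refine Finset.sum_congr rfl fun i _ => ?_
      rw [Algebra.TensorProduct.tmul_mul_tmul, Algebra.TensorProduct.tmul_mul_tmul, pderiv_mul,
        TensorProduct.add_tmul, ← mul_assoc (CliffordAlgebra.involute u), ← dx_mul, mul_assoc]

theorem d_sign {𝕜 : Type*} [RCLike 𝕜] {n : ℕ}
    {U : TopologicalSpace.Opens (EuclideanSpace ℝ (Fin n))} (ξ : Forms 𝕜 U) :
    d 𝕜 U (Forms.sign 𝕜 U ξ) = -Forms.sign 𝕜 U (d 𝕜 U ξ) := by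
  induction ξ using TensorProduct.induction_on with
  | zero => simp
  | add a b ha hb => simp only [map_add, ha, hb, neg_add]
  | tmul f u =>
    rw [Forms.sign_tmul, d_tmul, d_tmul, map_sum, ← Finset.sum_neg_distrib]
    refine Finset.sum_congr rfl fun i _ => ?_
    rw [Forms.sign_tmul, map_mul, involute_dx, neg_mul, TensorProduct.tmul_neg, neg_neg]

/-- Restriction of forms to a smaller open set. -/
def restrict (𝕜 : Type*) [RCLike 𝕜] {n : ℕ}
    {U V : TopologicalSpace.Opens (EuclideanSpace ℝ (Fin n))} (h : U ≤ V) :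
    Forms 𝕜 V →ₐ[𝕜] Forms 𝕜 U :=
  Algebra.TensorProduct.map (restrictFun 𝕜 h) (AlgHom.id 𝕜 (ConstForms 𝕜 n))

theorem restrict_tmul {𝕜 : Type*} [RCLike 𝕜] {n : ℕ}
    {U V : TopologicalSpace.Opens (EuclideanSpace ℝ (Fin n))} (h : U ≤ V) (f : Smooth 𝕜 V)
    (u : ConstForms 𝕜 n) :
    restrict 𝕜 h (f ⊗ₜ[𝕜] u) = restrictFun 𝕜 h f ⊗ₜ[𝕜] u := by
  simp [restrict]

theorem d_restrict {𝕜 : Type*} [RCLike 𝕜] {n : ℕ}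
    {U V : TopologicalSpace.Opens (EuclideanSpace ℝ (Fin n))} (h : U ≤ V) (ξ : Forms 𝕜 V) :
    d 𝕜 U (restrict 𝕜 h ξ) = restrict 𝕜 h (d 𝕜 V ξ) := by
  induction ξ using TensorProduct.induction_on with
  | zero => simp
  | add a b ha hb => simp only [map_add, ha, hb]
  | tmul f u => simp only [restrict_tmul, d_tmul, map_sum, pderiv_restrictFun]

theorem sign_restrict {𝕜 : Type*} [RCLike 𝕜] {n : ℕ}
    {U V : TopologicalSpace.Opens (EuclideanSpace ℝ (Fin n))} (h : U ≤ V) (ξ : Forms 𝕜 V) :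
    Forms.sign 𝕜 U (restrict 𝕜 h ξ) = restrict 𝕜 h (Forms.sign 𝕜 V ξ) := by
  induction ξ using TensorProduct.induction_on with
  | zero => simp
  | add a b ha hb => simp only [map_add, ha, hb]
  | tmul f u => simp only [restrict_tmul, Forms.sign_tmul]

/-- Contraction `ι_V` of forms with the vector field `V = ∑_i V_i ∂/∂x_i`. -/
def contract {𝕜 : Type*} [RCLike 𝕜] {n : ℕ}
    {U : TopologicalSpace.Opens (EuclideanSpace ℝ (Fin n))} (V : Fin n → Smooth 𝕜 U) :
    Forms 𝕜 U →ₗ[𝕜] Forms 𝕜 U :=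
  ∑ i : Fin n, TensorProduct.map (LinearMap.mulLeft 𝕜 (V i))
    (CliffordAlgebra.contractLeft (LinearMap.proj i : (Fin n → 𝕜) →ₗ[𝕜] 𝕜))

/-- The Lie derivative `L_V = d ι_V + ι_V d`. -/
def lieDeriv {𝕜 : Type*} [RCLike 𝕜] {n : ℕ}
    {U : TopologicalSpace.Opens (EuclideanSpace ℝ (Fin n))} (V : Fin n → Smooth 𝕜 U) :
    Forms 𝕜 U →ₗ[𝕜] Forms 𝕜 U :=
  d 𝕜 U ∘ₗ contract V + contract V ∘ₗ d 𝕜 U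

/-- The pullback `g^* : Ω(V) → Ω(U)` along a linear map `g` of `ℝⁿ` with `g(U) ⊆ V`: functions
are composed with `g`, and `g^* dx_i = ∑_j g_{ij} dx_j`. -/
def pullback (𝕜 : Type*) [RCLike 𝕜] {n : ℕ}
    {U V : TopologicalSpace.Opens (EuclideanSpace ℝ (Fin n))}
    (g : EuclideanSpace ℝ (Fin n) →L[ℝ] EuclideanSpace ℝ (Fin n)) (hg : Set.MapsTo g U V) :
    Forms 𝕜 V →ₐ[𝕜] Forms 𝕜 U :=
  Algebra.TensorProduct.map
    { toFun := fun f => ⟨fun x => f.1 ⟨g x, hg x.2⟩, contDiffOn_extend_of_eq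
        (ContDiffOn.comp f.2 g.contDiff.contDiffOn hg)
        fun x => (extend_coe f.1 ⟨g x, hg x.2⟩).symm⟩
      map_one' := rfl
      map_mul' := fun _ _ => rfl
      map_zero' := rfl
      map_add' := fun _ _ => rfl
      commutes' := fun _ => rfl }
    (ExteriorAlgebra.map (Matrix.toLin'
      (Matrix.of fun j i : Fin n => ((g (EuclideanSpace.single j 1) i : ℝ) : 𝕜))))

/-! ### The ball, the function `μ`, and the forms with poles -/

/-- `μ(x) = x_1² + ⋯ + x_m²`. -/
def mu {n m : ℕ} (hmn : m ≤ n) (x : EuclideanSpace ℝ (Fin n)) : ℝ :=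
  ∑ i : Fin m, x (Fin.castLE hmn i) ^ 2

theorem contDiff_mu {n m : ℕ} (hmn : m ≤ n) : ContDiff ℝ ∞ (mu hmn) := by
  unfold mu
  fun_prop

/-- `X`: the open ball of radius `R` centered at the origin of `ℝⁿ`. -/
def ball (n : ℕ) (R : ℝ) : TopologicalSpace.Opens (EuclideanSpace ℝ (Fin n)) :=
  ⟨Metric.ball 0 R, Metric.isOpen_ball⟩

/-- `X ∖ Y`, where `Y = μ⁻¹(0) ∩ X`. -/
def compl {n m : ℕ} (hmn : m ≤ n) (R : ℝ) : TopologicalSpace.Opens (EuclideanSpace ℝ (Fin n)) :=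
  ⟨Metric.ball 0 R \ mu hmn ⁻¹' {0},
    Metric.isOpen_ball.sdiff (isClosed_singleton.preimage (contDiff_mu hmn).continuous)⟩

theorem compl_le {n m : ℕ} (hmn : m ≤ n) (R : ℝ) : compl hmn R ≤ ball n R :=
  Set.sdiff_subset

theorem mu_ne_zero {n m : ℕ} {hmn : m ≤ n} {R : ℝ} {x : EuclideanSpace ℝ (Fin n)}
    (hx : x ∈ compl hmn R) : mu hmn x ≠ 0 :=
  hx.2

theorem contDiffOn_ofReal (𝕜 : Type*) [RCLike 𝕜] {n : ℕ} {s : Set (EuclideanSpace ℝ (Fin n))}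
    {g : EuclideanSpace ℝ (Fin n) → ℝ} (hg : ContDiffOn ℝ ∞ g s) :
    ContDiffOn ℝ ∞ (fun x => ((g x : ℝ) : 𝕜)) s :=
  ContDiff.comp_contDiffOn (g := fun y : ℝ => (y : 𝕜)) (RCLike.ofRealCLM (K := 𝕜)).contDiff hg

/-- `μ` as a smooth function on an open set. -/
def muFun (𝕜 : Type*) [RCLike 𝕜] {n m : ℕ} (hmn : m ≤ n)
    (U : TopologicalSpace.Opens (EuclideanSpace ℝ (Fin n))) : Smooth 𝕜 U :=
  Smooth.mk (fun x => ((mu hmn x : ℝ) : 𝕜))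
    (contDiffOn_ofReal 𝕜 (contDiff_mu hmn).contDiffOn)

/-- `1/μ` as a smooth function on `X ∖ Y`. -/
def muInv (𝕜 : Type*) [RCLike 𝕜] {n m : ℕ} (hmn : m ≤ n) (R : ℝ) : Smooth 𝕜 (compl hmn R) :=
  Smooth.mk (fun x => (((mu hmn x)⁻¹ : ℝ) : 𝕜))
    (contDiffOn_ofReal 𝕜 ((contDiff_mu hmn).contDiffOn.inv fun _ hx => mu_ne_zero hx))

/-- The coordinate function `x_i`. -/
def coord (𝕜 : Type*) [RCLike 𝕜] {n : ℕ}
    (U : TopologicalSpace.Opens (EuclideanSpace ℝ (Fin n))) (i : Fin n) : Smooth 𝕜 U :=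
  Smooth.mk (fun x => ((x i : ℝ) : 𝕜))
    (contDiffOn_ofReal 𝕜 (by fun_prop : ContDiff ℝ ∞
      fun x : EuclideanSpace ℝ (Fin n) => x i).contDiffOn)

theorem restrict_muFun {𝕜 : Type*} [RCLike 𝕜] {n m : ℕ} (hmn : m ≤ n) (R : ℝ) (N : ℕ) :
    restrict 𝕜 (compl_le hmn R) (Forms.ofFun (muFun 𝕜 hmn (ball n R) ^ N)) =
      Forms.ofFun (muFun 𝕜 hmn (compl hmn R) ^ N) := by
  rw [Forms.ofFun, restrict_tmul, map_pow]
  rfl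

/-- The algebra `𝒜_μ(X)` of forms `ξ` on `X ∖ Y` such that, for some `N`, the form `μ^N ξ` extends
to a smooth form on `X`. -/
def PoleForms (𝕜 : Type*) [RCLike 𝕜] {n m : ℕ} (hmn : m ≤ n) (R : ℝ) :
    Subalgebra 𝕜 (Forms 𝕜 (compl hmn R)) where
  carrier := {ξ | ∃ (N : ℕ) (η : Forms 𝕜 (ball n R)),
    Forms.ofFun (muFun 𝕜 hmn (compl hmn R) ^ N) * ξ = restrict 𝕜 (compl_le hmn R) η}
  mul_mem' := by
    rintro ξ₁ ξ₂ ⟨N₁, η₁, h₁⟩ ⟨N₂, η₂, h₂⟩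
    refine ⟨N₁ + N₂, η₁ * η₂, ?_⟩
    have hs : Forms.ofFun (muFun 𝕜 hmn (compl hmn R) ^ (N₁ + N₂)) =
        Forms.ofFun (muFun 𝕜 hmn (compl hmn R) ^ N₁) *
          Forms.ofFun (muFun 𝕜 hmn (compl hmn R) ^ N₂) := by
      simp [Forms.ofFun, pow_add]
    rw [map_mul, ← h₁, ← h₂, hs, mul_assoc, ← mul_assoc _ ξ₁, Forms.ofFun_mul_comm _ ξ₁]
    simp only [mul_assoc]
  add_mem' := by
    rintro ξ₁ ξ₂ ⟨N₁, η₁, h₁⟩ ⟨N₂, η₂, h₂⟩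
    refine ⟨N₁ + N₂, Forms.ofFun (muFun 𝕜 hmn (ball n R) ^ N₂) * η₁ +
      Forms.ofFun (muFun 𝕜 hmn (ball n R) ^ N₁) * η₂, ?_⟩
    rw [map_add, map_mul, map_mul, restrict_muFun, restrict_muFun, ← h₁, ← h₂, mul_add, ← mul_assoc, ← mul_assoc]
    simp only [Forms.ofFun, Algebra.TensorProduct.tmul_mul_tmul, ← pow_add, mul_one]
    rw [add_comm N₂ N₁]
  algebraMap_mem' c := ⟨0, algebraMap 𝕜 _ c, by
    rw [AlgHom.commutes, pow_zero]
    exact one_mul _⟩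

/-- `𝒜_μ(X)` is closed under the exterior derivative. -/
theorem d_mem_poleForms {𝕜 : Type*} [RCLike 𝕜] {n m : ℕ} {hmn : m ≤ n} {R : ℝ}
    {ξ : Forms 𝕜 (compl hmn R)} (hξ : ξ ∈ PoleForms 𝕜 hmn R) :
    d 𝕜 (compl hmn R) ξ ∈ PoleForms 𝕜 hmn R := by
  obtain ⟨N, η, h⟩ := hξ
  refine ⟨N + N, Forms.ofFun (muFun 𝕜 hmn (ball n R) ^ N) * d 𝕜 _ η -
    d 𝕜 _ (Forms.ofFun (muFun 𝕜 hmn (ball n R) ^ N)) * η, ?_⟩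
  have hs : ∀ f : Smooth 𝕜 (compl hmn R),
      Forms.sign 𝕜 (compl hmn R) (Forms.ofFun f) = Forms.ofFun f := fun f => by
    rw [Forms.ofFun, Forms.sign_tmul, map_one]
  have h2 : Forms.ofFun (muFun 𝕜 hmn (compl hmn R) ^ (N + N)) =
      Forms.ofFun (muFun 𝕜 hmn (compl hmn R) ^ N) *
        Forms.ofFun (muFun 𝕜 hmn (compl hmn R) ^ N) := by
    simp [Forms.ofFun, pow_add]
  rw [map_sub, map_mul, map_mul, ← d_restrict, ← d_restrict, restrict_muFun, ← h, d_mul, hs, h2,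
    mul_add, ← mul_assoc _ _ ξ, Forms.ofFun_mul_comm _ (d 𝕜 _ (Forms.ofFun _)), mul_assoc _ _ ξ,
    add_sub_cancel_left, mul_assoc]

theorem sign_mem_poleForms {𝕜 : Type*} [RCLike 𝕜] {n m : ℕ} {hmn : m ≤ n} {R : ℝ}
    {ξ : Forms 𝕜 (compl hmn R)} (hξ : ξ ∈ PoleForms 𝕜 hmn R) :
    Forms.sign 𝕜 (compl hmn R) ξ ∈ PoleForms 𝕜 hmn R := by
  obtain ⟨N, η, h⟩ := hξ
  refine ⟨N, Forms.sign 𝕜 (ball n R) η, ?_⟩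
  rw [← sign_restrict, ← h, map_mul, Forms.ofFun, Forms.sign_tmul, map_one]

/-! ### Cohomology -/

/-- The algebra of closed forms in `𝒜_μ(X)`. -/
def ClosedForms (𝕜 : Type*) [RCLike 𝕜] {n m : ℕ} (hmn : m ≤ n) (R : ℝ) :
    Subalgebra 𝕜 (Forms 𝕜 (compl hmn R)) where
  carrier := {ξ | ξ ∈ PoleForms 𝕜 hmn R ∧ d 𝕜 (compl hmn R) ξ = 0}
  mul_mem' h₁ h₂ := ⟨mul_mem h₁.1 h₂.1, by rw [d_mul, h₁.2, h₂.2, zero_mul, mul_zero, add_zero]⟩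
  add_mem' h₁ h₂ := ⟨add_mem h₁.1 h₂.1, by rw [map_add, h₁.2, h₂.2, add_zero]⟩
  algebraMap_mem' c := ⟨algebraMap_mem _ c, by
    have h1 : d 𝕜 (compl hmn R) 1 = 0 := by
      have h := d_mul (1 : Forms 𝕜 (compl hmn R)) 1
      rw [map_one (Forms.sign 𝕜 (compl hmn R)), mul_one, mul_one, one_mul] at h
      exact left_eq_add.mp h
    rw [Algebra.algebraMap_eq_smul_one, map_smul, h1, smul_zero]⟩

instance ClosedForms.instRing (𝕜 : Type*) [RCLike 𝕜] {n m : ℕ} (hmn : m ≤ n) (R : ℝ) :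
    Ring (ClosedForms 𝕜 hmn R) :=
  Subalgebra.toRing _

instance ClosedForms.instAlgebra (𝕜 : Type*) [RCLike 𝕜] {n m : ℕ} (hmn : m ≤ n) (R : ℝ) :
    Algebra 𝕜 (ClosedForms 𝕜 hmn R) :=
  Subalgebra.algebra _

/-- The exact forms `dη`, `η ∈ 𝒜_μ(X)`: an ideal of the algebra of closed forms. -/
def ExactForms (𝕜 : Type*) [RCLike 𝕜] {n m : ℕ} (hmn : m ≤ n) (R : ℝ) :
    Ideal (ClosedForms 𝕜 hmn R) where
  carrier := {ξ | ∃ η ∈ PoleForms 𝕜 hmn R, d 𝕜 (compl hmn R) η = ξ}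
  add_mem' := by
    rintro ξ₁ ξ₂ ⟨η₁, h₁, e₁⟩ ⟨η₂, h₂, e₂⟩
    exact ⟨η₁ + η₂, add_mem h₁ h₂, by rw [map_add, e₁, e₂]; rfl⟩
  zero_mem' := ⟨0, zero_mem _, map_zero _⟩
  smul_mem' := by
    rintro ζ ξ ⟨η, h, e⟩
    refine ⟨Forms.sign 𝕜 _ ζ.1 * η, mul_mem (sign_mem_poleForms ζ.2.1) h, ?_⟩
    rw [d_mul, d_sign, ζ.2.2, map_zero, neg_zero, zero_mul, zero_add, Forms.sign_sign, e]
    rfl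

instance ExactForms.isTwoSided (𝕜 : Type*) [RCLike 𝕜] {n m : ℕ} (hmn : m ≤ n) (R : ℝ) :
    (ExactForms 𝕜 hmn R).IsTwoSided where
  mul_mem_of_left := by
    rintro ξ ζ ⟨η, h, e⟩
    refine ⟨η * ζ.1, mul_mem h ζ.2.1, ?_⟩
    rw [d_mul, ζ.2.2, mul_zero, add_zero, e]
    rfl

/-- The cohomology algebra `H(𝒜_μ(X))`: closed forms modulo exact forms. -/
abbrev Cohomology (𝕜 : Type*) [RCLike 𝕜] {n m : ℕ} (hmn : m ≤ n) (R : ℝ) : Type _ :=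
  ClosedForms 𝕜 hmn R ⧸ ExactForms 𝕜 hmn R

instance Cohomology.instRing (𝕜 : Type*) [RCLike 𝕜] {n m : ℕ} (hmn : m ≤ n) (R : ℝ) :
    Ring (Cohomology 𝕜 hmn R) :=
  Ideal.Quotient.ring _

instance Cohomology.instAlgebra (𝕜 : Type*) [RCLike 𝕜] {n m : ℕ} (hmn : m ≤ n) (R : ℝ) :
    Algebra 𝕜 (Cohomology 𝕜 hmn R) :=
  Ideal.Quotient.algebra 𝕜

/-- The cohomology class of a closed form. -/
def cohomologyClass {𝕜 : Type*} [RCLike 𝕜] {n m : ℕ} {hmn : m ≤ n} {R : ℝ}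
    (ξ : Forms 𝕜 (compl hmn R)) (hξ : ξ ∈ ClosedForms 𝕜 hmn R) : Cohomology 𝕜 hmn R :=
  Ideal.Quotient.mk (ExactForms 𝕜 hmn R) ⟨ξ, hξ⟩

/-- `H^k(𝒜_μ(X))`: the classes of the closed forms of degree `k`. -/
def Cohomology.degree (𝕜 : Type*) [RCLike 𝕜] {n m : ℕ} (hmn : m ≤ n) (R : ℝ) (k : ℕ) :
    Submodule 𝕜 (Cohomology 𝕜 hmn R) :=
  ((Forms.degree 𝕜 (compl hmn R) k).comap (ClosedForms 𝕜 hmn R).val.toLinearMap).map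
    (Ideal.Quotient.mkₐ 𝕜 (ExactForms 𝕜 hmn R)).toLinearMap

/-! ### Exterior algebras on generators of given degrees, and the forms `α` and `β` -/

/-- The part of degree `k` of the exterior algebra on generators `t_1, …, t_r`, where `t_i` has
degree `w i`: the span of the products of generators of total degree `k`. -/
def exteriorDegree (𝕜 : Type*) [RCLike 𝕜] {r : ℕ} (w : Fin r → ℕ) (k : ℕ) :
    Submodule 𝕜 (ExteriorAlgebra 𝕜 (Fin r → 𝕜)) :=
  Submodule.span 𝕜 {z | ∃ l : List (Fin r), (l.map w).sum = k ∧
    (l.map fun i => ExteriorAlgebra.ι 𝕜 (Pi.single i (1 : 𝕜))).prod = z}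

/-- `α = dμ/μ`. -/
def alpha (𝕜 : Type*) [RCLike 𝕜] {n m : ℕ} (hmn : m ≤ n) (R : ℝ) : Forms 𝕜 (compl hmn R) :=
  Forms.ofFun (muInv 𝕜 hmn R) * d 𝕜 _ (Forms.ofFun (muFun 𝕜 hmn (compl hmn R)))

/-- For even `m`,
`β = ∑_{i=1}^m (-1)^{i-1} x_i dx_1 ∧ ⋯ ∧ dx_{i-1} ∧ dx_{i+1} ∧ ⋯ ∧ dx_m / μ^{m/2}`
(in the code the indices start at `0`; the form is used for even `m` only). -/
def beta (𝕜 : Type*) [RCLike 𝕜] {n m : ℕ} (hmn : m ≤ n) (R : ℝ) : Forms 𝕜 (compl hmn R) :=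
  ∑ i : Fin m, (-1 : 𝕜) ^ (i : ℕ) •
    ((coord 𝕜 _ (Fin.castLE hmn i) * muInv 𝕜 hmn R ^ (m / 2)) ⊗ₜ[𝕜]
      (((List.finRange m).filter (· ≠ i)).map fun j => dx 𝕜 (Fin.castLE hmn j)).prod)

/-- `dx_1 ∧ ⋯ ∧ dx_m`. -/
def normalVolume (𝕜 : Type*) [RCLike 𝕜] {n m : ℕ} (hmn : m ≤ n) : ConstForms 𝕜 n :=
  ((List.finRange m).map fun j => dx 𝕜 (Fin.castLE hmn j)).prod

/-- The components of the normal Euler vector field `e = ∑_{i=1}^m x_i ∂/∂x_i`. -/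
def euler (𝕜 : Type*) [RCLike 𝕜] {n : ℕ} (m : ℕ)
    (U : TopologicalSpace.Opens (EuclideanSpace ℝ (Fin n))) (i : Fin n) : Smooth 𝕜 U :=
  if (i : ℕ) < m then coord 𝕜 U i else 0

/-- A form on `X ∖ Y` is basic for the dilations of `x_1, …, x_m`: it is annihilated by `ι_V` and
`L_V` for the normal Euler field `V = e`, and likewise for `V = ∂/∂x_j`, `j > m`, so that it
involves the variables `x_1, …, x_m` only. -/
def IsBasic {𝕜 : Type*} [RCLike 𝕜] {n m : ℕ} {hmn : m ≤ n} {R : ℝ}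
    (ξ : Forms 𝕜 (compl hmn R)) : Prop :=
  (contract (euler 𝕜 m (compl hmn R)) ξ = 0 ∧ lieDeriv (euler 𝕜 m (compl hmn R)) ξ = 0) ∧
  ∀ j : Fin n, m ≤ (j : ℕ) →
    contract (Pi.single j (1 : Smooth 𝕜 (compl hmn R))) ξ = 0 ∧
    lieDeriv (Pi.single j (1 : Smooth 𝕜 (compl hmn R))) ξ = 0

/-- A form on `X ∖ Y` is rotation invariant if `g^* ξ = ξ` for all `g ∈ SO(m)`, i.e. for all linear
isometries `g` of `ℝⁿ` of determinant `1` that leave `x_{m+1}, …, x_n` unchanged. (Such a `g` maps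
`X ∖ Y` to itself.) -/
def IsRotationInvariant {𝕜 : Type*} [RCLike 𝕜] {n m : ℕ} {hmn : m ≤ n} {R : ℝ}
    (ξ : Forms 𝕜 (compl hmn R)) : Prop :=
  ∀ g : EuclideanSpace ℝ (Fin n) ≃ₗᵢ[ℝ] EuclideanSpace ℝ (Fin n),
    LinearMap.det (g.toLinearEquiv : EuclideanSpace ℝ (Fin n) →ₗ[ℝ] EuclideanSpace ℝ (Fin n)) = 1 →
    (∀ (x : EuclideanSpace ℝ (Fin n)) (j : Fin n), m ≤ (j : ℕ) → g x j = x j) →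
    ∀ hg : Set.MapsTo
        (g.toContinuousLinearEquiv : EuclideanSpace ℝ (Fin n) →L[ℝ] EuclideanSpace ℝ (Fin n))
        (compl hmn R) (compl hmn R),
      pullback 𝕜 _ hg ξ = ξ

end LocalDeRham

end

/-!
Every cohomology class of `𝒜_μ(X)` is represented by a form that is invariant under all symmetries
of the function `μ`, and an exact invariant form is the differential of an invariant form. The
invariant forms are the combinations of `1, α, β, αβ` (`m` even) or of `1, α` (`m` odd). All of
these are closed, so that none of the nonzero ones is exact, and their classes are a basis of the
cohomology.

*Invariance under dilations.* Let `E` be the Euler field of `ℝⁿ`. By Cartan's formula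
`L_E = d ι_E + ι_E d`, and the homotopy argument needs only that `𝒜_μ(X)` is the direct sum of the
kernel and the image of `L_E`. As `μ` is homogeneous of degree `2`, a form `μ^{-N} η` with `η` smooth
on the ball is in the kernel if and only if `η` has weight `2N`. The decomposition is thus one of the
forms on the ball: `Ω = ker (L_E - k) ⊕ im (L_E - k)`, which is Taylor's formula
(`exists_weightSpace_add`, `mem_weightSpace_of_sub_mem`). The kernel `weightSpace 𝕜 _ k` has finite
dimension, being described by Taylor coefficients at the origin.

*Invariance under rotations and under translations along `Y`.* Instead of averaging over a group,
the proof uses the operator `Δ = L_T - ∑ L_{ij}²` (`invariantLaplacian`), where `T` is the Euler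
field of the variables `x_{m+1}, …, x_n`, and `L_{ij}` the Lie derivative along the rotation of `x_i`
and `x_j` for `i, j ≤ m`. Again `Δ = d κ + κ d`, and `Δ` commutes with multiplication by `μ` and
with `L_E`. On each weight space it is symmetric and nonnegative for a positive definite Hermitian
form, the Fischer form, for which the adjoint of `x_i` is `∂/∂x_i` and the adjoint of `dx_i ∧` is
`ι_i`. Hence that weight space is the direct sum of the kernel and the image of `Δ`, and the forms
in the kernel are killed by all `L_{ij}` and do not involve `x_j, dx_j` for `j > m`. This gives
`exists_isInvariant_sub_d` and `IsInvariant.exists_d_eq`.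

*Classification of the invariant forms.* Let `e` be the Euler field of `x_1, …, x_m`. An invariant
form is `ξ₀ + α ξ₁` with invariant `ξ₀, ξ₁` that `ι_e` annihilates. For such a form `ξ` the equations
`L_{ij} ξ = 0` determine the derivatives of the coefficients. With these inserted they are algebraic,
and force the degree of `ξ` to be `0` or `m - 1` (`IsInvariant.iota_degreeOp`). In degree `0` the form
is a constant. In degree `m - 1` it is `ι_e (h dx_1 ∧ ⋯ ∧ dx_m)` with a function `h` of `μ` that is
homogeneous of degree `-m`. For `m` even `h` is a multiple of `μ^{-m/2}`, and the form is a multiple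
of `β` (`exists_eq_of_even`). For `m ≥ 3` odd such an `h` with poles along `Y` vanishes: its
numerator is homogeneous of odd degree and constant on circles about the origin (`exists_eq_of_odd`).

The form `β` is `ι_e` of the invariant volume `μ^{-m/2} dx_1 ∧ ⋯ ∧ dx_m`. From this follow that it is
closed, basic and invariant under `SO(m)`, and the formula for `α β`.

In the comments below, `E`, `e` and `L_{ij}` keep these meanings, and `ι_i` is the contraction with
`∂/∂x_i`.
-/

open scoped TensorProduct ContDiff

noncomputable section

namespace LocalDeRham

/-! ### Instances on functions and forms -/

section Instances

variable (𝕜 : Type*) [RCLike 𝕜] {n : ℕ} (U : TopologicalSpace.Opens (EuclideanSpace ℝ (Fin n)))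

abbrev Smooth.instCommRing : CommRing (Smooth 𝕜 U) := Subalgebra.toCommRing _

abbrev Smooth.instAlgebra : Algebra 𝕜 (Smooth 𝕜 U) := Subalgebra.algebra _

abbrev Forms.instModule : Module 𝕜 (Forms 𝕜 U) := TensorProduct.leftModule

abbrev Forms.instModuleSmooth : Module (Smooth 𝕜 U) (Forms 𝕜 U) := TensorProduct.leftModule

abbrev Forms.instDistribMulAction : DistribMulAction 𝕜 (Forms 𝕜 U) :=
  Module.toDistribMulAction

abbrev Forms.instDistribMulActionSmooth : DistribMulAction (Smooth 𝕜 U) (Forms 𝕜 U) :=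
  Module.toDistribMulAction

abbrev Forms.instMulAction : MulAction 𝕜 (Forms 𝕜 U) := DistribMulAction.toMulAction

abbrev Forms.instMulActionSmooth : MulAction (Smooth 𝕜 U) (Forms 𝕜 U) :=
  DistribMulAction.toMulAction

abbrev Forms.instDistribSMul : DistribSMul 𝕜 (Forms 𝕜 U) := DistribMulAction.toDistribSMul

abbrev Forms.instDistribSMulSmooth : DistribSMul (Smooth 𝕜 U) (Forms 𝕜 U) :=
  DistribMulAction.toDistribSMul

abbrev Forms.instSMulZeroClass : SMulZeroClass 𝕜 (Forms 𝕜 U) := DistribSMul.toSMulZeroClass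

abbrev Forms.instSMulZeroClassSmooth : SMulZeroClass (Smooth 𝕜 U) (Forms 𝕜 U) :=
  DistribSMul.toSMulZeroClass

abbrev Forms.instSMulWithZero : SMulWithZero 𝕜 (Forms 𝕜 U) :=
  MulActionWithZero.toSMulWithZero _ _

abbrev Forms.instSMulWithZeroSmooth : SMulWithZero (Smooth 𝕜 U) (Forms 𝕜 U) :=
  MulActionWithZero.toSMulWithZero _ _

abbrev Forms.instSMul : SMul 𝕜 (Forms 𝕜 U) := SMulZeroClass.toSMul

abbrev Forms.instSMulSmooth : SMul (Smooth 𝕜 U) (Forms 𝕜 U) := SMulZeroClass.toSMul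

end Instances

-- All of these are found by instance search; as shortcuts they keep the searches below short. They
-- are local, so that statements outside the namespace elaborate as without them.
attribute [local instance] Smooth.instCommRing Smooth.instAlgebra Forms.instModule
  Forms.instModuleSmooth Forms.instDistribMulAction Forms.instDistribMulActionSmooth
  Forms.instMulAction Forms.instMulActionSmooth Forms.instDistribSMul Forms.instDistribSMulSmooth
  Forms.instSMulZeroClass Forms.instSMulZeroClassSmooth Forms.instSMulWithZero
  Forms.instSMulWithZeroSmooth Forms.instSMul Forms.instSMulSmooth

/-! ### Coordinate operators on forms -/

section Operators

variable {𝕜 : Type*} [RCLike 𝕜] {n : ℕ} {U : TopologicalSpace.Opens (EuclideanSpace ℝ (Fin n))}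

/-- The partial derivative `∂/∂x_i` of the coefficients of a form. -/
def coeffDeriv (i : Fin n) : Forms 𝕜 U →ₗ[𝕜] Forms 𝕜 U :=
  LinearMap.rTensor (ConstForms 𝕜 n) (pderiv 𝕜 U i)

/-- The operator `dx_i ∧ _`. -/
def wedge (i : Fin n) : Forms 𝕜 U →ₗ[𝕜] Forms 𝕜 U :=
  LinearMap.lTensor (Smooth 𝕜 U) (LinearMap.mulLeft 𝕜 (dx 𝕜 i))

/-- The contraction with the coordinate field `∂/∂x_i`. -/
def iota (i : Fin n) : Forms 𝕜 U →ₗ[𝕜] Forms 𝕜 U :=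
  LinearMap.lTensor (Smooth 𝕜 U)
    (CliffordAlgebra.contractLeft (LinearMap.proj i : (Fin n → 𝕜) →ₗ[𝕜] 𝕜))

theorem coeffDeriv_tmul (i : Fin n) (f : Smooth 𝕜 U) (u : ConstForms 𝕜 n) :
    coeffDeriv i (f ⊗ₜ[𝕜] u : Forms 𝕜 U) = pderiv 𝕜 U i f ⊗ₜ[𝕜] u := rfl

theorem wedge_tmul (i : Fin n) (f : Smooth 𝕜 U) (u : ConstForms 𝕜 n) :
    wedge i (f ⊗ₜ[𝕜] u : Forms 𝕜 U) = f ⊗ₜ[𝕜] (dx 𝕜 i * u) := rfl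

theorem iota_tmul (i : Fin n) (f : Smooth 𝕜 U) (u : ConstForms 𝕜 n) :
    iota i (f ⊗ₜ[𝕜] u : Forms 𝕜 U) = f ⊗ₜ[𝕜] (CliffordAlgebra.contractLeft
      (LinearMap.proj i : (Fin n → 𝕜) →ₗ[𝕜] 𝕜) u) := rfl

theorem smul_tmul_form (g f : Smooth 𝕜 U) (u : ConstForms 𝕜 n) :
    g • (f ⊗ₜ[𝕜] u : Forms 𝕜 U) = (g * f) ⊗ₜ[𝕜] u := rfl

theorem ofFun_mul (f : Smooth 𝕜 U) (ξ : Forms 𝕜 U) : Forms.ofFun f * ξ = f • ξ := by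
  induction ξ using TensorProduct.induction_on with
  | zero => simp
  | add a b ha hb => rw [mul_add, ha, hb, smul_add]
  | tmul g u => rw [Forms.ofFun, Algebra.TensorProduct.tmul_mul_tmul, one_mul]; rfl

theorem smul_mul_form (f : Smooth 𝕜 U) (ξ η : Forms 𝕜 U) : (f • ξ) * η = f • (ξ * η) :=
  smul_mul_assoc f ξ η

theorem wedge_eq_mul (i : Fin n) (ξ : Forms 𝕜 U) :
    wedge i ξ = (1 ⊗ₜ[𝕜] dx 𝕜 i : Forms 𝕜 U) * ξ := by
  induction ξ using TensorProduct.induction_on with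
  | zero => simp
  | add a b ha hb => rw [mul_add, map_add, ha, hb]
  | tmul g u => rw [wedge_tmul, Algebra.TensorProduct.tmul_mul_tmul, one_mul]

theorem coeffDeriv_smul (i : Fin n) (f : Smooth 𝕜 U) (ξ : Forms 𝕜 U) :
    coeffDeriv i (f • ξ) = f • coeffDeriv i ξ + pderiv 𝕜 U i f • ξ := by
  induction ξ using TensorProduct.induction_on with
  | zero => simp
  | add a b ha hb => rw [smul_add, map_add, ha, hb, map_add, smul_add, smul_add]; abel
  | tmul g u =>
    simp only [smul_tmul_form, coeffDeriv_tmul, pderiv_mul, TensorProduct.add_tmul]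
    abel

theorem wedge_smul (i : Fin n) (f : Smooth 𝕜 U) (ξ : Forms 𝕜 U) :
    wedge i (f • ξ) = f • wedge i ξ := by
  induction ξ using TensorProduct.induction_on with
  | zero => simp
  | add a b ha hb => rw [smul_add, map_add, ha, hb, map_add, smul_add]
  | tmul g u => rfl

theorem iota_smul (i : Fin n) (f : Smooth 𝕜 U) (ξ : Forms 𝕜 U) :
    iota i (f • ξ) = f • iota i ξ := by
  induction ξ using TensorProduct.induction_on with
  | zero => simp
  | add a b ha hb => rw [smul_add, map_add, ha, hb, map_add, smul_add]
  | tmul g u => rfl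

theorem coeffDeriv_comm (i j : Fin n) (ξ : Forms 𝕜 U) :
    coeffDeriv i (coeffDeriv j ξ) = coeffDeriv j (coeffDeriv i ξ) := by
  induction ξ using TensorProduct.induction_on with
  | zero => simp
  | add a b ha hb => simp only [map_add, ha, hb]
  | tmul g u => simp only [coeffDeriv_tmul, pderiv_comm i j]

theorem wedge_coeffDeriv (i j : Fin n) (ξ : Forms 𝕜 U) :
    wedge i (coeffDeriv j ξ) = coeffDeriv j (wedge i ξ) := by
  induction ξ using TensorProduct.induction_on with
  | zero => simp
  | add a b ha hb => simp only [map_add, ha, hb]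
  | tmul g u => rfl

theorem iota_coeffDeriv (i j : Fin n) (ξ : Forms 𝕜 U) :
    iota i (coeffDeriv j ξ) = coeffDeriv j (iota i ξ) := by
  induction ξ using TensorProduct.induction_on with
  | zero => simp
  | add a b ha hb => simp only [map_add, ha, hb]
  | tmul g u => rfl

theorem wedge_wedge (i j : Fin n) (ξ : Forms 𝕜 U) :
    wedge i (wedge j ξ) = -wedge j (wedge i ξ) := by
  induction ξ using TensorProduct.induction_on with
  | zero => simp
  | add a b ha hb => simp only [map_add, ha, hb, neg_add]
  | tmul g u =>
    simp only [wedge_tmul, ← mul_assoc]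
    rw [dx_mul_dx, neg_mul, TensorProduct.tmul_neg]

theorem iota_iota (i j : Fin n) (ξ : Forms 𝕜 U) :
    iota i (iota j ξ) = -iota j (iota i ξ) := by
  induction ξ using TensorProduct.induction_on with
  | zero => simp
  | add a b ha hb => simp only [map_add, ha, hb, neg_add]
  | tmul g u =>
    simp only [iota_tmul]
    rw [CliffordAlgebra.contractLeft_comm, TensorProduct.tmul_neg]

theorem iota_self (i : Fin n) (ξ : Forms 𝕜 U) : iota i (iota i ξ) = 0 := by
  induction ξ using TensorProduct.induction_on with
  | zero => simp
  | add a b ha hb => simp only [map_add, ha, hb, add_zero]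
  | tmul g u =>
    simp only [iota_tmul]
    rw [CliffordAlgebra.contractLeft_contractLeft, TensorProduct.tmul_zero]

theorem contractLeft_dx_mul (i j : Fin n) (u : ConstForms 𝕜 n) :
    CliffordAlgebra.contractLeft (LinearMap.proj i : (Fin n → 𝕜) →ₗ[𝕜] 𝕜) (dx 𝕜 j * u) =
      (if i = j then u else 0) - dx 𝕜 j *
        CliffordAlgebra.contractLeft (LinearMap.proj i : (Fin n → 𝕜) →ₗ[𝕜] 𝕜) u := by
  refine (CliffordAlgebra.contractLeft_ι_mul _ _ _).trans ?_
  congr 1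
  by_cases h : i = j
  · subst h; simp
  · simp [h]

theorem iota_wedge (i j : Fin n) (ξ : Forms 𝕜 U) :
    iota i (wedge j ξ) = (if i = j then ξ else 0) - wedge j (iota i ξ) := by
  induction ξ using TensorProduct.induction_on with
  | zero => simp
  | add a b ha hb => simp only [map_add, ha, hb]; split_ifs <;> abel
  | tmul g u =>
    simp only [iota_tmul, wedge_tmul, contractLeft_dx_mul, TensorProduct.tmul_sub]
    split_ifs <;> simp

theorem iota_wedge_self (i : Fin n) (ξ : Forms 𝕜 U) :
    iota i (wedge i ξ) = ξ - wedge i (iota i ξ) := by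
  rw [iota_wedge, if_pos rfl]

theorem iota_wedge_of_ne {i j : Fin n} (h : i ≠ j) (ξ : Forms 𝕜 U) :
    iota i (wedge j ξ) = -wedge j (iota i ξ) := by
  rw [iota_wedge, if_neg h, zero_sub]

theorem d_eq_sum (ξ : Forms 𝕜 U) : d 𝕜 U ξ = ∑ i, coeffDeriv i (wedge i ξ) := by
  induction ξ using TensorProduct.induction_on with
  | zero => simp
  | add a b ha hb => simp only [map_add, ha, hb, Finset.sum_add_distrib]
  | tmul g u => rw [d_tmul]; rfl

theorem contract_eq_sum (V : Fin n → Smooth 𝕜 U) (ξ : Forms 𝕜 U) :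
    contract V ξ = ∑ i, V i • iota i ξ := by
  induction ξ using TensorProduct.induction_on with
  | zero => simp
  | add a b ha hb => simp only [map_add, ha, hb, smul_add, Finset.sum_add_distrib]
  | tmul g u => simp [contract, LinearMap.sum_apply, iota_tmul, smul_tmul_form]

theorem lieDeriv_apply (V : Fin n → Smooth 𝕜 U) (ξ : Forms 𝕜 U) :
    lieDeriv V ξ = d 𝕜 U (contract V ξ) + contract V (d 𝕜 U ξ) := rfl

theorem lieDeriv_d (V : Fin n → Smooth 𝕜 U) (ξ : Forms 𝕜 U) :
    lieDeriv V (d 𝕜 U ξ) = d 𝕜 U (lieDeriv V ξ) := by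
  simp [lieDeriv_apply, d_d]

/-- The Lie derivative in coordinates. -/
theorem lieDeriv_eq_sum (V : Fin n → Smooth 𝕜 U) (ξ : Forms 𝕜 U) :
    lieDeriv V ξ = ∑ k, V k • coeffDeriv k ξ +
      ∑ k, ∑ l, pderiv 𝕜 U l (V k) • wedge l (iota k ξ) := by
  have h1 : d 𝕜 U (contract V ξ) = ∑ k, ∑ l, (V k • coeffDeriv l (wedge l (iota k ξ)) +
      pderiv 𝕜 U l (V k) • wedge l (iota k ξ)) := by
    rw [d_eq_sum, contract_eq_sum, Finset.sum_comm]
    refine Finset.sum_congr rfl fun l _ => ?_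
    simp only [map_sum, wedge_smul, coeffDeriv_smul]
  have h2 : contract V (d 𝕜 U ξ) = ∑ k, V k • coeffDeriv k ξ -
      ∑ k, ∑ l, V k • coeffDeriv l (wedge l (iota k ξ)) := by
    rw [d_eq_sum, contract_eq_sum, ← Finset.sum_sub_distrib]
    refine Finset.sum_congr rfl fun k _ => ?_
    simp only [map_sum, iota_coeffDeriv, iota_wedge, map_sub, Finset.sum_sub_distrib, smul_sub,
      Finset.smul_sum]
    congr 1
    rw [Finset.sum_eq_single k]
    · simp
    · intro b _ hb; simp [hb.symm]
    · simp
  rw [lieDeriv_apply, h1, h2]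
  simp only [Finset.sum_add_distrib]
  abel

/-! ### The number operator -/

/-- The operator that multiplies a form by its degree. -/
def degreeOp : Forms 𝕜 U →ₗ[𝕜] Forms 𝕜 U := ∑ i : Fin n, wedge i ∘ₗ iota i

theorem degreeOp_apply (ξ : Forms 𝕜 U) : degreeOp ξ = ∑ i, wedge i (iota i ξ) := by
  simp [degreeOp, LinearMap.sum_apply]

theorem degreeOp_smul (f : Smooth 𝕜 U) (ξ : Forms 𝕜 U) :
    degreeOp (f • ξ) = f • degreeOp ξ := by
  simp only [degreeOp_apply, iota_smul, wedge_smul, Finset.smul_sum]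

theorem degreeOp_coeffDeriv (i : Fin n) (ξ : Forms 𝕜 U) :
    degreeOp (coeffDeriv i ξ) = coeffDeriv i (degreeOp ξ) := by
  simp only [degreeOp_apply, iota_coeffDeriv, wedge_coeffDeriv, map_sum]

theorem degreeOp_wedge (j : Fin n) (ξ : Forms 𝕜 U) :
    degreeOp (wedge j ξ) = wedge j (degreeOp ξ) + wedge j ξ := by
  have h : ∀ i, wedge i (iota i (wedge j ξ)) =
      wedge j (wedge i (iota i ξ)) + if i = j then wedge i ξ else 0 := fun i => by
    rw [iota_wedge, map_sub, wedge_wedge i j]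
    split_ifs
    · abel
    · simp
  simp only [degreeOp_apply, h, Finset.sum_add_distrib, map_sum]
  simp

theorem degreeOp_iota (j : Fin n) (ξ : Forms 𝕜 U) :
    degreeOp (iota j ξ) = iota j (degreeOp ξ) - iota j ξ := by
  have h : ∀ i, wedge i (iota i (iota j ξ)) =
      iota j (wedge i (iota i ξ)) - if j = i then iota i ξ else 0 := fun i => by
    rw [iota_wedge, iota_iota i j, map_neg]
    abel
  simp only [degreeOp_apply, h, Finset.sum_sub_distrib, map_sum]
  simp

theorem degreeOp_d (ξ : Forms 𝕜 U) :
    degreeOp (d 𝕜 U ξ) = d 𝕜 U (degreeOp ξ) + d 𝕜 U ξ := by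
  simp only [d_eq_sum, map_sum, degreeOp_coeffDeriv, degreeOp_wedge, map_add,
    Finset.sum_add_distrib]

end Operators

/-! ### Vector fields and Lie derivatives -/

section VectorFields

variable {𝕜 : Type*} [RCLike 𝕜] {n m : ℕ}
  {U V : TopologicalSpace.Opens (EuclideanSpace ℝ (Fin n))}

theorem pderiv_apply (i : Fin n) (f : Smooth 𝕜 U) (x : U) :
    (pderiv 𝕜 U i f).1 x =
      fderiv ℝ (extend f.1) (x : EuclideanSpace ℝ (Fin n)) (EuclideanSpace.single i 1) := rfl

theorem pderiv_mk_apply (i : Fin n) (g : EuclideanSpace ℝ (Fin n) → 𝕜) (hg : ContDiffOn ℝ ∞ g U)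
    (x : U) : (pderiv 𝕜 U i (Smooth.mk g hg)).1 x =
      fderiv ℝ g (x : EuclideanSpace ℝ (Fin n)) (EuclideanSpace.single i 1) := by
  rw [pderiv_apply, fderiv_eq_of_eq (g := extend (Smooth.mk g hg).1) (h := g)
    (fun y => extend_coe _ y) x]

theorem pderiv_algebraMap (i : Fin n) (c : 𝕜) :
    pderiv 𝕜 U i (algebraMap 𝕜 (Smooth 𝕜 U) c) = 0 := by
  have h1 : pderiv 𝕜 U i 1 = 0 := by
    have h := pderiv_mul i (1 : Smooth 𝕜 U) 1
    rw [mul_one, mul_one, one_mul] at h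
    exact left_eq_add.mp h
  rw [Algebra.algebraMap_eq_smul_one, map_smul, h1, smul_zero]

theorem pderiv_one (i : Fin n) : pderiv 𝕜 U i 1 = 0 := by
  simpa using pderiv_algebraMap (𝕜 := 𝕜) (U := U) i 1

theorem fderiv_ofReal (g : EuclideanSpace ℝ (Fin n) → ℝ) (x v : EuclideanSpace ℝ (Fin n))
    (hg : DifferentiableAt ℝ g x) :
    fderiv ℝ (fun y => ((g y : ℝ) : 𝕜)) x v = ((fderiv ℝ g x v : ℝ) : 𝕜) := by
  have h := ((RCLike.ofRealCLM (K := 𝕜)).hasFDerivAt.comp x hg.hasFDerivAt).fderiv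
  have h2 : (fun y => ((g y : ℝ) : 𝕜)) = (RCLike.ofRealCLM (K := 𝕜)) ∘ g := rfl
  rw [h2, h]
  rfl

theorem pderiv_coord (i j : Fin n) :
    pderiv 𝕜 U j (coord 𝕜 U i) = if i = j then 1 else 0 := by
  ext x
  rw [coord, pderiv_mk_apply, fderiv_ofReal _ _ _ (by fun_prop)]
  have : fderiv ℝ (fun y : EuclideanSpace ℝ (Fin n) => y i) (x : EuclideanSpace ℝ (Fin n)) =
      EuclideanSpace.proj i := (EuclideanSpace.proj i : EuclideanSpace ℝ (Fin n) →L[ℝ] ℝ).fderiv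
  rw [this]
  by_cases h : i = j
  · subst h; simp
  · simp [h]

theorem muFun_eq_sum (hmn : m ≤ n) : muFun 𝕜 hmn U =
    ∑ i : Fin m, coord 𝕜 U (Fin.castLE hmn i) * coord 𝕜 U (Fin.castLE hmn i) := by
  ext x
  rw [AddSubmonoidClass.coe_finsetSum, Finset.sum_apply]
  simp [muFun, coord, Smooth.mk, mu, pow_two]

/-- The derivative of `f` along the vector field `V`. -/
def dirDeriv (V : Fin n → Smooth 𝕜 U) (f : Smooth 𝕜 U) : Smooth 𝕜 U :=
  ∑ k, V k * pderiv 𝕜 U k f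

theorem dirDeriv_mul (V : Fin n → Smooth 𝕜 U) (f g : Smooth 𝕜 U) :
    dirDeriv V (f * g) = dirDeriv V f * g + f * dirDeriv V g := by
  simp only [dirDeriv, Finset.sum_mul, Finset.mul_sum, ← Finset.sum_add_distrib]
  refine Finset.sum_congr rfl fun k _ => ?_
  rw [pderiv_mul]; ring

theorem dirDeriv_one (V : Fin n → Smooth 𝕜 U) : dirDeriv V 1 = 0 := by
  simp [dirDeriv, pderiv_one]

theorem dirDeriv_add (V : Fin n → Smooth 𝕜 U) (f g : Smooth 𝕜 U) :
    dirDeriv V (f + g) = dirDeriv V f + dirDeriv V g := by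
  simp [dirDeriv, mul_add, Finset.sum_add_distrib]

theorem dirDeriv_pow_eq_zero {V : Fin n → Smooth 𝕜 U} {f : Smooth 𝕜 U} (h : dirDeriv V f = 0)
    (N : ℕ) : dirDeriv V (f ^ N) = 0 := by
  induction N with
  | zero => simp [dirDeriv_one]
  | succ N ih => rw [pow_succ, dirDeriv_mul, ih, h]; simp

theorem dirDeriv_pow_of_eq_smul {V : Fin n → Smooth 𝕜 U} {f : Smooth 𝕜 U} {c : 𝕜}
    (h : dirDeriv V f = c • f) (N : ℕ) : dirDeriv V (f ^ N) = ((N : 𝕜) * c) • f ^ N := by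
  induction N with
  | zero => rw [pow_zero, dirDeriv_one, Nat.cast_zero, zero_mul, zero_smul]
  | succ N ih =>
    rw [pow_succ, dirDeriv_mul, ih, h, smul_mul_assoc, mul_smul_comm, ← add_smul]
    push_cast
    congr 1
    ring

theorem pderiv_eq_dirDeriv (i : Fin n) (f : Smooth 𝕜 U) :
    pderiv 𝕜 U i f = dirDeriv (Pi.single i 1) f := by
  rw [dirDeriv, Finset.sum_eq_single i]
  · simp
  · intro b _ hb; simp [hb]
  · simp

theorem lieDeriv_smul (V : Fin n → Smooth 𝕜 U) (f : Smooth 𝕜 U) (ξ : Forms 𝕜 U) :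
    lieDeriv V (f • ξ) = f • lieDeriv V ξ + dirDeriv V f • ξ := by
  simp only [lieDeriv_eq_sum, coeffDeriv_smul, iota_smul, wedge_smul, smul_add, dirDeriv,
    Finset.sum_smul, Finset.smul_sum, Finset.sum_add_distrib, smul_smul, mul_comm f]
  abel

/-- The Euler field `∑_i x_i ∂/∂x_i` of `ℝⁿ`. -/
def radial (𝕜 : Type*) [RCLike 𝕜] {n : ℕ}
    (U : TopologicalSpace.Opens (EuclideanSpace ℝ (Fin n))) : Fin n → Smooth 𝕜 U := coord 𝕜 U

/-- The part `∑_{i > m} x_i ∂/∂x_i` of the Euler field that is tangent to `Y`. -/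
def tangential (𝕜 : Type*) [RCLike 𝕜] {n : ℕ} (m : ℕ)
    (U : TopologicalSpace.Opens (EuclideanSpace ℝ (Fin n))) (i : Fin n) : Smooth 𝕜 U :=
  if (i : ℕ) < m then 0 else coord 𝕜 U i

/-- The infinitesimal rotation `x_i ∂/∂x_j - x_j ∂/∂x_i`. -/
def rotation (𝕜 : Type*) [RCLike 𝕜] {n : ℕ}
    (U : TopologicalSpace.Opens (EuclideanSpace ℝ (Fin n))) (i j : Fin n) :
    Fin n → Smooth 𝕜 U :=
  Pi.single j (coord 𝕜 U i) - Pi.single i (coord 𝕜 U j)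

theorem sum_single_smul (j : Fin n) (f : Smooth 𝕜 U) (F : Fin n → Forms 𝕜 U) :
    ∑ k, (Pi.single j f : Fin n → Smooth 𝕜 U) k • F k = f • F j := by
  rw [Finset.sum_eq_single j]
  · simp
  · intro b _ hb; simp [hb]
  · simp

theorem dirDeriv_rotation (i j : Fin n) (f : Smooth 𝕜 U) :
    dirDeriv (rotation 𝕜 U i j) f =
      coord 𝕜 U i * pderiv 𝕜 U j f - coord 𝕜 U j * pderiv 𝕜 U i f := by
  simp only [dirDeriv, rotation, Pi.sub_apply, sub_mul, Finset.sum_sub_distrib]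
  congr 1
  · rw [Finset.sum_eq_single j]
    · simp
    · intro b _ hb; simp [hb]
    · simp
  · rw [Finset.sum_eq_single i]
    · simp
    · intro b _ hb; simp [hb]
    · simp

theorem lieDeriv_radial (ξ : Forms 𝕜 U) :
    lieDeriv (radial 𝕜 U) ξ = ∑ k, coord 𝕜 U k • coeffDeriv k ξ + degreeOp ξ := by
  rw [lieDeriv_eq_sum, degreeOp_apply]
  congr 1
  refine Finset.sum_congr rfl fun k _ => ?_
  simp [radial, pderiv_coord]

theorem lieDeriv_rotation (i j : Fin n) (ξ : Forms 𝕜 U) :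
    lieDeriv (rotation 𝕜 U i j) ξ =
      coord 𝕜 U i • coeffDeriv j ξ - coord 𝕜 U j • coeffDeriv i ξ +
        (wedge i (iota j ξ) - wedge j (iota i ξ)) := by
  rw [lieDeriv_eq_sum]
  congr 1
  · simp only [rotation, Pi.sub_apply, sub_smul, Finset.sum_sub_distrib, sum_single_smul]
  · have h : ∀ a b k l : Fin n, pderiv 𝕜 U l ((Pi.single a (coord 𝕜 U b) : Fin n → Smooth 𝕜 U) k) =
        if k = a then if b = l then 1 else 0 else 0 := fun a b k l => by
      by_cases hk : k = a
      · subst hk; simp [pderiv_coord]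
      · simp [hk]
    simp only [rotation, Pi.sub_apply, map_sub, h, sub_smul, Finset.sum_sub_distrib]
    simp

theorem lieDeriv_tangential (ξ : Forms 𝕜 U) :
    lieDeriv (tangential 𝕜 m U) ξ = ∑ k : Fin n, if (k : ℕ) < m then 0 else
      (coord 𝕜 U k • coeffDeriv k ξ + wedge k (iota k ξ)) := by
  rw [lieDeriv_eq_sum, ← Finset.sum_add_distrib]
  refine Finset.sum_congr rfl fun k _ => ?_
  by_cases h : (k : ℕ) < m <;> simp [tangential, h, pderiv_coord]

theorem lieDeriv_radial_smul_coord (i : Fin n) (ξ : Forms 𝕜 U) :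
    lieDeriv (radial 𝕜 U) (coord 𝕜 U i • ξ) =
      coord 𝕜 U i • lieDeriv (radial 𝕜 U) ξ + coord 𝕜 U i • ξ := by
  rw [lieDeriv_smul]
  simp [dirDeriv, pderiv_coord, radial]

theorem lieDeriv_radial_coeffDeriv (i : Fin n) (ξ : Forms 𝕜 U) :
    lieDeriv (radial 𝕜 U) (coeffDeriv i ξ) =
      coeffDeriv i (lieDeriv (radial 𝕜 U) ξ) - coeffDeriv i ξ := by
  simp only [lieDeriv_radial, map_add, map_sum, coeffDeriv_smul, degreeOp_coeffDeriv,
    Finset.sum_add_distrib, pderiv_coord, ite_smul, zero_smul, one_smul, coeffDeriv_comm _ i]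
  simp only [Finset.sum_ite_eq', Finset.mem_univ, if_true]
  abel

theorem lieDeriv_radial_wedge (i : Fin n) (ξ : Forms 𝕜 U) :
    lieDeriv (radial 𝕜 U) (wedge i ξ) =
      wedge i (lieDeriv (radial 𝕜 U) ξ) + wedge i ξ := by
  simp only [lieDeriv_radial, map_add, map_sum, wedge_smul, degreeOp_wedge, wedge_coeffDeriv]
  abel

theorem lieDeriv_radial_iota (i : Fin n) (ξ : Forms 𝕜 U) :
    lieDeriv (radial 𝕜 U) (iota i ξ) =
      iota i (lieDeriv (radial 𝕜 U) ξ) - iota i ξ := by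
  simp only [lieDeriv_radial, map_add, map_sum, iota_smul, degreeOp_iota, iota_coeffDeriv]
  abel

theorem dirDeriv_radial_coord (i : Fin n) :
    dirDeriv (radial 𝕜 U) (coord 𝕜 U i) = coord 𝕜 U i := by
  simp [dirDeriv, pderiv_coord, radial]

/-- The contraction with a vector field that has homogeneous coefficients of degree one commutes
with the dilations. -/
theorem lieDeriv_radial_contract {V : Fin n → Smooth 𝕜 U}
    (hV : ∀ k, dirDeriv (radial 𝕜 U) (V k) = V k) (ξ : Forms 𝕜 U) :
    lieDeriv (radial 𝕜 U) (contract V ξ) = contract V (lieDeriv (radial 𝕜 U) ξ) := by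
  simp only [contract_eq_sum, map_sum, lieDeriv_smul, lieDeriv_radial_iota, hV]
  refine Finset.sum_congr rfl fun k _ => ?_
  rw [smul_sub, sub_add_cancel]

theorem lieDeriv_radial_lieDeriv {V : Fin n → Smooth 𝕜 U}
    (hV : ∀ k, dirDeriv (radial 𝕜 U) (V k) = V k) (ξ : Forms 𝕜 U) :
    lieDeriv (radial 𝕜 U) (lieDeriv V ξ) = lieDeriv V (lieDeriv (radial 𝕜 U) ξ) := by
  rw [lieDeriv_apply V, lieDeriv_apply V, map_add, lieDeriv_d, lieDeriv_radial_contract hV,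
    lieDeriv_radial_contract hV, lieDeriv_d]

theorem dirDeriv_zero (V : Fin n → Smooth 𝕜 U) : dirDeriv V 0 = 0 := by
  simp [dirDeriv]

theorem dirDeriv_neg (V : Fin n → Smooth 𝕜 U) (f : Smooth 𝕜 U) :
    dirDeriv V (-f) = -dirDeriv V f := by
  refine eq_neg_of_add_eq_zero_left ?_
  rw [← dirDeriv_add, neg_add_cancel, dirDeriv_zero]

theorem dirDeriv_radial_rotation (i j k : Fin n) :
    dirDeriv (radial 𝕜 U) (rotation 𝕜 U i j k) = rotation 𝕜 U i j k := by
  simp only [rotation, Pi.sub_apply, Pi.single_apply, sub_eq_add_neg, dirDeriv_add, dirDeriv_neg]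
  split_ifs <;> simp [dirDeriv_radial_coord, dirDeriv_zero]

theorem dirDeriv_radial_tangential (k : Fin n) :
    dirDeriv (radial 𝕜 U) (tangential 𝕜 m U k) = tangential 𝕜 m U k := by
  rw [tangential]
  split_ifs
  · exact dirDeriv_zero _
  · exact dirDeriv_radial_coord k

theorem pderiv_muFun (hmn : m ≤ n) (k : Fin n) : pderiv 𝕜 U k (muFun 𝕜 hmn U) =
    if (k : ℕ) < m then 2 * coord 𝕜 U k else 0 := by
  rw [muFun_eq_sum, map_sum]
  simp only [pderiv_mul, pderiv_coord, ite_mul, mul_ite, mul_one, one_mul, zero_mul, mul_zero]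
  split_ifs with h
  · rw [Finset.sum_eq_single (⟨k, h⟩ : Fin m)]
    · have : Fin.castLE hmn ⟨k, h⟩ = k := rfl
      simp only [this, if_true]; ring
    · intro b _ hb
      have : Fin.castLE hmn b ≠ k := fun e => hb (Fin.ext (by simpa using congrArg Fin.val e))
      simp [this]
    · simp
  · refine Finset.sum_eq_zero fun i _ => ?_
    have : Fin.castLE hmn i ≠ k := fun e => h (by rw [← e]; exact i.2)
    simp [this]

theorem sum_castLE {M : Type*} [AddCommMonoid M] (hmn : m ≤ n) (F : Fin n → M) :
    ∑ i : Fin m, F (Fin.castLE hmn i) = ∑ k : Fin n, if (k : ℕ) < m then F k else 0 := by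
  rw [← Finset.sum_filter]
  refine Finset.sum_bij (fun i _ => Fin.castLE hmn i) ?_ ?_ ?_ ?_
  · intro i _; simp
  · intro i _ j _ h; exact Fin.castLE_injective hmn h
  · intro k hk
    exact ⟨⟨k, (Finset.mem_filter.mp hk).2⟩, Finset.mem_univ _, rfl⟩
  · intro i _; rfl

theorem dirDeriv_radial_muFun (hmn : m ≤ n) :
    dirDeriv (radial 𝕜 U) (muFun 𝕜 hmn U) = (2 : 𝕜) • muFun 𝕜 hmn U := by
  conv_rhs => rw [muFun_eq_sum, sum_castLE hmn fun k => coord 𝕜 U k * coord 𝕜 U k]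
  rw [dirDeriv, Finset.smul_sum]
  refine Finset.sum_congr rfl fun k _ => ?_
  rw [pderiv_muFun, radial]
  split_ifs
  · rw [two_smul]; ring
  · simp

theorem dirDeriv_tangential_muFun (hmn : m ≤ n) :
    dirDeriv (tangential 𝕜 m U) (muFun 𝕜 hmn U) = 0 := by
  refine Finset.sum_eq_zero fun k _ => ?_
  rw [pderiv_muFun, tangential]
  split_ifs <;> simp

theorem dirDeriv_rotation_muFun (hmn : m ≤ n) {i j : Fin n} (hi : (i : ℕ) < m)
    (hj : (j : ℕ) < m) : dirDeriv (rotation 𝕜 U i j) (muFun 𝕜 hmn U) = 0 := by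
  rw [dirDeriv_rotation, pderiv_muFun, pderiv_muFun, if_pos hi, if_pos hj]
  ring

/-! ### The invariant Laplacian and its homotopy -/

/-- The operator `L_V - ∑_{i,j ≤ m} L_{ij}²`, where `V` is the tangential part of the Euler field and
`L_{ij}` is the Lie derivative along the rotation field `x_i ∂/∂x_j - x_j ∂/∂x_i`. On the forms of
positive weight it is symmetric for a definite form, and its kernel consists of the forms in
`x_1, …, x_m` only that are invariant under rotations. -/
def invariantLaplacian (hmn : m ≤ n) : Forms 𝕜 U →ₗ[𝕜] Forms 𝕜 U :=
  lieDeriv (tangential 𝕜 m U) - ∑ i : Fin m, ∑ j : Fin m,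
    lieDeriv (rotation 𝕜 U (Fin.castLE hmn i) (Fin.castLE hmn j)) ∘ₗ
      lieDeriv (rotation 𝕜 U (Fin.castLE hmn i) (Fin.castLE hmn j))

/-- The operator `κ = ι_V - ∑_{i,j ≤ m} ι_{ij} L_{ij}`, for which `dκ + κd` is the invariant
Laplacian. -/
def invariantHomotopy (hmn : m ≤ n) : Forms 𝕜 U →ₗ[𝕜] Forms 𝕜 U :=
  contract (tangential 𝕜 m U) - ∑ i : Fin m, ∑ j : Fin m,
    contract (rotation 𝕜 U (Fin.castLE hmn i) (Fin.castLE hmn j)) ∘ₗ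
      lieDeriv (rotation 𝕜 U (Fin.castLE hmn i) (Fin.castLE hmn j))

theorem invariantLaplacian_apply (hmn : m ≤ n) (ξ : Forms 𝕜 U) :
    invariantLaplacian hmn ξ = lieDeriv (tangential 𝕜 m U) ξ - ∑ i : Fin m, ∑ j : Fin m,
      lieDeriv (rotation 𝕜 U (Fin.castLE hmn i) (Fin.castLE hmn j))
        (lieDeriv (rotation 𝕜 U (Fin.castLE hmn i) (Fin.castLE hmn j)) ξ) := by
  simp [invariantLaplacian, LinearMap.sum_apply]

theorem invariantHomotopy_apply (hmn : m ≤ n) (ξ : Forms 𝕜 U) :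
    invariantHomotopy hmn ξ = contract (tangential 𝕜 m U) ξ - ∑ i : Fin m, ∑ j : Fin m,
      contract (rotation 𝕜 U (Fin.castLE hmn i) (Fin.castLE hmn j))
        (lieDeriv (rotation 𝕜 U (Fin.castLE hmn i) (Fin.castLE hmn j)) ξ) := by
  simp [invariantHomotopy, LinearMap.sum_apply]

theorem invariantLaplacian_eq (hmn : m ≤ n) (ξ : Forms 𝕜 U) :
    invariantLaplacian hmn ξ =
      d 𝕜 U (invariantHomotopy hmn ξ) + invariantHomotopy hmn (d 𝕜 U ξ) := by
  simp only [invariantLaplacian_apply, invariantHomotopy_apply, map_sub, map_sum, lieDeriv_d]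
  rw [sub_add_sub_comm, ← Finset.sum_add_distrib]
  congr 1
  refine Finset.sum_congr rfl fun i _ => ?_
  rw [← Finset.sum_add_distrib]
  refine Finset.sum_congr rfl fun j _ => ?_
  rw [lieDeriv_apply]

theorem lieDeriv_radial_invariantHomotopy (hmn : m ≤ n) (ξ : Forms 𝕜 U) :
    lieDeriv (radial 𝕜 U) (invariantHomotopy hmn ξ) =
      invariantHomotopy hmn (lieDeriv (radial 𝕜 U) ξ) := by
  simp only [invariantHomotopy_apply, map_sub, map_sum,
    lieDeriv_radial_contract (dirDeriv_radial_rotation _ _),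
    lieDeriv_radial_lieDeriv (dirDeriv_radial_rotation _ _),
    lieDeriv_radial_contract (dirDeriv_radial_tangential)]

theorem lieDeriv_radial_invariantLaplacian (hmn : m ≤ n) (ξ : Forms 𝕜 U) :
    lieDeriv (radial 𝕜 U) (invariantLaplacian hmn ξ) =
      invariantLaplacian hmn (lieDeriv (radial 𝕜 U) ξ) := by
  simp only [invariantLaplacian_eq, map_add, lieDeriv_d, lieDeriv_radial_invariantHomotopy]

/-- The invariant Laplacian is linear over the functions of `μ`. -/
theorem invariantLaplacian_smul (hmn : m ≤ n) {f : Smooth 𝕜 U}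
    (ht : dirDeriv (tangential 𝕜 m U) f = 0)
    (hr : ∀ i j : Fin n, (i : ℕ) < m → (j : ℕ) < m → dirDeriv (rotation 𝕜 U i j) f = 0)
    (ξ : Forms 𝕜 U) :
    invariantLaplacian hmn (f • ξ) = f • invariantLaplacian hmn ξ := by
  have hr' : ∀ i j : Fin m, dirDeriv (rotation 𝕜 U (Fin.castLE hmn i) (Fin.castLE hmn j)) f = 0 :=
    fun i j => hr _ _ i.2 j.2
  simp only [invariantLaplacian_apply, lieDeriv_smul, ht, hr', zero_smul, add_zero, smul_sub,
    Finset.smul_sum]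

/-! ### Restriction to a smaller open set -/

theorem restrict_smul (h : U ≤ V) (f : Smooth 𝕜 V) (ξ : Forms 𝕜 V) :
    restrict 𝕜 h (f • ξ) = restrictFun 𝕜 h f • restrict 𝕜 h ξ := by
  rw [← ofFun_mul, ← ofFun_mul, map_mul]
  rfl

theorem restrict_coeffDeriv (h : U ≤ V) (i : Fin n) (ξ : Forms 𝕜 V) :
    coeffDeriv i (restrict 𝕜 h ξ) = restrict 𝕜 h (coeffDeriv i ξ) := by
  induction ξ using TensorProduct.induction_on with
  | zero => simp
  | add a b ha hb => simp only [map_add, ha, hb]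
  | tmul g u => simp only [restrict_tmul, coeffDeriv_tmul, pderiv_restrictFun]

theorem restrict_wedge (h : U ≤ V) (i : Fin n) (ξ : Forms 𝕜 V) :
    wedge i (restrict 𝕜 h ξ) = restrict 𝕜 h (wedge i ξ) := by
  induction ξ using TensorProduct.induction_on with
  | zero => simp
  | add a b ha hb => simp only [map_add, ha, hb]
  | tmul g u => simp only [restrict_tmul, wedge_tmul]

theorem restrict_iota (h : U ≤ V) (i : Fin n) (ξ : Forms 𝕜 V) :
    iota i (restrict 𝕜 h ξ) = restrict 𝕜 h (iota i ξ) := by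
  induction ξ using TensorProduct.induction_on with
  | zero => simp
  | add a b ha hb => simp only [map_add, ha, hb]
  | tmul g u => simp only [restrict_tmul, iota_tmul]

theorem restrict_contract (h : U ≤ V) {X : Fin n → Smooth 𝕜 V} {X' : Fin n → Smooth 𝕜 U}
    (hX : ∀ k, restrictFun 𝕜 h (X k) = X' k) (ξ : Forms 𝕜 V) :
    contract X' (restrict 𝕜 h ξ) = restrict 𝕜 h (contract X ξ) := by
  simp only [contract_eq_sum, map_sum, restrict_smul, hX, restrict_iota]

theorem restrict_lieDeriv (h : U ≤ V) {X : Fin n → Smooth 𝕜 V} {X' : Fin n → Smooth 𝕜 U}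
    (hX : ∀ k, restrictFun 𝕜 h (X k) = X' k) (ξ : Forms 𝕜 V) :
    lieDeriv X' (restrict 𝕜 h ξ) = restrict 𝕜 h (lieDeriv X ξ) := by
  simp only [lieDeriv_apply, map_add, d_restrict, restrict_contract h hX]

theorem restrictFun_coord (h : U ≤ V) (i : Fin n) :
    restrictFun 𝕜 h (coord 𝕜 V i) = coord 𝕜 U i := rfl

theorem restrictFun_muFun (h : U ≤ V) (hmn : m ≤ n) :
    restrictFun 𝕜 h (muFun 𝕜 hmn V) = muFun 𝕜 hmn U := rfl

theorem restrictFun_radial (h : U ≤ V) (k : Fin n) :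
    restrictFun 𝕜 h (radial 𝕜 V k) = radial 𝕜 U k := rfl

theorem restrictFun_rotation (h : U ≤ V) (i j k : Fin n) :
    restrictFun 𝕜 h (rotation 𝕜 V i j k) = rotation 𝕜 U i j k := by
  simp only [rotation, Pi.sub_apply, Pi.single_apply, map_sub]
  split_ifs <;> simp [restrictFun_coord]

theorem restrictFun_tangential (h : U ≤ V) (k : Fin n) :
    restrictFun 𝕜 h (tangential 𝕜 m V k) = tangential 𝕜 m U k := by
  rw [tangential, tangential]
  split_ifs
  · exact map_zero _
  · rfl

theorem restrict_invariantLaplacian (h : U ≤ V) (hmn : m ≤ n) (ξ : Forms 𝕜 V) :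
    invariantLaplacian hmn (restrict 𝕜 h ξ) = restrict 𝕜 h (invariantLaplacian hmn ξ) := by
  simp only [invariantLaplacian_apply, map_sub, map_sum,
    restrict_lieDeriv h (restrictFun_tangential h),
    restrict_lieDeriv h (restrictFun_rotation h _ _)]

end VectorFields

/-! ### Radial integrals -/

section ParametricIntegral

variable {E : Type} [NormedAddCommGroup E] [NormedSpace ℝ E]

theorem smul_mem_ball {R : ℝ} {x : E} (hx : x ∈ Metric.ball (0 : E) R) {t : ℝ} (h0 : 0 ≤ t)
    (h1 : t ≤ 1) : t • x ∈ Metric.ball (0 : E) R := by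
  rw [mem_ball_zero_iff] at hx ⊢
  rw [norm_smul, Real.norm_of_nonneg h0]
  exact (mul_le_of_le_one_left (norm_nonneg x) h1).trans_lt hx

theorem continuousOn_radial {G : Type*} [NormedAddCommGroup G] [NormedSpace ℝ G] {R : ℝ}
    {F : E → G} (hF : ContinuousOn F (Metric.ball 0 R)) {x : E} (hx : x ∈ Metric.ball (0 : E) R)
    (p : ℕ) : ContinuousOn (fun t : ℝ => t ^ p • F (t • x)) (Set.uIcc 0 1) := by
  rw [Set.uIcc_of_le zero_le_one]
  refine (continuousOn_id.pow p).smul (hF.comp (by fun_prop) ?_)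
  exact fun t ht => smul_mem_ball hx ht.1 ht.2

/-- Differentiation under the integral sign: the domination comes from the compactness of a smaller
closed ball around the origin, which contains the segments `[0, x]` for all `x` near `x₀`. -/
theorem hasFDerivAt_radial_integral [ProperSpace E] {G : Type*} [NormedAddCommGroup G] [NormedSpace ℝ G]
    {R : ℝ} {F : E → G} (hF : ContDiffOn ℝ 1 F (Metric.ball 0 R)) (p : ℕ) {x₀ : E}
    (hx₀ : x₀ ∈ Metric.ball (0 : E) R) :
    HasFDerivAt (fun x => ∫ t in (0 : ℝ)..1, t ^ p • F (t • x))
      (∫ t in (0 : ℝ)..1, t ^ (p + 1) • fderiv ℝ F (t • x₀)) x₀ := by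
  have hF' : ContinuousOn (fderiv ℝ F) (Metric.ball 0 R) :=
    hF.continuousOn_fderiv_of_isOpen Metric.isOpen_ball le_rfl
  have hx₀' : ‖x₀‖ < R := mem_ball_zero_iff.mp hx₀
  obtain ⟨r, hr₀, hr⟩ := exists_between hx₀'
  obtain ⟨C, hC⟩ := (isCompact_closedBall (0 : E) r).exists_bound_of_continuousOn
    (hF'.mono (Metric.closedBall_subset_ball hr))
  have hs : Metric.ball (0 : E) r ∈ nhds x₀ :=
    Metric.isOpen_ball.mem_nhds (mem_ball_zero_iff.mpr hr₀)
  have hsub : Metric.ball (0 : E) r ⊆ Metric.ball 0 R := Metric.ball_subset_ball hr.le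
  have hI : Set.uIoc (0 : ℝ) 1 ⊆ Set.uIcc 0 1 := Set.uIoc_subset_uIcc
  refine (intervalIntegral.hasFDerivAt_integral_of_dominated_of_fderiv_le
    (F' := fun x t => t ^ (p + 1) • fderiv ℝ F (t • x)) (bound := fun _ => C) hs ?_ ?_ ?_ ?_ ?_ ?_)
  · filter_upwards [hs] with x hx
    exact (continuousOn_radial hF.continuousOn (hsub hx) p).intervalIntegrable.def'.aestronglyMeasurable
  · exact (continuousOn_radial hF.continuousOn hx₀ p).intervalIntegrable
  · exact (continuousOn_radial hF' hx₀ (p + 1)).intervalIntegrable.def'.aestronglyMeasurable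
  · refine Filter.Eventually.of_forall fun t ht x hx => ?_
    have ht' := Set.uIoc_of_le (zero_le_one (α := ℝ)) ▸ ht
    have h1 : ‖fderiv ℝ F (t • x)‖ ≤ C :=
      hC _ (Metric.ball_subset_closedBall (smul_mem_ball hx ht'.1.le ht'.2))
    rw [norm_smul, norm_pow, Real.norm_of_nonneg ht'.1.le]
    exact (mul_le_of_le_one_left (norm_nonneg _) (pow_le_one₀ ht'.1.le ht'.2)).trans h1
  · exact intervalIntegrable_const
  · refine Filter.Eventually.of_forall fun t ht x hx => ?_
    have ht' := Set.uIoc_of_le (zero_le_one (α := ℝ)) ▸ ht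
    have hd : HasFDerivAt F (fderiv ℝ F (t • x)) (t • x) :=
      ((hF.contDiffAt (Metric.isOpen_ball.mem_nhds
        (smul_mem_ball (hsub hx) ht'.1.le ht'.2))).differentiableAt one_ne_zero).hasFDerivAt
    have h2 := (hd.comp x ((hasFDerivAt_id x).const_smul t)).const_smul (t ^ p)
    refine h2.congr_fderiv ?_
    ext v
    simp [pow_succ, mul_smul]

/-- The derivative of a radial integral is a radial integral of the derivative, so that the
induction has to allow for all target spaces `G`. -/
theorem contDiffOn_radial_integral.{u} [ProperSpace E] {R : ℝ} (k : ℕ) :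
    ∀ {G : Type u} [NormedAddCommGroup G] [NormedSpace ℝ G] {F : E → G} (p : ℕ),
    ContDiffOn ℝ (k + 1 : ℕ) F (Metric.ball 0 R) →
    ContDiffOn ℝ k (fun x => ∫ t in (0 : ℝ)..1, t ^ p • F (t • x)) (Metric.ball 0 R) := by
  induction k with
  | zero =>
    intro G hG₁ hG₂ F p hF
    have h : ∀ x ∈ Metric.ball (0 : E) R, ContinuousWithinAt
        (fun x => ∫ t in (0 : ℝ)..1, t ^ p • F (t • x)) (Metric.ball 0 R) x := fun x hx =>
      (hasFDerivAt_radial_integral (by simpa using hF) p hx).continuousAt.continuousWithinAt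
    exact_mod_cast contDiffOn_zero.mpr h
  | succ k ih =>
    intro G _ _ F p hF
    have h1 : ContDiffOn ℝ 1 F (Metric.ball 0 R) := hF.of_le (by
      norm_cast; omega)
    have hF2 : ContDiffOn ℝ (k + 1 : ℕ) (fderiv ℝ F) (Metric.ball 0 R) :=
      hF.fderiv_of_isOpen Metric.isOpen_ball (by norm_cast)
    push_cast
    rw [contDiffOn_succ_iff_fderiv_of_isOpen Metric.isOpen_ball]
    refine ⟨fun x hx => (hasFDerivAt_radial_integral h1 p hx).differentiableAt
      |>.differentiableWithinAt, by simp, ?_⟩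
    exact (ih (p + 1) hF2).congr fun x hx => (hasFDerivAt_radial_integral h1 p hx).fderiv

end ParametricIntegral

/-! ### Homogeneous functions on a ball -/

section HomogeneousFunctions

variable {𝕜 : Type*} [RCLike 𝕜] {n m : ℕ}
  {U V : TopologicalSpace.Opens (EuclideanSpace ℝ (Fin n))} {R : ℝ}

theorem fderiv_extend_apply (f : Smooth 𝕜 U) (x : U) (v : EuclideanSpace ℝ (Fin n)) :
    fderiv ℝ (extend f.1) (x : EuclideanSpace ℝ (Fin n)) v =
      ∑ i, ((v i : ℝ) : 𝕜) * (pderiv 𝕜 U i f).1 x := by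
  have hv : v = ∑ k, v k • EuclideanSpace.single k (1 : ℝ) := by
    ext j
    simp [Pi.single_apply]
  conv_lhs => rw [hv, map_sum]
  refine Finset.sum_congr rfl fun k _ => ?_
  rw [map_smul, RCLike.real_smul_eq_coe_mul]
  rfl

theorem dirDeriv_radial_apply (f : Smooth 𝕜 U) (x : U) :
    (dirDeriv (radial 𝕜 U) f).1 x = fderiv ℝ (extend f.1) (x : EuclideanSpace ℝ (Fin n)) x := by
  rw [dirDeriv, AddSubmonoidClass.coe_finsetSum, Finset.sum_apply, fderiv_extend_apply]
  rfl

theorem hasDerivAt_ray (f : Smooth 𝕜 (ball n R)) (p : ℕ) {x : EuclideanSpace ℝ (Fin n)} {t : ℝ}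
    (ht : t • x ∈ ball n R) :
    HasDerivAt (fun t : ℝ => t ^ (p + 1) • extend f.1 (t • x))
      (t ^ p • (extend (dirDeriv (radial 𝕜 _) f).1 (t • x) + ((p + 1 : ℕ) : ℝ) •
        extend f.1 (t • x))) t := by
  have hd := (differentiableAt_extend f ⟨t • x, ht⟩).hasFDerivAt
  have h2 := hd.comp_hasDerivAt t ((hasDerivAt_id t).smul_const x)
  have h3 := (hasDerivAt_pow (p + 1) t).smul h2
  refine h3.congr_deriv ?_
  rw [extend_coe (dirDeriv (radial 𝕜 _) f).1 ⟨t • x, ht⟩, dirDeriv_radial_apply]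
  simp only [id, one_smul, map_smul, smul_add, smul_smul, Function.comp, add_tsub_cancel_right]
  rw [pow_succ, mul_comm (t ^ p) ((p + 1 : ℕ) : ℝ)]

/-- `(E + p + 1) g = f` has a solution for every smooth `f` on a ball, namely
`g(x) = ∫₀¹ t^p f(tx) dt`. -/
theorem exists_dirDeriv_radial_add_eq (p : ℕ) (f : Smooth 𝕜 (ball n R)) :
    ∃ g : Smooth 𝕜 (ball n R), dirDeriv (radial 𝕜 _) g + ((p + 1 : ℕ) : 𝕜) • g = f := by
  have hf : ContDiffOn ℝ ∞ (extend f.1) (Metric.ball 0 R) := f.2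
  have hg : ContDiffOn ℝ ∞ (fun x => ∫ t in (0 : ℝ)..1, t ^ p • extend f.1 (t • x))
      (Metric.ball 0 R) := by
    rw [contDiffOn_infty]
    intro k
    exact contDiffOn_radial_integral k p (hf.of_le (mod_cast le_top))
  refine ⟨Smooth.mk _ hg, ?_⟩
  ext x
  have hx : (x : EuclideanSpace ℝ (Fin n)) ∈ Metric.ball (0 : EuclideanSpace ℝ (Fin n)) R := x.2
  have h1 : ContDiffOn ℝ 1 (extend f.1) (Metric.ball 0 R) := hf.of_le (mod_cast le_top)
  have hc : ContinuousOn (fderiv ℝ (extend f.1)) (Metric.ball 0 R) :=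
    h1.continuousOn_fderiv_of_isOpen Metric.isOpen_ball le_rfl
  have hder : fderiv ℝ (extend (Smooth.mk (U := ball n R) _ hg).1) (x : EuclideanSpace ℝ (Fin n)) =
      ∫ t in (0 : ℝ)..1, t ^ (p + 1) • fderiv ℝ (extend f.1) (t • x.1) := by
    rw [fderiv_eq_of_eq (h := fun x => ∫ t in (0 : ℝ)..1, t ^ p • extend f.1 (t • x))
      (fun y => extend_coe (Smooth.mk (U := ball n R) _ hg).1 y) x]
    exact (hasFDerivAt_radial_integral h1 p hx).fderiv
  change (dirDeriv (radial 𝕜 _) (Smooth.mk (U := ball n R) _ hg)).1 x + ((p + 1 : ℕ) : 𝕜) •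
    (∫ t in (0 : ℝ)..1, t ^ p • extend f.1 (t • x.1)) = f.1 x
  rw [dirDeriv_radial_apply, hder, ContinuousLinearMap.intervalIntegral_apply
    (continuousOn_radial hc hx (p + 1)).intervalIntegrable, ← intervalIntegral.integral_smul,
    ← intervalIntegral.integral_add]
  -- The integrand is the derivative of `t^{p+1} f(tx)`.
  · have hFTC := intervalIntegral.integral_eq_sub_of_hasDerivAt (a := 0) (b := 1)
      (f := fun t : ℝ => t ^ (p + 1) • extend f.1 (t • x.1)) (fun t ht => by
        rw [Set.uIcc_of_le zero_le_one] at ht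
        exact hasDerivAt_ray f p (smul_mem_ball hx ht.1 ht.2)) (by
        refine ContinuousOn.intervalIntegrable ?_
        exact continuousOn_radial (F := fun y => extend (dirDeriv (radial 𝕜 _) f).1 y +
          ((p + 1 : ℕ) : ℝ) • extend f.1 y)
          (ContinuousOn.add (dirDeriv (radial 𝕜 _) f).2.continuousOn
            (hf.continuousOn.const_smul _)) hx p)
    have hfin : (1 : ℝ) ^ (p + 1) • extend f.1 ((1 : ℝ) • x.1) -
        (0 : ℝ) ^ (p + 1) • extend f.1 ((0 : ℝ) • x.1) = f.1 x := by
      simp [extend_coe]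
    rw [← hfin, ← hFTC]
    refine intervalIntegral.integral_congr fun t ht => ?_
    rw [Set.uIcc_of_le zero_le_one] at ht
    have hm := smul_mem_ball hx ht.1 ht.2
    rw [extend_coe (dirDeriv (radial 𝕜 _) f).1 ⟨t • x.1, hm⟩, dirDeriv_radial_apply]
    simp only [map_smul, smul_add, smul_smul]
    rw [smul_apply, pow_succ]
    congr 1
    rw [RCLike.real_smul_eq_coe_mul, RCLike.real_smul_eq_coe_mul, smul_eq_mul]
    push_cast
    ring
  · refine ContinuousOn.intervalIntegrable ?_
    exact ((ContinuousLinearMap.apply ℝ 𝕜 x.1).continuous.comp_continuousOn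
      (continuousOn_radial hc hx (p + 1)))
  · refine ContinuousOn.intervalIntegrable ?_
    exact (continuousOn_radial hf.continuousOn hx p).const_smul ((p + 1 : ℕ) : 𝕜)

/-- If `E f = -p f`, then `t^p f(tx)` does not depend on `t ∈ [0, 1]`. Compare `t = 1` and `t = 0`;
for `p = 0` the factor `0 ^ p` is `1`. -/
theorem apply_eq_of_dirDeriv_radial (p : ℕ) {f : Smooth 𝕜 (ball n R)}
    (hf : dirDeriv (radial 𝕜 _) f + (p : 𝕜) • f = 0) (x : EuclideanSpace ℝ (Fin n))
    (hx : x ∈ ball n R) : extend f.1 x = (0 : ℝ) ^ p • extend f.1 0 := by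
  have hx' : x ∈ Metric.ball (0 : EuclideanSpace ℝ (Fin n)) R := hx
  have hc : ContinuousOn (fun t : ℝ => t ^ p • extend f.1 (t • x)) (Set.Icc 0 1) := by
    have h := continuousOn_radial (show ContinuousOn (extend f.1) (Metric.ball 0 R) from
      f.2.continuousOn) hx' p
    rwa [Set.uIcc_of_le zero_le_one] at h
  have hE : ∀ y ∈ ball n R, extend (dirDeriv (radial 𝕜 _) f).1 y = -((p : ℝ) • extend f.1 y) := by
    intro y hy
    have h := congrArg (fun g : Smooth 𝕜 (ball n R) => g.1 ⟨y, hy⟩) hf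
    have h' : (dirDeriv (radial 𝕜 _) f).1 ⟨y, hy⟩ + (p : 𝕜) * f.1 ⟨y, hy⟩ = 0 := h
    rw [extend_coe (dirDeriv (radial 𝕜 _) f).1 ⟨y, hy⟩, extend_coe f.1 ⟨y, hy⟩, eq_neg_of_add_eq_zero_left h',
      RCLike.real_smul_eq_coe_mul]
    simp
  -- For `t > 0` the derivative of `t^p f(tx)` is `t^{p-1} (E f + p f)(tx) = 0`.
  have hd : ∀ t ∈ Set.Ioc (0 : ℝ) 1, t ^ p • extend f.1 (t • x) = extend f.1 x := by
    intro s hs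
    have key := constant_of_has_deriv_right_zero (a := s) (b := 1)
      (f := fun t : ℝ => t ^ p • extend f.1 (t • x)) (hc.mono (Set.Icc_subset_Icc_left hs.1.le))
      (fun t ht => by
        have ht0 : 0 < t := hs.1.trans_le ht.1
        have hm : t • x ∈ ball n R := smul_mem_ball hx' ht0.le ht.2.le
        have h1 := (differentiableAt_extend f ⟨t • x, hm⟩).hasFDerivAt.comp_hasDerivAt t
          ((hasDerivAt_id t).smul_const x)
        have h2 := (hasDerivAt_pow p t).smul h1
        refine (h2.congr_deriv ?_).hasDerivWithinAt
        have h3 := hE _ hm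
        rw [extend_coe (dirDeriv (radial 𝕜 _) f).1 ⟨t • x, hm⟩, dirDeriv_radial_apply] at h3
        simp only [map_smul] at h3
        simp only [id, one_smul, Function.comp]
        refine (smul_eq_zero.mp (?_ : t • _ = (0 : 𝕜))).resolve_left ht0.ne'
        rw [smul_add, smul_comm t, h3]
        rcases p with _ | p
        · simp
        · simp only [smul_neg, smul_smul, add_tsub_cancel_right]
          rw [pow_succ, neg_add_eq_zero]
          congr 1
          ring)
    have := key 1 ⟨hs.2, le_rfl⟩
    simpa using this.symm
  -- Let `t` tend to zero.
  have hlim : Filter.Tendsto (fun t : ℝ => t ^ p • extend f.1 (t • x)) (nhdsWithin 0 (Set.Ioc 0 1))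
      (nhds ((0 : ℝ) ^ p • extend f.1 ((0 : ℝ) • x))) :=
    (hc 0 ⟨le_rfl, zero_le_one⟩).mono_left (nhdsWithin_mono _ Set.Ioc_subset_Icc_self)
  have hne : (nhdsWithin (0 : ℝ) (Set.Ioc 0 1)).NeBot := by
    rw [nhdsWithin_Ioc_eq_nhdsGT zero_lt_one]; infer_instance
  have hlim2 : Filter.Tendsto (fun t : ℝ => t ^ p • extend f.1 (t • x))
      (nhdsWithin 0 (Set.Ioc 0 1)) (nhds (extend f.1 x)) :=
    tendsto_const_nhds.congr' (Filter.eventually_of_mem self_mem_nhdsWithin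
      fun t ht => (hd t ht).symm)
  have := tendsto_nhds_unique hlim2 hlim
  rwa [zero_smul] at this

theorem eq_zero_of_dirDeriv_radial (p : ℕ) {f : Smooth 𝕜 (ball n R)}
    (hf : dirDeriv (radial 𝕜 _) f + ((p + 1 : ℕ) : 𝕜) • f = 0) : f = 0 := by
  ext x
  have h := apply_eq_of_dirDeriv_radial (p + 1) hf x x.2
  rw [extend_coe] at h
  simpa using h

/-- `X ∖ Y` is dense in `X`. -/
theorem restrictFun_compl_injective (hm : 1 ≤ m) (hmn : m ≤ n) :
    Function.Injective (restrictFun 𝕜 (compl_le hmn R)) := by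
  rw [injective_iff_map_eq_zero]
  intro f hf
  have h0 : ∀ y ∈ compl hmn R, extend f.1 y = 0 := fun y hy => by
    have := congrArg (fun g : Smooth 𝕜 (compl hmn R) => g.1 ⟨y, hy⟩) hf
    rw [extend_coe f.1 ⟨y, compl_le hmn R hy⟩]
    exact this
  ext x
  have hx : (x : EuclideanSpace ℝ (Fin n)) ∈ Metric.ball (0 : EuclideanSpace ℝ (Fin n)) R := x.2
  change f.1 x = 0
  rw [← extend_coe f.1]
  by_cases hmu : mu hmn x.1 = 0
  -- A point of `Y` is approached along the `x_1`-axis.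
  · set e : EuclideanSpace ℝ (Fin n) := EuclideanSpace.single ⟨0, by omega⟩ 1
    have hcont : Filter.Tendsto (fun t : ℝ => extend f.1 (x.1 + t • e)) (nhdsWithin 0 {0}ᶜ)
        (nhds (extend f.1 x.1)) := by
      have h1 : ContinuousAt (extend f.1) (x.1 + (0 : ℝ) • e) := by
        rw [zero_smul, add_zero]
        exact f.2.continuousOn.continuousAt (Metric.isOpen_ball.mem_nhds hx)
      have h2 : ContinuousAt (fun t : ℝ => extend f.1 (x.1 + t • e)) 0 :=
        ContinuousAt.comp (f := fun t : ℝ => x.1 + t • e) h1 (by fun_prop)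
      have h3 := h2.tendsto.mono_left (nhdsWithin_le_nhds (s := {0}ᶜ))
      simpa using h3
    have hball : ∀ᶠ t : ℝ in nhds 0, x.1 + t • e ∈ Metric.ball (0 : EuclideanSpace ℝ (Fin n)) R := by
      have h2 : ContinuousAt (fun t : ℝ => x.1 + t • e) 0 := by fun_prop
      exact h2 (Metric.isOpen_ball.mem_nhds (by simpa using hx))
    have hx0 : x.1 ⟨0, by omega⟩ = 0 := by
      rw [mu, Finset.sum_eq_zero_iff_of_nonneg (fun i _ => sq_nonneg _)] at hmu
      have := hmu ⟨0, hm⟩ (Finset.mem_univ _)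
      exact pow_eq_zero_iff two_ne_zero |>.mp this
    have hzero : ∀ᶠ t : ℝ in nhdsWithin 0 {0}ᶜ, extend f.1 (x.1 + t • e) = 0 := by
      filter_upwards [nhdsWithin_le_nhds hball, self_mem_nhdsWithin] with t ht ht0
      refine h0 _ ⟨ht, fun hmu' => ht0 ?_⟩
      have hmu'' : mu hmn (x.1 + t • e) = 0 := hmu'
      rw [mu, Finset.sum_eq_zero_iff_of_nonneg (fun i _ => sq_nonneg _)] at hmu''
      have h3 := pow_eq_zero_iff two_ne_zero |>.mp (hmu'' ⟨0, hm⟩ (Finset.mem_univ _))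
      have h4 : (x.1 + t • e) ⟨0, by omega⟩ = 0 := h3
      simpa [e, hx0] using h4
    exact tendsto_nhds_unique (hcont.congr' hzero) tendsto_const_nhds
  · exact h0 _ ⟨hx, hmu⟩

/-- The forms with constant coefficients are flat over `𝕜`. -/
theorem restrict_compl_injective (hm : 1 ≤ m) (hmn : m ≤ n) :
    Function.Injective (restrict 𝕜 (compl_le hmn R)) :=
  Module.Flat.rTensor_preserves_injective_linearMap (M := ConstForms 𝕜 n)
    (restrictFun 𝕜 (compl_le hmn R)).toLinearMap (restrictFun_compl_injective hm hmn)

end HomogeneousFunctions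

/-! ### The grading and the weights under dilations -/

section Grading

variable {𝕜 : Type*} [RCLike 𝕜] {n m : ℕ}
  {U V : TopologicalSpace.Opens (EuclideanSpace ℝ (Fin n))} {R : ℝ}

theorem ι_eq_sum_dx (v : Fin n → 𝕜) : ExteriorAlgebra.ι 𝕜 v = ∑ i, v i • dx 𝕜 i := by
  conv_lhs => rw [pi_eq_sum_univ' v]
  rw [map_sum]
  refine Finset.sum_congr rfl fun i _ => ?_
  rw [map_smul, dx]

theorem degreeOp_tmul {p : ℕ} {u : ConstForms 𝕜 n} (hu : u ∈ ⋀[𝕜]^p (Fin n → 𝕜))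
    (f : Smooth 𝕜 U) : degreeOp (f ⊗ₜ[𝕜] u : Forms 𝕜 U) = (p : 𝕜) • (f ⊗ₜ[𝕜] u : Forms 𝕜 U) := by
  induction hu using Submodule.pow_induction_on_left' with
  | algebraMap r =>
    simp [degreeOp_apply, iota_tmul, CliffordAlgebra.contractLeft_algebraMap]
  | add x y i hx hy h₁ h₂ => rw [TensorProduct.tmul_add, map_add, h₁, h₂, smul_add]
  | mem_mul v hv i x hx h =>
    obtain ⟨w, rfl⟩ := hv
    have e : (f ⊗ₜ[𝕜] (ExteriorAlgebra.ι 𝕜 w * x) : Forms 𝕜 U) =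
        ∑ j, w j • wedge j (f ⊗ₜ[𝕜] x : Forms 𝕜 U) := by
      rw [ι_eq_sum_dx, Finset.sum_mul, TensorProduct.tmul_sum]
      refine Finset.sum_congr rfl fun j _ => ?_
      rw [smul_mul_assoc, TensorProduct.tmul_smul, wedge_tmul]
    rw [e, map_sum, Finset.smul_sum]
    refine Finset.sum_congr rfl fun j _ => ?_
    rw [map_smul, degreeOp_wedge, h, map_smul, smul_comm ((i.succ : ℕ) : 𝕜)]
    congr 1
    push_cast
    rw [add_smul, one_smul]

theorem degreeOp_of_mem_degree {k : ℕ} {ξ : Forms 𝕜 U} (hξ : ξ ∈ Forms.degree 𝕜 U k) :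
    degreeOp ξ = (k : 𝕜) • ξ := by
  obtain ⟨η, rfl⟩ := hξ
  induction η using TensorProduct.induction_on with
  | zero => simp
  | add a b ha hb => simp only [map_add, ha, hb, smul_add]
  | tmul f u => exact degreeOp_tmul u.2 f

/-- Forms are sums of forms `f u` with `u` a homogeneous constant form. -/
theorem homogeneous_induction {p : Forms 𝕜 U → Prop} (ξ : Forms 𝕜 U) (h0 : p 0)
    (ha : ∀ a b, p a → p b → p (a + b))
    (ht : ∀ (k : ℕ) (f : Smooth 𝕜 U) (u : ConstForms 𝕜 n), u ∈ ⋀[𝕜]^k (Fin n → 𝕜) →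
      p (f ⊗ₜ[𝕜] u)) : p ξ := by
  induction ξ using TensorProduct.induction_on with
  | zero => exact h0
  | add a b h₁ h₂ => exact ha a b h₁ h₂
  | tmul f u =>
    induction u using DirectSum.Decomposition.inductionOn
      (fun i : ℕ => ⋀[𝕜]^i (Fin n → 𝕜)) with
    | zero => rw [TensorProduct.tmul_zero]; exact h0
    | homogeneous u => exact ht _ f u u.2
    | add a b h₁ h₂ => rw [TensorProduct.tmul_add]; exact ha _ _ h₁ h₂

/-- The component of degree `p` of a form. -/
def degreePart (p : ℕ) : Forms 𝕜 U →ₗ[𝕜] Forms 𝕜 U :=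
  LinearMap.lTensor (Smooth 𝕜 U) (GradedAlgebra.proj (fun i : ℕ => ⋀[𝕜]^i (Fin n → 𝕜)) p)

theorem degreePart_tmul {k : ℕ} {u : ConstForms 𝕜 n} (hu : u ∈ ⋀[𝕜]^k (Fin n → 𝕜))
    (p : ℕ) (f : Smooth 𝕜 U) : degreePart p (f ⊗ₜ[𝕜] u : Forms 𝕜 U) =
      if k = p then (f ⊗ₜ[𝕜] u : Forms 𝕜 U) else 0 := by
  rw [degreePart, LinearMap.lTensor_tmul, GradedAlgebra.proj_apply]
  split_ifs with h
  · subst h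
    rw [DirectSum.decompose_of_mem_same (fun i : ℕ => ⋀[𝕜]^i (Fin n → 𝕜)) hu]
  · rw [DirectSum.decompose_of_mem_ne (fun i : ℕ => ⋀[𝕜]^i (Fin n → 𝕜)) hu h, TensorProduct.tmul_zero]

theorem exists_sum_degreePart (ξ : Forms 𝕜 U) :
    ∃ N : ℕ, ∀ M, N ≤ M → ξ = ∑ p ∈ Finset.range M, degreePart p ξ := by
  induction ξ using homogeneous_induction with
  | h0 => exact ⟨0, by simp⟩
  | ha a b ha hb =>
    obtain ⟨N₁, h₁⟩ := ha
    obtain ⟨N₂, h₂⟩ := hb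
    refine ⟨max N₁ N₂, fun M hM => ?_⟩
    simp only [map_add, Finset.sum_add_distrib]
    rw [← h₁ M (le_of_max_le_left hM), ← h₂ M (le_of_max_le_right hM)]
  | ht k f u hu =>
    refine ⟨k + 1, fun M hM => ?_⟩
    simp only [degreePart_tmul hu]
    rw [Finset.sum_ite_eq, if_pos (Finset.mem_range.mpr hM)]

/-- The component of degree zero of a form, as a function. -/
def scalarPart : Forms 𝕜 U →ₗ[𝕜] Smooth 𝕜 U :=
  (TensorProduct.rid 𝕜 (Smooth 𝕜 U)).toLinearMap ∘ₗ
    LinearMap.lTensor (Smooth 𝕜 U) ExteriorAlgebra.algebraMapInv.toLinearMap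

theorem scalarPart_tmul (f : Smooth 𝕜 U) (u : ConstForms 𝕜 n) :
    scalarPart (f ⊗ₜ[𝕜] u : Forms 𝕜 U) = ExteriorAlgebra.algebraMapInv u • f := by
  simp [scalarPart]

theorem scalarPart_ofFun (f : Smooth 𝕜 U) : scalarPart (Forms.ofFun f) = f := by
  rw [Forms.ofFun, scalarPart_tmul, map_one, one_smul]

theorem scalarPart_wedge (i : Fin n) (ξ : Forms 𝕜 U) : scalarPart (wedge i ξ) = 0 := by
  induction ξ using TensorProduct.induction_on with
  | zero => simp
  | add a b ha hb => simp only [map_add, ha, hb, add_zero]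
  | tmul f u =>
    rw [wedge_tmul, scalarPart_tmul, map_mul, dx]
    have : ExteriorAlgebra.algebraMapInv (ExteriorAlgebra.ι 𝕜 (Pi.single i 1 : Fin n → 𝕜)) = 0 := by
      simp [ExteriorAlgebra.algebraMapInv]
    rw [this, zero_mul, zero_smul]

theorem scalarPart_smul (f : Smooth 𝕜 U) (ξ : Forms 𝕜 U) :
    scalarPart (f • ξ) = f * scalarPart ξ := by
  induction ξ using TensorProduct.induction_on with
  | zero => simp
  | add a b ha hb => simp only [smul_add, map_add, ha, hb, mul_add]
  | tmul g u => rw [smul_tmul_form, scalarPart_tmul, scalarPart_tmul, mul_smul_comm]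

theorem scalarPart_coeffDeriv (i : Fin n) (ξ : Forms 𝕜 U) :
    scalarPart (coeffDeriv i ξ) = pderiv 𝕜 U i (scalarPart ξ) := by
  induction ξ using TensorProduct.induction_on with
  | zero => simp
  | add a b ha hb => simp only [map_add, ha, hb]
  | tmul f u => rw [coeffDeriv_tmul, scalarPart_tmul, scalarPart_tmul, map_smul]

theorem scalarPart_restrict (h : U ≤ V) (ξ : Forms 𝕜 V) :
    scalarPart (restrict 𝕜 h ξ) = restrictFun 𝕜 h (scalarPart ξ) := by
  induction ξ using TensorProduct.induction_on with
  | zero => simp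
  | add a b ha hb => simp only [map_add, ha, hb]
  | tmul f u => rw [restrict_tmul, scalarPart_tmul, scalarPart_tmul, map_smul]

theorem scalarPart_degreeOp (ξ : Forms 𝕜 U) : scalarPart (degreeOp ξ) = 0 := by
  simp [degreeOp_apply, scalarPart_wedge]

theorem scalarPart_lieDeriv_radial (ξ : Forms 𝕜 U) :
    scalarPart (lieDeriv (radial 𝕜 U) ξ) = dirDeriv (radial 𝕜 U) (scalarPart ξ) := by
  rw [lieDeriv_radial, map_add, scalarPart_degreeOp, add_zero, map_sum, dirDeriv]
  simp only [scalarPart_smul, scalarPart_coeffDeriv, radial]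

theorem ofFun_scalarPart_of_mem {u : ConstForms 𝕜 n} (hu : u ∈ ⋀[𝕜]^0 (Fin n → 𝕜))
    (f : Smooth 𝕜 U) :
    (f ⊗ₜ[𝕜] u : Forms 𝕜 U) = Forms.ofFun (scalarPart (f ⊗ₜ[𝕜] u : Forms 𝕜 U)) := by
  have hu' : u ∈ LinearMap.range (ExteriorAlgebra.ι 𝕜 (M := Fin n → 𝕜)) ^ 0 := hu
  rw [pow_zero, Submodule.mem_one] at hu'
  obtain ⟨c, rfl⟩ := hu'
  rw [scalarPart_tmul, AlgHom.commutes, Forms.ofFun, Algebra.algebraMap_eq_smul_one]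
  rw [TensorProduct.tmul_smul, TensorProduct.smul_tmul']
  rfl

theorem ofFun_scalarPart (ξ : Forms 𝕜 U) :
    Forms.ofFun (scalarPart ξ) = degreePart 0 ξ := by
  induction ξ using homogeneous_induction with
  | h0 => simp [Forms.ofFun]
  | ha a b ha hb =>
    rw [map_add, map_add, ← ha, ← hb, Forms.ofFun, TensorProduct.add_tmul]; rfl
  | ht k f u hu =>
    rw [degreePart_tmul hu]
    split_ifs with h
    · subst h
      exact (ofFun_scalarPart_of_mem hu f).symm
    · have h1 := degreeOp_tmul hu f
      have h2 := congrArg scalarPart h1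
      rw [scalarPart_degreeOp, map_smul] at h2
      have h3 := (smul_eq_zero.mp h2.symm).resolve_left (by exact_mod_cast h)
      rw [h3, Forms.ofFun, TensorProduct.zero_tmul]

theorem degreeOp_degreePart (p : ℕ) (ξ : Forms 𝕜 U) :
    degreePart p (degreeOp ξ) = (p : 𝕜) • degreePart p ξ := by
  induction ξ using homogeneous_induction with
  | h0 => simp
  | ha a b ha hb => simp only [map_add, ha, hb, smul_add]
  | ht k f u hu =>
    rw [degreeOp_tmul hu, map_smul, degreePart_tmul hu]
    split_ifs with h
    · rw [h]
    · simp

/-- A form of degree zero is a function. -/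
theorem eq_ofFun_of_degreeOp_eq_zero {ξ : Forms 𝕜 U} (h : degreeOp ξ = 0) :
    ξ = Forms.ofFun (scalarPart ξ) := by
  rw [ofFun_scalarPart]
  obtain ⟨N, hN⟩ := exists_sum_degreePart ξ
  have h1 := hN (N + 1) (Nat.le_succ N)
  rw [Finset.sum_range_succ'] at h1
  rw [Finset.sum_eq_zero, zero_add] at h1
  · exact h1
  · intro p _
    have h2 := degreeOp_degreePart (p + 1) ξ
    rw [h, map_zero] at h2
    exact (smul_eq_zero.mp h2.symm).resolve_left (by exact_mod_cast p.succ_ne_zero)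

theorem lieDeriv_radial_tmul {k : ℕ} {u : ConstForms 𝕜 n} (hu : u ∈ ⋀[𝕜]^k (Fin n → 𝕜))
    (f : Smooth 𝕜 U) : lieDeriv (radial 𝕜 U) (f ⊗ₜ[𝕜] u : Forms 𝕜 U) =
      (dirDeriv (radial 𝕜 U) f + (k : 𝕜) • f) ⊗ₜ[𝕜] u := by
  rw [lieDeriv_radial, degreeOp_tmul hu, TensorProduct.add_tmul, TensorProduct.smul_tmul',
    dirDeriv, TensorProduct.sum_tmul]
  rfl

/-- The operator `f ↦ E f + k f` on functions. -/
def radialAdd (k : 𝕜) : Smooth 𝕜 U →ₗ[𝕜] Smooth 𝕜 U :=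
  (∑ i, LinearMap.mulLeft 𝕜 (radial 𝕜 U i) ∘ₗ pderiv 𝕜 U i) + k • LinearMap.id

theorem radialAdd_apply (k : 𝕜) (f : Smooth 𝕜 U) :
    radialAdd k f = dirDeriv (radial 𝕜 U) f + k • f := by
  simp [radialAdd, dirDeriv, LinearMap.sum_apply]

theorem degreePart_lieDeriv_radial (p : ℕ) (ξ : Forms 𝕜 U) :
    degreePart p (lieDeriv (radial 𝕜 U) ξ) =
      LinearMap.rTensor (ConstForms 𝕜 n) (radialAdd (p : 𝕜)) (degreePart p ξ) := by
  induction ξ using homogeneous_induction with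
  | h0 => simp
  | ha a b ha hb => simp only [map_add, ha, hb]
  | ht k f u hu =>
    rw [lieDeriv_radial_tmul hu, degreePart_tmul hu, degreePart_tmul hu]
    split_ifs with h
    · rw [← h, LinearMap.rTensor_tmul, radialAdd_apply]
    · simp

/-- A form on a ball that is invariant under dilations is a constant. -/
theorem exists_eq_smul_one_of_lieDeriv_radial {ξ : Forms 𝕜 (ball n R)}
    (h : lieDeriv (radial 𝕜 _) ξ = 0) : ∃ c : 𝕜, ξ = c • (1 : Forms 𝕜 (ball n R)) := by
  have hz : ∀ p : ℕ, degreePart (p + 1) ξ = 0 := fun p => by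
    have h1 := degreePart_lieDeriv_radial (p + 1) ξ
    rw [h, map_zero] at h1
    have hinj : Function.Injective (radialAdd (U := ball n R) ((p + 1 : ℕ) : 𝕜)) := by
      rw [injective_iff_map_eq_zero]
      intro f hf
      rw [radialAdd_apply] at hf
      exact eq_zero_of_dirDeriv_radial p hf
    have h2 := Module.Flat.rTensor_preserves_injective_linearMap (M := ConstForms 𝕜 n) _ hinj
    exact h2 (h1.symm.trans (map_zero _).symm)
  have h0 : ξ = Forms.ofFun (scalarPart ξ) := by
    rw [ofFun_scalarPart]
    obtain ⟨N, hN⟩ := exists_sum_degreePart ξ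
    have h1 := hN (N + 1) (Nat.le_succ N)
    rw [Finset.sum_range_succ', Finset.sum_eq_zero fun p _ => hz p, zero_add] at h1
    exact h1
  have hE : dirDeriv (radial 𝕜 (ball n R)) (scalarPart ξ) = 0 := by
    rw [← scalarPart_lieDeriv_radial, h, map_zero]
  have hc : scalarPart ξ = algebraMap 𝕜 _ (extend (scalarPart ξ).1 0) := by
    ext x
    have h3 := apply_eq_of_dirDeriv_radial 0 (f := scalarPart ξ) (by simp [hE]) x x.2
    rw [extend_coe] at h3
    change (scalarPart ξ).1 x = extend (scalarPart ξ).1 0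
    simpa using h3
  refine ⟨extend (scalarPart ξ).1 0, ?_⟩
  conv_lhs => rw [h0, hc]
  rw [Forms.ofFun, Algebra.algebraMap_eq_smul_one, ← TensorProduct.smul_tmul']
  rfl

/-- On forms `f u` with `u` constant of degree `k` the operator `L_E + 1` is `E + k + 1`. -/
theorem exists_lieDeriv_radial_add_eq (ξ : Forms 𝕜 (ball n R)) :
    ∃ η : Forms 𝕜 (ball n R), lieDeriv (radial 𝕜 _) η + η = ξ := by
  induction ξ using homogeneous_induction with
  | h0 => exact ⟨0, by simp⟩
  | ha a b ha hb =>
    obtain ⟨η₁, h₁⟩ := ha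
    obtain ⟨η₂, h₂⟩ := hb
    exact ⟨η₁ + η₂, by rw [map_add, ← h₁, ← h₂]; abel⟩
  | ht k f u hu =>
    obtain ⟨g, hg⟩ := exists_dirDeriv_radial_add_eq k f
    refine ⟨g ⊗ₜ[𝕜] u, ?_⟩
    rw [lieDeriv_radial_tmul hu, ← TensorProduct.add_tmul, ← hg]
    push_cast
    rw [add_smul, one_smul, add_assoc]

/-- The forms of weight `k` under dilations: `L_E ξ = k ξ` for the Euler field `E` of `ℝⁿ`. -/
def weightSpace (𝕜 : Type*) [RCLike 𝕜] {n : ℕ}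
    (U : TopologicalSpace.Opens (EuclideanSpace ℝ (Fin n))) (k : ℕ) : Submodule 𝕜 (Forms 𝕜 U) :=
  LinearMap.ker (lieDeriv (radial 𝕜 U) - (k : 𝕜) • LinearMap.id)

theorem mem_weightSpace {k : ℕ} {ξ : Forms 𝕜 U} :
    ξ ∈ weightSpace 𝕜 U k ↔ lieDeriv (radial 𝕜 U) ξ = (k : 𝕜) • ξ := by
  rw [weightSpace, LinearMap.mem_ker, LinearMap.sub_apply, sub_eq_zero]
  rfl

theorem coeffDeriv_mem_weightSpace {k : ℕ} {ξ : Forms 𝕜 U} (h : ξ ∈ weightSpace 𝕜 U (k + 1))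
    (i : Fin n) : coeffDeriv i ξ ∈ weightSpace 𝕜 U k := by
  rw [mem_weightSpace] at h ⊢
  rw [lieDeriv_radial_coeffDeriv, h, map_smul]
  push_cast
  rw [add_smul, one_smul, add_sub_cancel_right]

theorem iota_mem_weightSpace {k : ℕ} {ξ : Forms 𝕜 U} (h : ξ ∈ weightSpace 𝕜 U (k + 1))
    (i : Fin n) : iota i ξ ∈ weightSpace 𝕜 U k := by
  rw [mem_weightSpace] at h ⊢
  rw [lieDeriv_radial_iota, h, map_smul]
  push_cast
  rw [add_smul, one_smul, add_sub_cancel_right]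

theorem coord_smul_mem_weightSpace {k : ℕ} {ξ : Forms 𝕜 U} (h : ξ ∈ weightSpace 𝕜 U k)
    (i : Fin n) : coord 𝕜 U i • ξ ∈ weightSpace 𝕜 U (k + 1) := by
  rw [mem_weightSpace] at h ⊢
  rw [lieDeriv_radial_smul_coord, h, smul_comm]
  push_cast
  rw [add_smul, one_smul]

theorem wedge_mem_weightSpace {k : ℕ} {ξ : Forms 𝕜 U} (h : ξ ∈ weightSpace 𝕜 U k)
    (i : Fin n) : wedge i ξ ∈ weightSpace 𝕜 U (k + 1) := by
  rw [mem_weightSpace] at h ⊢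
  rw [lieDeriv_radial_wedge, h, map_smul]
  push_cast
  rw [add_smul, one_smul]

/-- A form of nonzero weight is determined by its contractions and the derivatives of its
coefficients. -/
theorem eq_zero_of_mem_weightSpace {k : ℕ} {ξ : Forms 𝕜 U} (h : ξ ∈ weightSpace 𝕜 U (k + 1))
    (hD : ∀ i, coeffDeriv i ξ = 0) (hI : ∀ i, iota i ξ = 0) : ξ = 0 := by
  rw [mem_weightSpace, lieDeriv_radial, degreeOp_apply] at h
  simp only [hD, hI, map_zero, smul_zero, Finset.sum_const_zero, add_zero] at h
  exact (smul_eq_zero.mp h.symm).resolve_left (by exact_mod_cast k.succ_ne_zero)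

theorem lieDeriv_radial_sub_coord_smul (k : ℕ) (i : Fin n) (ξ : Forms 𝕜 U) :
    lieDeriv (radial 𝕜 U) (coord 𝕜 U i • ξ) - ((k + 1 : ℕ) : 𝕜) • (coord 𝕜 U i • ξ) =
      coord 𝕜 U i • (lieDeriv (radial 𝕜 U) ξ - (k : 𝕜) • ξ) := by
  rw [lieDeriv_radial_smul_coord, smul_sub, smul_comm (coord 𝕜 U i) (k : 𝕜)]
  push_cast
  rw [add_smul, one_smul]
  abel

theorem lieDeriv_radial_sub_wedge (k : ℕ) (i : Fin n) (ξ : Forms 𝕜 U) :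
    lieDeriv (radial 𝕜 U) (wedge i ξ) - ((k + 1 : ℕ) : 𝕜) • wedge i ξ =
      wedge i (lieDeriv (radial 𝕜 U) ξ - (k : 𝕜) • ξ) := by
  rw [lieDeriv_radial_wedge, map_sub, map_smul]
  push_cast
  rw [add_smul, one_smul]
  abel

/-- For families `F`, `G` of forms, `∑_i (x_i F_i + dx_i ∧ G_i)`. For `F_i = ∂_i ξ`, `G_i = ι_i ξ` this
is `L_E ξ`. -/
def eulerSum (F G : Fin n → Forms 𝕜 U) : Forms 𝕜 U :=
  ∑ i, (coord 𝕜 U i • F i + wedge i (G i))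

theorem eulerSum_add (F G F' G' : Fin n → Forms 𝕜 U) :
    eulerSum (fun i => F i + F' i) (fun i => G i + G' i) = eulerSum F G + eulerSum F' G' := by
  rw [eulerSum, eulerSum, eulerSum, ← Finset.sum_add_distrib]
  refine Finset.sum_congr rfl fun i _ => ?_
  rw [smul_add, map_add]
  abel

theorem lieDeriv_radial_eq_eulerSum (ξ : Forms 𝕜 U) :
    lieDeriv (radial 𝕜 U) ξ = eulerSum (fun i => coeffDeriv i ξ) (fun i => iota i ξ) := by
  rw [lieDeriv_radial, degreeOp_apply, ← Finset.sum_add_distrib]; rfl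

/-- The operators `x_i` and `dx_i ∧ _` raise the weight by one. -/
theorem lieDeriv_radial_sub_eulerSum (k : ℕ) (F G : Fin n → Forms 𝕜 U) :
    lieDeriv (radial 𝕜 U) (eulerSum F G) - ((k + 1 : ℕ) : 𝕜) • eulerSum F G =
      eulerSum (fun i => lieDeriv (radial 𝕜 U) (F i) - (k : 𝕜) • F i)
        (fun i => lieDeriv (radial 𝕜 U) (G i) - (k : 𝕜) • G i) := by
  rw [eulerSum, eulerSum, map_sum, Finset.smul_sum, ← Finset.sum_sub_distrib]
  refine Finset.sum_congr rfl fun i _ => ?_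
  rw [← lieDeriv_radial_sub_coord_smul, ← lieDeriv_radial_sub_wedge, map_add, smul_add]
  abel

theorem lieDeriv_radial_eulerSum (F G : Fin n → Forms 𝕜 U) :
    lieDeriv (radial 𝕜 U) (eulerSum F G) =
      eulerSum (fun i => lieDeriv (radial 𝕜 U) (F i) + F i)
        (fun i => lieDeriv (radial 𝕜 U) (G i) + G i) := by
  rw [eulerSum, eulerSum, map_sum]
  refine Finset.sum_congr rfl fun i _ => ?_
  rw [map_add, lieDeriv_radial_smul_coord, lieDeriv_radial_wedge, smul_add, map_add]

/-- Every form on a ball is the sum of a form of weight `k` and of a form in the image of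
`L_E - k`. This is Taylor's formula: `ξ₀` collects the Taylor coefficients of weight `k`. -/
theorem exists_weightSpace_add (k : ℕ) : ∀ ξ : Forms 𝕜 (ball n R),
    ∃ ξ₀ ∈ weightSpace 𝕜 (ball n R) k, ∃ η : Forms 𝕜 (ball n R),
      ξ = ξ₀ + (lieDeriv (radial 𝕜 _) η - (k : 𝕜) • η) := by
  induction k with
  | zero =>
    intro ξ
    -- `∂_i ξ` and `ι_i ξ` lie in the image of `(L_E + 1)²`.
    choose s hs using fun ξ : Forms 𝕜 (ball n R) => exists_lieDeriv_radial_add_eq ξ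
    refine ⟨ξ - eulerSum (fun i => s (coeffDeriv i ξ)) (fun i => s (iota i ξ)), ?_,
      eulerSum (fun i => s (s (coeffDeriv i ξ))) (fun i => s (s (iota i ξ))), ?_⟩
    · rw [mem_weightSpace, map_sub, lieDeriv_radial_eulerSum, lieDeriv_radial_eq_eulerSum ξ]
      simp only [hs, sub_self, Nat.cast_zero, zero_smul]
    · rw [lieDeriv_radial_eulerSum]
      simp only [hs, Nat.cast_zero, zero_smul, sub_zero, sub_add_cancel]
  | succ k ih =>
    intro ξ
    -- By the case `k` for `∂_i ξ` and `ι_i ξ`, `L_E ξ = A + (L_E - k - 1) B` with `A` of weight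
    -- `k + 1`, whence `(k + 1) ξ = A + (L_E - k - 1) (B - ξ)`.
    choose a ha s hs using ih
    set A : Forms 𝕜 (ball n R) :=
      eulerSum (fun i => a (coeffDeriv i ξ)) (fun i => a (iota i ξ)) with hA
    set B : Forms 𝕜 (ball n R) :=
      eulerSum (fun i => s (coeffDeriv i ξ)) (fun i => s (iota i ξ)) with hB
    have hAw : A ∈ weightSpace 𝕜 (ball n R) (k + 1) := Submodule.sum_mem _ fun i _ =>
      Submodule.add_mem _ (coord_smul_mem_weightSpace (ha _) i) (wedge_mem_weightSpace (ha _) i)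
    have h1 : lieDeriv (radial 𝕜 _) ξ =
        A + (lieDeriv (radial 𝕜 _) B - ((k + 1 : ℕ) : 𝕜) • B) := by
      rw [hB, lieDeriv_radial_sub_eulerSum, hA, ← eulerSum_add, lieDeriv_radial_eq_eulerSum]
      congr 1
      · funext i; exact hs _
      · funext i; exact hs _
    have hk : ((k + 1 : ℕ) : 𝕜) ≠ 0 := by exact_mod_cast k.succ_ne_zero
    refine ⟨((k + 1 : ℕ) : 𝕜)⁻¹ • A, Submodule.smul_mem _ _ hAw,
      ((k + 1 : ℕ) : 𝕜)⁻¹ • (B - ξ), ?_⟩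
    have h2 : ((k + 1 : ℕ) : 𝕜) • ξ = A + (lieDeriv (radial 𝕜 _) (B - ξ) -
        ((k + 1 : ℕ) : 𝕜) • (B - ξ)) := by
      rw [map_sub, h1, smul_sub]; abel
    rw [map_smul, smul_comm ((k + 1 : ℕ) : 𝕜), ← smul_sub, ← smul_add, ← h2, inv_smul_smul₀ hk]

/-- The operator `L_E - k` on the forms on a ball has no nilpotent part at the eigenvalue zero. -/
theorem mem_weightSpace_of_sub_mem (hR : 0 < R) (k : ℕ) : ∀ ξ : Forms 𝕜 (ball n R),
    lieDeriv (radial 𝕜 _) ξ - (k : 𝕜) • ξ ∈ weightSpace 𝕜 (ball n R) k →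
    ξ ∈ weightSpace 𝕜 (ball n R) k := by
  induction k with
  | zero =>
    intro ξ h
    rw [mem_weightSpace] at h ⊢
    simp only [Nat.cast_zero, zero_smul, sub_zero] at h ⊢
    -- `L_E ξ` is a constant `c`, and its component of degree zero vanishes at the origin.
    obtain ⟨c, hc⟩ := exists_eq_smul_one_of_lieDeriv_radial h
    have h0 : (0 : EuclideanSpace ℝ (Fin n)) ∈ ball n R := by
      simpa [ball] using (Metric.mem_ball_self hR : (0 : EuclideanSpace ℝ (Fin n)) ∈ _)
    have h1 := congrArg scalarPart hc
    rw [scalarPart_lieDeriv_radial, map_smul] at h1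
    have h2 := congrArg (fun f : Smooth 𝕜 (ball n R) => f.1 ⟨0, h0⟩) h1
    simp only [dirDeriv_radial_apply, map_zero] at h2
    have h3 : scalarPart (1 : Forms 𝕜 (ball n R)) = 1 := scalarPart_ofFun 1
    rw [h3] at h2
    have h4 : (0 : 𝕜) = c * 1 := h2
    rw [hc, show c = 0 by simpa using h4.symm, zero_smul]
  | succ k ih =>
    intro ξ h
    have hD : ∀ i, coeffDeriv i (lieDeriv (radial 𝕜 _) ξ - ((k + 1 : ℕ) : 𝕜) • ξ) =
        lieDeriv (radial 𝕜 _) (coeffDeriv i ξ) - (k : 𝕜) • coeffDeriv i ξ := fun i => by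
      rw [lieDeriv_radial_coeffDeriv, map_sub, map_smul]
      push_cast
      rw [add_smul, one_smul]; abel
    have hI : ∀ i, iota i (lieDeriv (radial 𝕜 _) ξ - ((k + 1 : ℕ) : 𝕜) • ξ) =
        lieDeriv (radial 𝕜 _) (iota i ξ) - (k : 𝕜) • iota i ξ := fun i => by
      rw [lieDeriv_radial_iota, map_sub, map_smul]
      push_cast
      rw [add_smul, one_smul]; abel
    -- By the case `k`, the operators `∂_i` and `ι_i` annihilate `(L_E - k - 1) ξ`.
    have h0 := eq_zero_of_mem_weightSpace h (fun i => ?_) (fun i => ?_)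
    · rw [mem_weightSpace]
      exact sub_eq_zero.mp h0
    · have h1 := coeffDeriv_mem_weightSpace h i
      rw [hD] at h1 ⊢
      exact sub_eq_zero.mpr (mem_weightSpace.mp (ih _ h1))
    · have h1 := iota_mem_weightSpace h i
      rw [hI] at h1 ⊢
      exact sub_eq_zero.mpr (mem_weightSpace.mp (ih _ h1))

/-- The map `ξ ↦ (∂_i ξ, ι_i ξ)_i` embeds the forms of weight `k + 1` into a power of the forms of
weight `k`. -/
theorem finiteDimensional_weightSpace (k : ℕ) :
    FiniteDimensional 𝕜 (weightSpace 𝕜 (ball n R) k) := by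
  induction k with
  | zero =>
    have h : weightSpace 𝕜 (ball n R) 0 ≤ Submodule.span 𝕜 {1} := fun ξ hξ => by
      rw [mem_weightSpace, Nat.cast_zero, zero_smul] at hξ
      obtain ⟨c, hc⟩ := exists_eq_smul_one_of_lieDeriv_radial hξ
      rw [hc]
      exact Submodule.smul_mem _ _ (Submodule.mem_span_singleton_self _)
    exact Submodule.finiteDimensional_of_le h
  | succ k ih =>
    have hmap : ∀ (j : Fin n ⊕ Fin n) (ξ : weightSpace 𝕜 (ball n R) (k + 1)),
        (Sum.elim coeffDeriv iota j : Forms 𝕜 (ball n R) →ₗ[𝕜] _) ξ.1 ∈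
          weightSpace 𝕜 (ball n R) k := by
      rintro (i | i) ξ
      · exact coeffDeriv_mem_weightSpace ξ.2 i
      · exact iota_mem_weightSpace ξ.2 i
    refine FiniteDimensional.of_injective (LinearMap.pi fun j =>
      LinearMap.codRestrict (weightSpace 𝕜 (ball n R) k)
        ((Sum.elim coeffDeriv iota j : Forms 𝕜 (ball n R) →ₗ[𝕜] _) ∘ₗ Submodule.subtype _)
        (hmap j)) ?_
    intro ξ ζ h
    refine Subtype.ext (sub_eq_zero.mp (eq_zero_of_mem_weightSpace
      (Submodule.sub_mem _ ξ.2 ζ.2) (fun i => ?_) (fun i => ?_)))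
    · rw [map_sub, sub_eq_zero]
      exact congrArg Subtype.val (congrFun h (Sum.inl i))
    · rw [map_sub, sub_eq_zero]
      exact congrArg Subtype.val (congrFun h (Sum.inr i))

end Grading

/-! ### The Fischer form -/

section Fischer

variable {𝕜 : Type*} [RCLike 𝕜] {n m : ℕ}
  {U : TopologicalSpace.Opens (EuclideanSpace ℝ (Fin n))} {R : ℝ}

open Classical in
/-- The value of a function at the origin (zero if the origin is not in `U`). -/
def evalOrigin : Smooth 𝕜 U →ₗ[𝕜] 𝕜 :=
  if h : (0 : EuclideanSpace ℝ (Fin n)) ∈ U then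
    LinearMap.proj (⟨0, h⟩ : U) ∘ₗ (Smooth 𝕜 U).val.toLinearMap else 0

theorem evalOrigin_coord_mul (i : Fin n) (f : Smooth 𝕜 U) :
    evalOrigin (coord 𝕜 U i * f) = 0 := by
  rw [evalOrigin]
  split_ifs with h
  · have : (coord 𝕜 U i).1 ⟨0, h⟩ = 0 := by simp [coord, Smooth.mk]
    change (coord 𝕜 U i).1 ⟨0, h⟩ * f.1 ⟨0, h⟩ = 0
    rw [this, zero_mul]
  · rfl

theorem evalOrigin_one (hR : 0 < R) : evalOrigin (1 : Smooth 𝕜 (ball n R)) = 1 := by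
  have h : (0 : EuclideanSpace ℝ (Fin n)) ∈ ball n R := by
    simpa [ball] using (Metric.mem_ball_self hR : (0 : EuclideanSpace ℝ (Fin n)) ∈ _)
  rw [evalOrigin, dif_pos h]
  rfl

/-- The Fischer form in weight `k`: the sesquilinear form on germs of forms at the origin for which
the adjoints of `x_i` and of `dx_i ∧ _` are multiples of `∂/∂x_i` and of `ι_i`. It is defined by
Euler's recursion `L_E ξ = ∑_i (x_i ∂_i ξ + dx_i ∧ ι_i ξ)`. -/
def fischer : ℕ → Forms 𝕜 U → Forms 𝕜 U → 𝕜
  | 0, ξ, η => evalOrigin (scalarPart ξ) * starRingEnd 𝕜 (evalOrigin (scalarPart η))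
  | k + 1, ξ, η => ∑ i, (fischer k (coeffDeriv i ξ) (coeffDeriv i η) +
      fischer k (iota i ξ) (iota i η))

theorem fischer_conj (k : ℕ) : ∀ ξ η : Forms 𝕜 U,
    starRingEnd 𝕜 (fischer k ξ η) = fischer k η ξ := by
  induction k with
  | zero => intro ξ η; simp [fischer, mul_comm]
  | succ k ih => intro ξ η; simp only [fischer, map_sum, map_add, ih]

theorem fischer_add_left (k : ℕ) : ∀ ξ ζ η : Forms 𝕜 U,
    fischer k (ξ + ζ) η = fischer k ξ η + fischer k ζ η := by
  induction k with
  | zero => intro ξ ζ η; simp [fischer, add_mul]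
  | succ k ih =>
    intro ξ ζ η
    simp only [fischer, map_add, ih, ← Finset.sum_add_distrib]
    exact Finset.sum_congr rfl fun i _ => by ring

/-- The Fischer form as an additive map in the first variable. -/
def fischerHom (k : ℕ) (η : Forms 𝕜 U) : Forms 𝕜 U →+ 𝕜 :=
  AddMonoidHom.mk' (fun ξ => fischer k ξ η) fun ξ ζ => fischer_add_left k ξ ζ η

theorem fischer_zero_left (k : ℕ) (η : Forms 𝕜 U) : fischer k 0 η = 0 :=
  map_zero (fischerHom k η)

theorem fischer_neg_left (k : ℕ) (ξ η : Forms 𝕜 U) : fischer k (-ξ) η = -fischer k ξ η :=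
  map_neg (fischerHom k η) ξ

theorem fischer_sub_left (k : ℕ) (ξ ζ η : Forms 𝕜 U) :
    fischer k (ξ - ζ) η = fischer k ξ η - fischer k ζ η :=
  map_sub (fischerHom k η) ξ ζ

theorem fischer_sum_left {ι : Type*} (s : Finset ι) (k : ℕ) (F : ι → Forms 𝕜 U) (η : Forms 𝕜 U) :
    fischer k (∑ i ∈ s, F i) η = ∑ i ∈ s, fischer k (F i) η :=
  map_sum (fischerHom k η) F s

theorem fischer_neg_right (k : ℕ) (ξ η : Forms 𝕜 U) : fischer k ξ (-η) = -fischer k ξ η := by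
  rw [← fischer_conj, fischer_neg_left, map_neg, fischer_conj]

/-- The adjoint of the multiplication with `x_i` is a multiple of `∂/∂x_i`. -/
theorem fischer_coord_smul (k : ℕ) (i : Fin n) : ∀ ξ η : Forms 𝕜 U,
    fischer (k + 1) (coord 𝕜 U i • ξ) η = ((k + 1 : ℕ) : 𝕜) * fischer k ξ (coeffDeriv i η) := by
  have hD : ∀ (l : ℕ) (ξ η : Forms 𝕜 U), fischer (l + 1) (coord 𝕜 U i • ξ) η =
      ∑ j, (fischer l (coord 𝕜 U i • coeffDeriv j ξ) (coeffDeriv j η) +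
        fischer l (coord 𝕜 U i • iota j ξ) (iota j η)) + fischer l ξ (coeffDeriv i η) := by
    intro l ξ η
    have h : ∀ j, fischer l (coeffDeriv j (coord 𝕜 U i • ξ)) (coeffDeriv j η) =
        fischer l (coord 𝕜 U i • coeffDeriv j ξ) (coeffDeriv j η) +
          if i = j then fischer l ξ (coeffDeriv j η) else 0 := fun j => by
      rw [coeffDeriv_smul, pderiv_coord, fischer_add_left]
      split_ifs
      · rw [one_smul]
      · rw [zero_smul, fischer_zero_left]
    rw [fischer]
    simp only [h, iota_smul, Finset.sum_add_distrib, Finset.sum_ite_eq, Finset.mem_univ, if_true]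
    ring
  induction k with
  | zero =>
    intro ξ η
    rw [hD, Finset.sum_eq_zero]
    · simp
    · intro j _
      simp [fischer, scalarPart_smul, evalOrigin_coord_mul]
  | succ k ih =>
    intro ξ η
    rw [hD]
    simp only [ih]
    have h2 : fischer (k + 1) ξ (coeffDeriv i η) =
        ∑ j, (fischer k (coeffDeriv j ξ) (coeffDeriv i (coeffDeriv j η)) +
          fischer k (iota j ξ) (coeffDeriv i (iota j η))) := by
      rw [fischer]
      exact Finset.sum_congr rfl fun j _ => by rw [coeffDeriv_comm, iota_coeffDeriv]
    rw [h2]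
    simp only [← mul_add, ← Finset.mul_sum]
    push_cast
    ring

/-- The adjoint of `dx_i ∧ _` is a multiple of `ι_i`. -/
theorem fischer_wedge (k : ℕ) (i : Fin n) : ∀ ξ η : Forms 𝕜 U,
    fischer (k + 1) (wedge i ξ) η = ((k + 1 : ℕ) : 𝕜) * fischer k ξ (iota i η) := by
  have hD : ∀ (l : ℕ) (ξ η : Forms 𝕜 U), fischer (l + 1) (wedge i ξ) η =
      ∑ j, (fischer l (wedge i (coeffDeriv j ξ)) (coeffDeriv j η) -
        fischer l (wedge i (iota j ξ)) (iota j η)) + fischer l ξ (iota i η) := by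
    intro l ξ η
    have h : ∀ j, fischer l (iota j (wedge i ξ)) (iota j η) =
        (if j = i then fischer l ξ (iota j η) else 0) -
          fischer l (wedge i (iota j ξ)) (iota j η) := fun j => by
      rw [iota_wedge, fischer_sub_left]
      split_ifs
      · rfl
      · rw [fischer_zero_left]
    rw [fischer]
    simp only [h, ← wedge_coeffDeriv, Finset.sum_add_distrib, Finset.sum_sub_distrib,
      Finset.sum_ite_eq', Finset.mem_univ, if_true]
    ring
  induction k with
  | zero =>
    intro ξ η
    rw [hD, Finset.sum_eq_zero]
    · simp
    · intro j _
      simp [fischer, scalarPart_wedge]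
  | succ k ih =>
    intro ξ η
    rw [hD]
    simp only [ih]
    have h2 : fischer (k + 1) ξ (iota i η) =
        ∑ j, (fischer k (coeffDeriv j ξ) (iota i (coeffDeriv j η)) -
          fischer k (iota j ξ) (iota i (iota j η))) := by
      rw [fischer]
      refine Finset.sum_congr rfl fun j _ => ?_
      rw [iota_coeffDeriv, iota_iota i j, fischer_neg_right, sub_neg_eq_add]
    rw [h2]
    simp only [← mul_sub, ← Finset.mul_sum]
    push_cast
    ring

theorem re_fischer_self_nonneg (k : ℕ) : ∀ ξ : Forms 𝕜 U, 0 ≤ RCLike.re (fischer k ξ ξ) := by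
  induction k with
  | zero =>
    intro ξ
    rw [fischer, RCLike.mul_conj, ← RCLike.ofReal_pow, RCLike.ofReal_re]
    positivity
  | succ k ih =>
    intro ξ
    rw [fischer, map_sum]
    refine Finset.sum_nonneg fun i _ => ?_
    rw [map_add]
    exact add_nonneg (ih _) (ih _)

/-- The Fischer form is definite on the forms of weight `k`. -/
theorem eq_zero_of_re_fischer_self (hR : 0 < R) (k : ℕ) : ∀ ξ ∈ weightSpace 𝕜 (ball n R) k,
    RCLike.re (fischer k ξ ξ) = 0 → ξ = 0 := by
  induction k with
  | zero =>
    intro ξ hξ h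
    rw [mem_weightSpace, Nat.cast_zero, zero_smul] at hξ
    obtain ⟨c, rfl⟩ := exists_eq_smul_one_of_lieDeriv_radial hξ
    have h1 : scalarPart (1 : Forms 𝕜 (ball n R)) = 1 := scalarPart_ofFun 1
    rw [fischer, RCLike.mul_conj, ← RCLike.ofReal_pow, RCLike.ofReal_re, map_smul, map_smul, h1,
      evalOrigin_one hR] at h
    have h2 : c = 0 := by simpa using h
    rw [h2, zero_smul]
  | succ k ih =>
    intro ξ hξ h
    rw [fischer, map_sum, Finset.sum_eq_zero_iff_of_nonneg (fun i _ => by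
      rw [map_add]
      exact add_nonneg (re_fischer_self_nonneg k _) (re_fischer_self_nonneg k _))] at h
    have h' : ∀ i, RCLike.re (fischer k (coeffDeriv i ξ) (coeffDeriv i ξ)) = 0 ∧
        RCLike.re (fischer k (iota i ξ) (iota i ξ)) = 0 := fun i => by
      have h1 := h i (Finset.mem_univ i)
      rw [map_add] at h1
      exact (add_eq_zero_iff_of_nonneg (re_fischer_self_nonneg k _)
        (re_fischer_self_nonneg k _)).mp h1
    exact eq_zero_of_mem_weightSpace hξ
      (fun i => ih _ (coeffDeriv_mem_weightSpace hξ i) (h' i).1)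
      (fun i => ih _ (iota_mem_weightSpace hξ i) (h' i).2)

/-- The infinitesimal rotations are skew for the Fischer form. -/
theorem fischer_lieDeriv_rotation (k : ℕ) (i j : Fin n) (ξ η : Forms 𝕜 U) :
    fischer (k + 1) (lieDeriv (rotation 𝕜 U i j) ξ) η =
      -fischer (k + 1) ξ (lieDeriv (rotation 𝕜 U i j) η) := by
  have h : ∀ ξ η : Forms 𝕜 U, fischer (k + 1) (lieDeriv (rotation 𝕜 U i j) ξ) η =
      ((k + 1 : ℕ) : 𝕜) * (fischer k (coeffDeriv j ξ) (coeffDeriv i η) -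
        fischer k (coeffDeriv i ξ) (coeffDeriv j η) + (fischer k (iota j ξ) (iota i η) -
        fischer k (iota i ξ) (iota j η))) := fun ξ η => by
    rw [lieDeriv_rotation, fischer_add_left, fischer_sub_left, fischer_sub_left,
      fischer_coord_smul, fischer_coord_smul, fischer_wedge, fischer_wedge]
    ring
  rw [← fischer_conj (k + 1) (lieDeriv (rotation 𝕜 U i j) η) ξ, h, h]
  simp only [map_mul, map_add, map_sub, map_natCast, fischer_conj]
  ring

theorem fischer_lieDeriv_tangential (k : ℕ) (ξ η : Forms 𝕜 U) :
    fischer (k + 1) (lieDeriv (tangential 𝕜 m U) ξ) η =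
      ∑ j : Fin n, if (j : ℕ) < m then 0 else ((k + 1 : ℕ) : 𝕜) *
        (fischer k (coeffDeriv j ξ) (coeffDeriv j η) + fischer k (iota j ξ) (iota j η)) := by
  rw [lieDeriv_tangential, fischer_sum_left]
  refine Finset.sum_congr rfl fun j _ => ?_
  split_ifs
  · exact fischer_zero_left _ _
  · rw [fischer_add_left, fischer_coord_smul, fischer_wedge, mul_add]

/-- The quadratic form of the invariant Laplacian is a sum of squares. -/
theorem fischer_invariantLaplacian (hmn : m ≤ n) (k : ℕ) (ξ η : Forms 𝕜 U) :
    fischer (k + 1) (invariantLaplacian hmn ξ) η =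
      (∑ j : Fin n, if (j : ℕ) < m then 0 else ((k + 1 : ℕ) : 𝕜) *
        (fischer k (coeffDeriv j ξ) (coeffDeriv j η) + fischer k (iota j ξ) (iota j η))) +
      ∑ i : Fin m, ∑ j : Fin m,
        fischer (k + 1) (lieDeriv (rotation 𝕜 U (Fin.castLE hmn i) (Fin.castLE hmn j)) ξ)
          (lieDeriv (rotation 𝕜 U (Fin.castLE hmn i) (Fin.castLE hmn j)) η) := by
  rw [invariantLaplacian_apply, fischer_sub_left, fischer_lieDeriv_tangential, sub_eq_add_neg]
  congr 1
  simp only [fischer_sum_left, ← Finset.sum_neg_distrib]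
  refine Finset.sum_congr rfl fun i _ => Finset.sum_congr rfl fun j _ => ?_
  rw [fischer_lieDeriv_rotation, neg_neg]

theorem fischer_invariantLaplacian_symm (hmn : m ≤ n) (k : ℕ) (ξ η : Forms 𝕜 U) :
    fischer (k + 1) (invariantLaplacian hmn ξ) η =
      fischer (k + 1) ξ (invariantLaplacian hmn η) := by
  rw [← fischer_conj (k + 1) (invariantLaplacian hmn η) ξ, fischer_invariantLaplacian,
    fischer_invariantLaplacian]
  simp only [map_add, map_sum, fischer_conj, apply_ite (starRingEnd 𝕜), map_mul, map_zero,
    map_natCast]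

theorem lieDeriv_mem_weightSpace {V : Fin n → Smooth 𝕜 U}
    (hV : ∀ k, dirDeriv (radial 𝕜 U) (V k) = V k) {k : ℕ} {ξ : Forms 𝕜 U}
    (h : ξ ∈ weightSpace 𝕜 U k) : lieDeriv V ξ ∈ weightSpace 𝕜 U k := by
  rw [mem_weightSpace] at h ⊢
  rw [lieDeriv_radial_lieDeriv hV, h, map_smul]

theorem invariantLaplacian_mem_weightSpace (hmn : m ≤ n) {k : ℕ} {ξ : Forms 𝕜 U}
    (h : ξ ∈ weightSpace 𝕜 U k) : invariantLaplacian hmn ξ ∈ weightSpace 𝕜 U k := by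
  rw [mem_weightSpace] at h ⊢
  rw [lieDeriv_radial_invariantLaplacian, h, map_smul]

/-- A symmetric operator on a definite space has no nilpotent part at the eigenvalue zero. -/
theorem invariantLaplacian_eq_zero_of_sq (hR : 0 < R) (hmn : m ≤ n) {k : ℕ}
    {ξ : Forms 𝕜 (ball n R)} (hξ : ξ ∈ weightSpace 𝕜 (ball n R) (k + 1))
    (h : invariantLaplacian hmn (invariantLaplacian hmn ξ) = 0) :
    invariantLaplacian hmn ξ = 0 := by
  refine eq_zero_of_re_fischer_self hR (k + 1) _ (invariantLaplacian_mem_weightSpace hmn hξ) ?_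
  rw [← fischer_invariantLaplacian_symm, h, fischer_zero_left, map_zero]

/-- The kernel of the symmetric operator `invariantLaplacian` consists of the forms that are
rotation invariant and involve the variables `x_1, …, x_m` only. -/
theorem eq_zero_of_invariantLaplacian (hR : 0 < R) (hmn : m ≤ n) {k : ℕ}
    {ξ : Forms 𝕜 (ball n R)} (hξ : ξ ∈ weightSpace 𝕜 (ball n R) (k + 1))
    (h : invariantLaplacian hmn ξ = 0) :
    (∀ j : Fin n, m ≤ (j : ℕ) → coeffDeriv j ξ = 0 ∧ iota j ξ = 0) ∧
      ∀ i j : Fin m, lieDeriv (rotation 𝕜 _ (Fin.castLE hmn i) (Fin.castLE hmn j)) ξ = 0 := by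
  have h0 := fischer_invariantLaplacian hmn k ξ ξ
  rw [h, fischer_zero_left] at h0
  have h1 := congrArg RCLike.re h0
  rw [map_zero, map_add, map_sum, map_sum] at h1
  simp only [map_sum] at h1
  have hk : 0 < ((k + 1 : ℕ) : ℝ) := by positivity
  have hre : ∀ j : Fin n, RCLike.re (if (j : ℕ) < m then 0 else ((k + 1 : ℕ) : 𝕜) *
      (fischer k (coeffDeriv j ξ) (coeffDeriv j ξ) + fischer k (iota j ξ) (iota j ξ))) =
      if (j : ℕ) < m then 0 else ((k + 1 : ℕ) : ℝ) *
        (RCLike.re (fischer k (coeffDeriv j ξ) (coeffDeriv j ξ)) +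
          RCLike.re (fischer k (iota j ξ) (iota j ξ))) := fun j => by
    split_ifs
    · exact map_zero _
    · rw [← RCLike.ofReal_natCast, RCLike.re_ofReal_mul, map_add]
  simp only [hre] at h1
  have hn1 : ∀ j ∈ (Finset.univ : Finset (Fin n)), 0 ≤ if (j : ℕ) < m then 0 else
      ((k + 1 : ℕ) : ℝ) * (RCLike.re (fischer k (coeffDeriv j ξ) (coeffDeriv j ξ)) +
          RCLike.re (fischer k (iota j ξ) (iota j ξ))) := fun j _ => by
    split_ifs
    · exact le_rfl
    · exact mul_nonneg hk.le (add_nonneg (re_fischer_self_nonneg k _) (re_fischer_self_nonneg k _))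
  have hn3 : ∀ i ∈ (Finset.univ : Finset (Fin m)), ∀ j ∈ (Finset.univ : Finset (Fin m)), 0 ≤
      RCLike.re (fischer (k + 1)
        (lieDeriv (rotation 𝕜 (ball n R) (Fin.castLE hmn i) (Fin.castLE hmn j)) ξ)
        (lieDeriv (rotation 𝕜 (ball n R) (Fin.castLE hmn i) (Fin.castLE hmn j)) ξ)) :=
    fun i _ j _ => re_fischer_self_nonneg _ _
  have hn2 := fun i hi => Finset.sum_nonneg (hn3 i hi)
  obtain ⟨h2, h3⟩ := (add_eq_zero_iff_of_nonneg (Finset.sum_nonneg hn1)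
    (Finset.sum_nonneg hn2)).mp h1.symm
  rw [Finset.sum_eq_zero_iff_of_nonneg hn1] at h2
  rw [Finset.sum_eq_zero_iff_of_nonneg hn2] at h3
  constructor
  · intro j hj
    have h4 := h2 j (Finset.mem_univ j)
    rw [if_neg (not_lt.mpr hj)] at h4
    obtain ⟨h5, h6⟩ := (add_eq_zero_iff_of_nonneg (re_fischer_self_nonneg k _)
      (re_fischer_self_nonneg k _)).mp ((mul_eq_zero.mp h4).resolve_left hk.ne')
    exact ⟨eq_zero_of_re_fischer_self hR k _ (coeffDeriv_mem_weightSpace hξ j) h5,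
      eq_zero_of_re_fischer_self hR k _ (iota_mem_weightSpace hξ j) h6⟩
  · intro i j
    have h4 := h3 i (Finset.mem_univ i)
    rw [Finset.sum_eq_zero_iff_of_nonneg (hn3 i (Finset.mem_univ i))] at h4
    exact eq_zero_of_re_fischer_self hR (k + 1) _
      (lieDeriv_mem_weightSpace (dirDeriv_radial_rotation _ _) hξ) (h4 j (Finset.mem_univ j))

/-- An endomorphism of a finite-dimensional space with `ker T² = ker T` splits the space as
`ker T + im T`. -/
theorem exists_apply_sub_eq_zero {M : Type*} [AddCommGroup M] [Module 𝕜 M] (T : M →ₗ[𝕜] M)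
    (S : Submodule 𝕜 M) [FiniteDimensional 𝕜 S] (hS : ∀ x ∈ S, T x ∈ S)
    (h : ∀ x ∈ S, T (T x) = 0 → T x = 0) {x : M} (hx : x ∈ S) :
    ∃ y ∈ S, T (x - T y) = 0 := by
  -- `T` is injective, hence surjective on its image.
  let T' : S →ₗ[𝕜] S := T.restrict hS
  let T'' : LinearMap.range T' →ₗ[𝕜] LinearMap.range T' :=
    T'.restrict fun y _ => LinearMap.mem_range_self T' y
  have hinj : Function.Injective T'' := by
    rw [injective_iff_map_eq_zero]
    rintro ⟨_, y, rfl⟩ hy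
    have h1 : T (T y.1) = 0 := congrArg (fun z => ((z : LinearMap.range T') : S).1) hy
    exact Subtype.ext (Subtype.ext (h y.1 y.2 h1))
  obtain ⟨⟨_, y, rfl⟩, hz⟩ := LinearMap.injective_iff_surjective.mp hinj
    ⟨T' ⟨x, hx⟩, LinearMap.mem_range_self T' _⟩
  have h2 : T (T y.1) = T x := congrArg (fun z => ((z : LinearMap.range T') : S).1) hz
  exact ⟨y.1, y.2, by rw [map_sub, h2, sub_self]⟩

end Fischer

/-! ### Homotopy operators -/

section Homotopy

variable {𝕜 M : Type*} [Field 𝕜] [AddCommGroup M] [Module 𝕜 M]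

/-- Let `T = dκ + κd` on a complex `A`. If `A = ker T + im T` and `ker T² = ker T`, then every class
has a representative in `ker T`. -/
theorem exists_sub_d_mem_ker {d κ T : M →ₗ[𝕜] M} (hd : ∀ x, d (d x) = 0)
    (hT : ∀ x, T x = d (κ x) + κ (d x)) {A : Submodule 𝕜 M} (hdA : ∀ x ∈ A, d x ∈ A)
    (hκA : ∀ x ∈ A, κ x ∈ A) (h₁ : ∀ a ∈ A, ∃ b ∈ A, T (a - T b) = 0)
    (h₂ : ∀ b ∈ A, T (T b) = 0 → T b = 0) {a : M} (ha : a ∈ A) (hda : d a = 0) :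
    ∃ θ ∈ A, T (a - d θ) = 0 := by
  have hTd : ∀ x, T (d x) = d (T x) := fun x => by simp [hT, hd]
  have hTA : ∀ x ∈ A, T x ∈ A := fun x hx => by
    rw [hT]
    exact add_mem (hdA _ (hκA _ hx)) (hκA _ (hdA _ hx))
  obtain ⟨b, hb, h⟩ := h₁ a ha
  -- Since `T b ∈ im T²`, one may replace `b` by an element of `im T`, which is then closed.
  obtain ⟨c, hc, hbc⟩ := h₁ b hb
  have hTb : T (T c) = T b := by
    rw [map_sub, sub_eq_zero] at hbc; exact hbc.symm
  rw [← hTb] at h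
  have h3 : T (T (T (d c))) = 0 := by
    have := congrArg d h
    rw [map_zero, ← hTd, map_sub, hda, zero_sub, map_neg, neg_eq_zero] at this
    rw [hTd, hTd]
    exact this
  have h4 : d (T c) = 0 := by
    rw [← hTd]
    exact h₂ _ (hdA _ hc) (h₂ _ (hTA _ (hdA _ hc)) h3)
  refine ⟨κ (T c), hκA _ (hTA _ hc), ?_⟩
  rw [hT (T c), h4, map_zero, add_zero] at h
  exact h

/-- Under the same hypotheses, an exact element of `ker T` is the differential of an element of
`ker T`. -/
theorem exists_d_eq_of_mem_ker {d κ T : M →ₗ[𝕜] M} (hd : ∀ x, d (d x) = 0)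
    (hT : ∀ x, T x = d (κ x) + κ (d x)) {A : Submodule 𝕜 M} (hdA : ∀ x ∈ A, d x ∈ A)
    (h₁ : ∀ a ∈ A, ∃ b ∈ A, T (a - T b) = 0)
    (h₂ : ∀ b ∈ A, T (T b) = 0 → T b = 0) {v : M} (hv : v ∈ A) (hTdv : T (d v) = 0) :
    ∃ b ∈ A, T (v - T b) = 0 ∧ d (v - T b) = d v := by
  have hTd : ∀ x, T (d x) = d (T x) := fun x => by simp [hT, hd]
  obtain ⟨b, hb, h⟩ := h₁ v hv
  refine ⟨b, hb, h, ?_⟩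
  have h3 := congrArg d h
  rw [map_zero, ← hTd, map_sub, map_sub, hTdv, zero_sub, neg_eq_zero, ← hTd] at h3
  rw [map_sub, ← hTd, h₂ _ (hdA _ hb) h3, sub_zero]

end Homotopy

/-! ### Reduction to invariant forms -/

section PoleForms

variable {𝕜 : Type*} [RCLike 𝕜] {n m : ℕ} {hmn : m ≤ n} {R : ℝ}

theorem muFun_mul_muInv (hmn : m ≤ n) (R : ℝ) :
    muFun 𝕜 hmn (compl hmn R) * muInv 𝕜 hmn R = 1 := by
  ext x
  change ((mu hmn x.1 : ℝ) : 𝕜) * (((mu hmn x.1)⁻¹ : ℝ) : 𝕜) = 1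
  rw [← RCLike.ofReal_mul, mul_inv_cancel₀ (mu_ne_zero x.2), RCLike.ofReal_one]

theorem muFun_pow_mul_muInv_pow (hmn : m ≤ n) (R : ℝ) (N : ℕ) :
    muFun 𝕜 hmn (compl hmn R) ^ N * muInv 𝕜 hmn R ^ N = 1 := by
  rw [← mul_pow, muFun_mul_muInv, one_pow]

theorem muFun_smul_cancel {ξ : Forms 𝕜 (compl hmn R)} (N : ℕ)
    (h : muFun 𝕜 hmn (compl hmn R) ^ N • ξ = 0) : ξ = 0 := by
  have := congrArg (fun ζ => muInv 𝕜 hmn R ^ N • ζ) h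
  simpa only [smul_smul, mul_comm (muInv 𝕜 hmn R ^ N), muFun_pow_mul_muInv_pow, one_smul,
    smul_zero] using this

theorem mem_poleForms {ξ : Forms 𝕜 (compl hmn R)} : ξ ∈ PoleForms 𝕜 hmn R ↔
    ∃ (N : ℕ) (η : Forms 𝕜 (ball n R)), muFun 𝕜 hmn (compl hmn R) ^ N • ξ =
      restrict 𝕜 (compl_le hmn R) η := by
  simp only [← ofFun_mul]
  exact Iff.rfl

/-- The exponent of `μ` may be taken positive, so that the numerator of a form of weight zero has
positive weight. -/
theorem exists_extension_succ {ξ : Forms 𝕜 (compl hmn R)} (h : ξ ∈ PoleForms 𝕜 hmn R) :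
    ∃ (N : ℕ) (η : Forms 𝕜 (ball n R)), muFun 𝕜 hmn (compl hmn R) ^ (N + 1) • ξ =
      restrict 𝕜 (compl_le hmn R) η := by
  obtain ⟨N, η, h⟩ := mem_poleForms.mp h
  refine ⟨N, muFun 𝕜 hmn (ball n R) • η, ?_⟩
  rw [restrict_smul, ← h, restrictFun_muFun, smul_smul, pow_succ']

theorem restrict_mem_poleForms (η : Forms 𝕜 (ball n R)) :
    restrict 𝕜 (compl_le hmn R) η ∈ PoleForms 𝕜 hmn R :=
  mem_poleForms.mpr ⟨0, η, by rw [pow_zero, one_smul]⟩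

theorem smul_mem_poleForms {ξ : Forms 𝕜 (compl hmn R)} (f : Smooth 𝕜 (ball n R))
    (h : ξ ∈ PoleForms 𝕜 hmn R) : restrictFun 𝕜 (compl_le hmn R) f • ξ ∈ PoleForms 𝕜 hmn R := by
  obtain ⟨N, η, h⟩ := mem_poleForms.mp h
  refine mem_poleForms.mpr ⟨N, f • η, ?_⟩
  rw [restrict_smul, ← h, smul_comm]

theorem muInv_pow_smul_mem_poleForms {ξ : Forms 𝕜 (compl hmn R)} (N : ℕ)
    (h : ξ ∈ PoleForms 𝕜 hmn R) : muInv 𝕜 hmn R ^ N • ξ ∈ PoleForms 𝕜 hmn R := by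
  obtain ⟨M, η, h⟩ := mem_poleForms.mp h
  refine mem_poleForms.mpr ⟨M + N, η, ?_⟩
  rw [smul_smul, pow_add, mul_assoc, muFun_pow_mul_muInv_pow, mul_one, h]

theorem iota_mem_poleForms {ξ : Forms 𝕜 (compl hmn R)} (i : Fin n)
    (h : ξ ∈ PoleForms 𝕜 hmn R) : iota i ξ ∈ PoleForms 𝕜 hmn R := by
  obtain ⟨N, η, h⟩ := mem_poleForms.mp h
  refine mem_poleForms.mpr ⟨N, iota i η, ?_⟩
  rw [← iota_smul, h, restrict_iota]

theorem wedge_mem_poleForms {ξ : Forms 𝕜 (compl hmn R)} (i : Fin n)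
    (h : ξ ∈ PoleForms 𝕜 hmn R) : wedge i ξ ∈ PoleForms 𝕜 hmn R := by
  obtain ⟨N, η, h⟩ := mem_poleForms.mp h
  refine mem_poleForms.mpr ⟨N, wedge i η, ?_⟩
  rw [← wedge_smul, h, restrict_wedge]

theorem degreeOp_mem_poleForms {ξ : Forms 𝕜 (compl hmn R)}
    (h : ξ ∈ PoleForms 𝕜 hmn R) : degreeOp ξ ∈ PoleForms 𝕜 hmn R := by
  rw [degreeOp_apply]
  exact sum_mem fun i _ => wedge_mem_poleForms i (iota_mem_poleForms i h)

theorem contract_mem_poleForms {V : Fin n → Smooth 𝕜 (ball n R)}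
    {V' : Fin n → Smooth 𝕜 (compl hmn R)}
    (hV : ∀ k, restrictFun 𝕜 (compl_le hmn R) (V k) = V' k)
    {ξ : Forms 𝕜 (compl hmn R)} (h : ξ ∈ PoleForms 𝕜 hmn R) :
    contract V' ξ ∈ PoleForms 𝕜 hmn R := by
  rw [contract_eq_sum]
  refine sum_mem fun i _ => ?_
  rw [← hV]
  exact smul_mem_poleForms _ (iota_mem_poleForms i h)

theorem lieDeriv_mem_poleForms {V : Fin n → Smooth 𝕜 (ball n R)}
    {V' : Fin n → Smooth 𝕜 (compl hmn R)}
    (hV : ∀ k, restrictFun 𝕜 (compl_le hmn R) (V k) = V' k)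
    {ξ : Forms 𝕜 (compl hmn R)} (h : ξ ∈ PoleForms 𝕜 hmn R) :
    lieDeriv V' ξ ∈ PoleForms 𝕜 hmn R := by
  rw [lieDeriv_apply]
  exact add_mem (d_mem_poleForms (contract_mem_poleForms hV h))
    (contract_mem_poleForms hV (d_mem_poleForms h))

theorem invariantHomotopy_mem_poleForms {ξ : Forms 𝕜 (compl hmn R)}
    (h : ξ ∈ PoleForms 𝕜 hmn R) : invariantHomotopy hmn ξ ∈ PoleForms 𝕜 hmn R := by
  rw [invariantHomotopy_apply]
  refine sub_mem (contract_mem_poleForms (restrictFun_tangential _) h)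
    (sum_mem fun i _ => sum_mem fun j _ => ?_)
  exact contract_mem_poleForms (restrictFun_rotation _ _ _)
    (lieDeriv_mem_poleForms (restrictFun_rotation _ _ _) h)

theorem dirDeriv_radial_muFun_pow {U : TopologicalSpace.Opens (EuclideanSpace ℝ (Fin n))}
    (hmn : m ≤ n) (N : ℕ) :
    dirDeriv (radial 𝕜 U) (muFun 𝕜 hmn U ^ N) = ((2 * N : ℕ) : 𝕜) • muFun 𝕜 hmn U ^ N := by
  rw [dirDeriv_pow_of_eq_smul (dirDeriv_radial_muFun hmn), Nat.cast_mul, Nat.cast_two, mul_comm]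

/-- `L_E` on `μ^{-N} η` is `L_E - 2N` on `η`. -/
theorem muFun_smul_lieDeriv_radial {ξ : Forms 𝕜 (compl hmn R)} {N : ℕ}
    {η : Forms 𝕜 (ball n R)}
    (h : muFun 𝕜 hmn (compl hmn R) ^ N • ξ = restrict 𝕜 (compl_le hmn R) η) :
    muFun 𝕜 hmn (compl hmn R) ^ N • lieDeriv (radial 𝕜 _) ξ =
      restrict 𝕜 (compl_le hmn R) (lieDeriv (radial 𝕜 _) η - ((2 * N : ℕ) : 𝕜) • η) := by
  rw [map_sub, map_smul, ← h, ← restrict_lieDeriv (compl_le hmn R) (restrictFun_radial _), ← h,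
    lieDeriv_smul, dirDeriv_radial_muFun_pow, smul_assoc, add_sub_cancel_right]

/-- The invariant Laplacian acts on `μ^{-N} η` by its action on `η`, as `μ` is invariant. -/
theorem muFun_smul_invariantLaplacian {ξ : Forms 𝕜 (compl hmn R)} {N : ℕ}
    {η : Forms 𝕜 (ball n R)}
    (h : muFun 𝕜 hmn (compl hmn R) ^ N • ξ = restrict 𝕜 (compl_le hmn R) η) :
    muFun 𝕜 hmn (compl hmn R) ^ N • invariantLaplacian hmn ξ =
      restrict 𝕜 (compl_le hmn R) (invariantLaplacian hmn η) := by
  rw [← restrict_invariantLaplacian, ← h, invariantLaplacian_smul]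
  · exact dirDeriv_pow_eq_zero (dirDeriv_tangential_muFun hmn) N
  · exact fun i j hi hj => dirDeriv_pow_eq_zero (dirDeriv_rotation_muFun hmn hi hj) N

theorem muFun_smul_muInv_smul (N : ℕ) (ξ : Forms 𝕜 (compl hmn R)) :
    muFun 𝕜 hmn (compl hmn R) ^ N • muInv 𝕜 hmn R ^ N • ξ = ξ := by
  rw [smul_smul, muFun_pow_mul_muInv_pow, one_smul]

/-- `𝒜_μ(X)` is the sum of the kernel and of the image of `L_E`: split the numerator by weights. -/
theorem exists_lieDeriv_radial_sub_eq_zero {a : Forms 𝕜 (compl hmn R)}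
    (ha : a ∈ PoleForms 𝕜 hmn R) : ∃ b ∈ PoleForms 𝕜 hmn R,
      lieDeriv (radial 𝕜 _) (a - lieDeriv (radial 𝕜 _) b) = 0 := by
  obtain ⟨N, η, h⟩ := mem_poleForms.mp ha
  obtain ⟨η₀, hη₀, ζ, hζ⟩ := exists_weightSpace_add (2 * N) η
  have hb := muFun_smul_muInv_smul N (restrict 𝕜 (compl_le hmn R) ζ)
  refine ⟨_, muInv_pow_smul_mem_poleForms N (restrict_mem_poleForms ζ), muFun_smul_cancel N ?_⟩
  refine (muFun_smul_lieDeriv_radial (η := η₀) ?_).trans ?_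
  · rw [smul_sub, h, muFun_smul_lieDeriv_radial hb, ← map_sub, hζ, add_sub_cancel_right]
  · rw [mem_weightSpace.mp hη₀, sub_self, map_zero]

theorem weight_of_lieDeriv_radial_eq_zero (hm : 1 ≤ m) {ξ : Forms 𝕜 (compl hmn R)} {N : ℕ}
    {η : Forms 𝕜 (ball n R)}
    (h : muFun 𝕜 hmn (compl hmn R) ^ N • ξ = restrict 𝕜 (compl_le hmn R) η)
    (hξ : lieDeriv (radial 𝕜 _) ξ = 0) : η ∈ weightSpace 𝕜 (ball n R) (2 * N) := by
  have h1 := muFun_smul_lieDeriv_radial h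
  rw [hξ, smul_zero] at h1
  exact mem_weightSpace.mpr (sub_eq_zero.mp (restrict_compl_injective hm hmn
    (h1.symm.trans (map_zero _).symm)))

/-- On `𝒜_μ(X)` the operator `L_E` has no nilpotent part at the eigenvalue zero. -/
theorem lieDeriv_radial_eq_zero_of_sq (hm : 1 ≤ m) (hR : 0 < R) {b : Forms 𝕜 (compl hmn R)}
    (hb : b ∈ PoleForms 𝕜 hmn R)
    (h : lieDeriv (radial 𝕜 _) (lieDeriv (radial 𝕜 _) b) = 0) :
    lieDeriv (radial 𝕜 _) b = 0 := by
  obtain ⟨N, η, hη⟩ := mem_poleForms.mp hb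
  have h1 := muFun_smul_lieDeriv_radial hη
  have h2 := mem_weightSpace_of_sub_mem hR _ _ (weight_of_lieDeriv_radial_eq_zero hm h1 h)
  refine muFun_smul_cancel N ?_
  rw [h1, mem_weightSpace.mp h2, sub_self, map_zero]

/-- The forms in `𝒜_μ(X)` that are invariant under dilations of `ℝⁿ`. -/
def dilationInvariant (𝕜 : Type*) [RCLike 𝕜] {n m : ℕ} (hmn : m ≤ n) (R : ℝ) :
    Submodule 𝕜 (Forms 𝕜 (compl hmn R)) :=
  Subalgebra.toSubmodule (PoleForms 𝕜 hmn R) ⊓ LinearMap.ker (lieDeriv (radial 𝕜 (compl hmn R)))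

theorem mem_dilationInvariant {ξ : Forms 𝕜 (compl hmn R)} : ξ ∈ dilationInvariant 𝕜 hmn R ↔
    ξ ∈ PoleForms 𝕜 hmn R ∧ lieDeriv (radial 𝕜 _) ξ = 0 := Iff.rfl

/-- The dilation invariant forms are the sum of the kernel and of the image of the invariant
Laplacian: the numerators of bounded pole order form a finite-dimensional space. -/
theorem exists_invariantLaplacian_sub_eq_zero (hm : 1 ≤ m) (hR : 0 < R)
    {a : Forms 𝕜 (compl hmn R)} (ha : a ∈ dilationInvariant 𝕜 hmn R) :
    ∃ b ∈ dilationInvariant 𝕜 hmn R,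
      invariantLaplacian hmn (a - invariantLaplacian hmn b) = 0 := by
  obtain ⟨N, η, h⟩ := exists_extension_succ ha.1
  have hη := weight_of_lieDeriv_radial_eq_zero hm h ha.2
  have hfin := finiteDimensional_weightSpace (𝕜 := 𝕜) (n := n) (R := R) (2 * (N + 1))
  obtain ⟨ζ, hζ, hζ'⟩ := exists_apply_sub_eq_zero (invariantLaplacian hmn)
    (weightSpace 𝕜 (ball n R) (2 * (N + 1)))
    (fun x hx => invariantLaplacian_mem_weightSpace hmn hx)
    (fun x hx => invariantLaplacian_eq_zero_of_sq (k := 2 * N + 1) hR hmn hx) hη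
  have hb := muFun_smul_muInv_smul (N + 1) (restrict 𝕜 (compl_le hmn R) ζ)
  refine ⟨muInv 𝕜 hmn R ^ (N + 1) • restrict 𝕜 (compl_le hmn R) ζ,
    ⟨muInv_pow_smul_mem_poleForms _ (restrict_mem_poleForms ζ), ?_⟩, ?_⟩
  · refine muFun_smul_cancel (N + 1) ?_
    rw [muFun_smul_lieDeriv_radial hb, mem_weightSpace.mp hζ, sub_self, map_zero]
  · refine muFun_smul_cancel (N + 1) ?_
    rw [muFun_smul_invariantLaplacian (η := η - invariantLaplacian hmn ζ), hζ', map_zero]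
    rw [smul_sub, h, muFun_smul_invariantLaplacian hb, map_sub]

theorem invariantLaplacian_eq_zero_of_sq_poleForms (hm : 1 ≤ m) (hR : 0 < R)
    {b : Forms 𝕜 (compl hmn R)} (hb : b ∈ dilationInvariant 𝕜 hmn R)
    (h : invariantLaplacian hmn (invariantLaplacian hmn b) = 0) :
    invariantLaplacian hmn b = 0 := by
  obtain ⟨N, η, hη⟩ := exists_extension_succ hb.1
  have hw := weight_of_lieDeriv_radial_eq_zero hm hη hb.2
  have h1 := muFun_smul_invariantLaplacian hη
  have h2 := muFun_smul_invariantLaplacian h1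
  rw [h, smul_zero] at h2
  have h3 := invariantLaplacian_eq_zero_of_sq (k := 2 * N + 1) hR hmn hw
    (restrict_compl_injective hm hmn (h2.symm.trans (map_zero _).symm))
  refine muFun_smul_cancel (N + 1) ?_
  rw [h1, h3, map_zero]

/-- The forms in `𝒜_μ(X)` that are invariant under all dilations, under the infinitesimal rotations
of `x_1, …, x_m`, and do not involve the other variables. -/
structure IsInvariant (ξ : Forms 𝕜 (compl hmn R)) : Prop where
  mem : ξ ∈ PoleForms 𝕜 hmn R
  radial : lieDeriv (radial 𝕜 (compl hmn R)) ξ = 0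
  coeffDeriv : ∀ j : Fin n, m ≤ (j : ℕ) → coeffDeriv j ξ = 0
  iota : ∀ j : Fin n, m ≤ (j : ℕ) → iota j ξ = 0
  rotation : ∀ i j : Fin m,
    lieDeriv (rotation 𝕜 (compl hmn R) (Fin.castLE hmn i) (Fin.castLE hmn j)) ξ = 0

/-- The numerator has positive weight, so that the kernel of the invariant Laplacian is known. -/
theorem isInvariant_of_invariantLaplacian (hm : 1 ≤ m) (hR : 0 < R)
    {ξ : Forms 𝕜 (compl hmn R)} (hξ : ξ ∈ dilationInvariant 𝕜 hmn R)
    (h : invariantLaplacian hmn ξ = 0) : IsInvariant ξ := by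
  obtain ⟨N, η, hη⟩ := exists_extension_succ hξ.1
  have hw := weight_of_lieDeriv_radial_eq_zero hm hη hξ.2
  have h1 := muFun_smul_invariantLaplacian hη
  rw [h, smul_zero] at h1
  obtain ⟨h2, h3⟩ := eq_zero_of_invariantLaplacian (k := 2 * N + 1) hR hmn hw
    (restrict_compl_injective hm hmn (h1.symm.trans (map_zero _).symm))
  refine ⟨hξ.1, hξ.2, fun j hj => muFun_smul_cancel (N + 1) ?_,
    fun j hj => muFun_smul_cancel (N + 1) ?_, fun i j => muFun_smul_cancel (N + 1) ?_⟩
  · have h4 := congrArg (LocalDeRham.coeffDeriv j) hη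
    have h5 : pderiv 𝕜 (compl hmn R) j (muFun 𝕜 hmn (compl hmn R)) = 0 := by
      rw [pderiv_muFun, if_neg (not_lt.mpr hj)]
    rw [coeffDeriv_smul, restrict_coeffDeriv, (h2 j hj).1, map_zero, pderiv_eq_dirDeriv,
      dirDeriv_pow_eq_zero (by rw [← pderiv_eq_dirDeriv, h5]), zero_smul, add_zero] at h4
    exact h4
  · rw [← iota_smul, hη, restrict_iota, (h2 j hj).2, map_zero]
  · have h4 := congrArg (lieDeriv (LocalDeRham.rotation 𝕜 (compl hmn R) (Fin.castLE hmn i)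
      (Fin.castLE hmn j))) hη
    rw [lieDeriv_smul, dirDeriv_pow_eq_zero (dirDeriv_rotation_muFun hmn i.2 j.2), zero_smul,
      add_zero, restrict_lieDeriv _ (restrictFun_rotation _ _ _), h3 i j, map_zero] at h4
    exact h4

theorem d_mem_dilationInvariant {ξ : Forms 𝕜 (compl hmn R)}
    (h : ξ ∈ dilationInvariant 𝕜 hmn R) : d 𝕜 _ ξ ∈ dilationInvariant 𝕜 hmn R :=
  mem_dilationInvariant.mpr ⟨d_mem_poleForms h.1, by
    rw [lieDeriv_d, (mem_dilationInvariant.mp h).2, map_zero]⟩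

theorem invariantHomotopy_mem_dilationInvariant {ξ : Forms 𝕜 (compl hmn R)}
    (h : ξ ∈ dilationInvariant 𝕜 hmn R) : invariantHomotopy hmn ξ ∈ dilationInvariant 𝕜 hmn R :=
  mem_dilationInvariant.mpr ⟨invariantHomotopy_mem_poleForms h.1, by
    rw [lieDeriv_radial_invariantHomotopy, (mem_dilationInvariant.mp h).2,
      map_zero]⟩

theorem IsInvariant.invariantLaplacian_eq_zero {ξ : Forms 𝕜 (compl hmn R)}
    (h : IsInvariant ξ) : invariantLaplacian hmn ξ = 0 := by
  rw [invariantLaplacian_apply, lieDeriv_tangential, Finset.sum_eq_zero, zero_sub, neg_eq_zero]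
  · exact Finset.sum_eq_zero fun i _ => Finset.sum_eq_zero fun j _ => by
      rw [h.rotation, map_zero]
  · intro j _
    split_ifs with hj
    · rfl
    · rw [h.coeffDeriv j (not_lt.mp hj), h.iota j (not_lt.mp hj), map_zero, smul_zero, add_zero]

/-- Every cohomology class of `𝒜_μ(X)` is represented by an invariant form. -/
theorem exists_isInvariant_sub_d (hm : 1 ≤ m) (hR : 0 < R) {ξ : Forms 𝕜 (compl hmn R)}
    (hξ : ξ ∈ PoleForms 𝕜 hmn R) (hd : d 𝕜 _ ξ = 0) :
    ∃ θ ∈ PoleForms 𝕜 hmn R, IsInvariant (ξ - d 𝕜 _ θ) := by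
  -- Make the form invariant under dilations first, then under rotations and translations.
  obtain ⟨θ₁, hθ₁, h₁⟩ := exists_sub_d_mem_ker (d := d 𝕜 (compl hmn R))
    (κ := contract (radial 𝕜 _)) (T := lieDeriv (radial 𝕜 _))
    (A := Subalgebra.toSubmodule (PoleForms 𝕜 hmn R)) d_d (fun x => lieDeriv_apply _ x)
    (fun x hx => d_mem_poleForms hx)
    (fun x hx => contract_mem_poleForms (restrictFun_radial _) hx)
    (fun a ha => exists_lieDeriv_radial_sub_eq_zero ha)
    (fun b hb => lieDeriv_radial_eq_zero_of_sq hm hR hb) hξ hd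
  have h1 : ξ - d 𝕜 _ θ₁ ∈ dilationInvariant 𝕜 hmn R :=
    ⟨sub_mem hξ (d_mem_poleForms hθ₁), h₁⟩
  obtain ⟨θ₂, hθ₂, h₂⟩ := exists_sub_d_mem_ker (d := d 𝕜 (compl hmn R))
    (κ := invariantHomotopy hmn) (T := invariantLaplacian hmn)
    (A := dilationInvariant 𝕜 hmn R) d_d (invariantLaplacian_eq hmn)
    (fun x hx => d_mem_dilationInvariant hx)
    (fun x hx => invariantHomotopy_mem_dilationInvariant hx)
    (fun a ha => exists_invariantLaplacian_sub_eq_zero hm hR ha)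
    (fun b hb => invariantLaplacian_eq_zero_of_sq_poleForms hm hR hb) h1
    (by rw [map_sub, d_d, hd, sub_zero])
  refine ⟨θ₁ + θ₂, add_mem hθ₁ hθ₂.1, ?_⟩
  rw [map_add, ← sub_sub]
  exact isInvariant_of_invariantLaplacian hm hR (sub_mem h1 (d_mem_dilationInvariant hθ₂)) h₂

/-- An exact invariant form is the differential of an invariant form. -/
theorem IsInvariant.exists_d_eq (hm : 1 ≤ m) (hR : 0 < R) {ξ θ : Forms 𝕜 (compl hmn R)}
    (hξ : IsInvariant ξ) (hθ : θ ∈ PoleForms 𝕜 hmn R) (h : d 𝕜 _ θ = ξ) :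
    ∃ θ', IsInvariant θ' ∧ d 𝕜 _ θ' = ξ := by
  subst h
  obtain ⟨b₁, hb₁, h₁, e₁⟩ := exists_d_eq_of_mem_ker (d := d 𝕜 (compl hmn R))
    (κ := contract (LocalDeRham.radial 𝕜 _)) (T := lieDeriv (LocalDeRham.radial 𝕜 _))
    (A := Subalgebra.toSubmodule (PoleForms 𝕜 hmn R)) d_d (fun x => lieDeriv_apply _ x)
    (fun x hx => d_mem_poleForms hx)
    (fun a ha => exists_lieDeriv_radial_sub_eq_zero ha)
    (fun b hb => lieDeriv_radial_eq_zero_of_sq hm hR hb) hθ hξ.radial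
  have h1 : θ - lieDeriv (LocalDeRham.radial 𝕜 _) b₁ ∈ dilationInvariant 𝕜 hmn R :=
    ⟨sub_mem hθ (lieDeriv_mem_poleForms (restrictFun_radial _) hb₁), h₁⟩
  obtain ⟨b₂, hb₂, h₂, e₂⟩ := exists_d_eq_of_mem_ker (d := d 𝕜 (compl hmn R))
    (κ := invariantHomotopy hmn) (T := invariantLaplacian hmn)
    (A := dilationInvariant 𝕜 hmn R) d_d (invariantLaplacian_eq hmn)
    (fun x hx => d_mem_dilationInvariant hx)
    (fun a ha => exists_invariantLaplacian_sub_eq_zero hm hR ha)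
    (fun b hb => invariantLaplacian_eq_zero_of_sq_poleForms hm hR hb) h1
    (by rw [e₁, hξ.invariantLaplacian_eq_zero])
  refine ⟨_, isInvariant_of_invariantLaplacian hm hR (sub_mem h1 ?_) h₂, by rw [e₂, e₁]⟩
  rw [invariantLaplacian_eq]
  exact add_mem (d_mem_dilationInvariant (invariantHomotopy_mem_dilationInvariant hb₂))
    (invariantHomotopy_mem_dilationInvariant (d_mem_dilationInvariant hb₂))

end PoleForms

/-! ### Contraction with the normal Euler field -/

section NormalEuler

variable {𝕜 : Type*} [RCLike 𝕜] {n m : ℕ}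
  {U : TopologicalSpace.Opens (EuclideanSpace ℝ (Fin n))}

/-- The operator `½ dμ ∧ _`. -/
def wedgeHalfMu (hmn : m ≤ n) : Forms 𝕜 U →ₗ[𝕜] Forms 𝕜 U where
  toFun ξ := ∑ i : Fin m, coord 𝕜 U (Fin.castLE hmn i) • wedge (Fin.castLE hmn i) ξ
  map_add' ξ η := by simp only [map_add, smul_add, Finset.sum_add_distrib]
  map_smul' c ξ := by
    simp only [map_smul, Finset.smul_sum, RingHom.id_apply]
    exact Finset.sum_congr rfl fun i _ => smul_comm _ _ _

theorem wedgeHalfMu_apply (hmn : m ≤ n) (ξ : Forms 𝕜 U) : wedgeHalfMu hmn ξ =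
    ∑ i : Fin m, coord 𝕜 U (Fin.castLE hmn i) • wedge (Fin.castLE hmn i) ξ := rfl

theorem contract_euler (hmn : m ≤ n) (ξ : Forms 𝕜 U) : contract (euler 𝕜 m U) ξ =
    ∑ i : Fin m, coord 𝕜 U (Fin.castLE hmn i) • iota (Fin.castLE hmn i) ξ := by
  rw [contract_eq_sum, sum_castLE hmn fun k => coord 𝕜 U k • iota k ξ]
  refine Finset.sum_congr rfl fun k _ => ?_
  rw [euler]
  split_ifs
  · rfl
  · exact zero_smul _ _

theorem contract_smul (V : Fin n → Smooth 𝕜 U) (f : Smooth 𝕜 U) (ξ : Forms 𝕜 U) :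
    contract V (f • ξ) = f • contract V ξ := by
  simp only [contract_eq_sum, iota_smul, Finset.smul_sum]
  exact Finset.sum_congr rfl fun i _ => smul_comm _ _ _

theorem iota_contract (V : Fin n → Smooth 𝕜 U) (j : Fin n) (ξ : Forms 𝕜 U) :
    iota j (contract V ξ) = -contract V (iota j ξ) := by
  simp only [contract_eq_sum, map_sum, iota_smul, iota_iota j, smul_neg, Finset.sum_neg_distrib]

theorem contract_contract (V : Fin n → Smooth 𝕜 U) (ξ : Forms 𝕜 U) :
    contract V (contract V ξ) = 0 := by
  have h : contract V (contract V ξ) = -contract V (contract V ξ) := by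
    conv_lhs => rw [contract_eq_sum]
    conv_rhs => rw [contract_eq_sum V ξ]
    simp only [iota_contract, smul_neg, Finset.sum_neg_distrib, map_sum, contract_smul]
  have h2 : (2 : 𝕜) • contract V (contract V ξ) = 0 := by
    rw [two_smul]
    exact eq_neg_iff_add_eq_zero.mp h
  exact (smul_eq_zero.mp h2).resolve_left two_ne_zero

theorem wedgeHalfMu_smul (hmn : m ≤ n) (f : Smooth 𝕜 U) (ξ : Forms 𝕜 U) :
    wedgeHalfMu hmn (f • ξ) = f • wedgeHalfMu hmn ξ := by
  simp only [wedgeHalfMu_apply, wedge_smul, Finset.smul_sum]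
  exact Finset.sum_congr rfl fun i _ => smul_comm _ _ _

theorem wedge_wedgeHalfMu (hmn : m ≤ n) (j : Fin n) (ξ : Forms 𝕜 U) :
    wedge j (wedgeHalfMu hmn ξ) = -wedgeHalfMu hmn (wedge j ξ) := by
  simp only [wedgeHalfMu_apply, map_sum, wedge_smul, wedge_wedge j, smul_neg,
    Finset.sum_neg_distrib]

theorem wedgeHalfMu_wedgeHalfMu (hmn : m ≤ n) (ξ : Forms 𝕜 U) :
    wedgeHalfMu hmn (wedgeHalfMu hmn ξ) = 0 := by
  have h : wedgeHalfMu hmn (wedgeHalfMu hmn ξ) = -wedgeHalfMu hmn (wedgeHalfMu hmn ξ) := by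
    conv_lhs => rw [wedgeHalfMu_apply]
    conv_rhs => rw [wedgeHalfMu_apply hmn ξ]
    simp only [wedge_wedgeHalfMu, smul_neg, Finset.sum_neg_distrib, map_sum, wedgeHalfMu_smul]
  have h2 : (2 : 𝕜) • wedgeHalfMu hmn (wedgeHalfMu hmn ξ) = 0 := by
    rw [two_smul]
    exact eq_neg_iff_add_eq_zero.mp h
  exact (smul_eq_zero.mp h2).resolve_left two_ne_zero

theorem iota_wedgeHalfMu (hmn : m ≤ n) (j : Fin m) (ξ : Forms 𝕜 U) :
    iota (Fin.castLE hmn j) (wedgeHalfMu hmn ξ) = coord 𝕜 U (Fin.castLE hmn j) • ξ -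
      wedgeHalfMu hmn (iota (Fin.castLE hmn j) ξ) := by
  simp only [wedgeHalfMu_apply, map_sum, iota_smul, iota_wedge, smul_sub,
    Finset.sum_sub_distrib]
  congr 1
  rw [Finset.sum_eq_single j]
  · rw [if_pos rfl]
  · intro b _ hb
    rw [if_neg fun e => hb (Fin.castLE_injective hmn e).symm, smul_zero]
  · simp

theorem iota_wedgeHalfMu_of_le (hmn : m ≤ n) {j : Fin n} (hj : m ≤ (j : ℕ)) (ξ : Forms 𝕜 U) :
    iota j (wedgeHalfMu hmn ξ) = -wedgeHalfMu hmn (iota j ξ) := by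
  simp only [wedgeHalfMu_apply, map_sum, iota_smul, ← Finset.sum_neg_distrib, ← smul_neg]
  refine Finset.sum_congr rfl fun i _ => ?_
  rw [iota_wedge_of_ne]
  intro e
  have := i.2
  rw [e] at hj
  simp only [Fin.val_castLE] at hj
  omega

theorem muFun_smul (hmn : m ≤ n) (ξ : Forms 𝕜 U) : muFun 𝕜 hmn U • ξ =
    ∑ i : Fin m, coord 𝕜 U (Fin.castLE hmn i) • coord 𝕜 U (Fin.castLE hmn i) • ξ := by
  rw [muFun_eq_sum, Finset.sum_smul]
  exact Finset.sum_congr rfl fun i _ => mul_smul _ _ _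

theorem contract_wedgeHalfMu (hmn : m ≤ n) (ξ : Forms 𝕜 U) :
    contract (euler 𝕜 m U) (wedgeHalfMu hmn ξ) = muFun 𝕜 hmn U • ξ -
      wedgeHalfMu hmn (contract (euler 𝕜 m U) ξ) := by
  rw [contract_euler hmn, contract_euler hmn, muFun_smul]
  simp only [iota_wedgeHalfMu, smul_sub, Finset.sum_sub_distrib, map_sum, wedgeHalfMu_smul]

theorem degreeOp_wedgeHalfMu (hmn : m ≤ n) (ξ : Forms 𝕜 U) :
    degreeOp (wedgeHalfMu hmn ξ) = wedgeHalfMu hmn (degreeOp ξ) + wedgeHalfMu hmn ξ := by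
  simp only [wedgeHalfMu_apply, map_sum, degreeOp_smul, degreeOp_wedge, smul_add,
    Finset.sum_add_distrib]

theorem degreeOp_contract (V : Fin n → Smooth 𝕜 U) (ξ : Forms 𝕜 U) :
    degreeOp (contract V ξ) = contract V (degreeOp ξ) - contract V ξ := by
  simp only [contract_eq_sum, map_sum, degreeOp_smul, degreeOp_iota, smul_sub,
    Finset.sum_sub_distrib]

theorem degreeOp_lieDeriv (V : Fin n → Smooth 𝕜 U) (ξ : Forms 𝕜 U) :
    degreeOp (lieDeriv V ξ) = lieDeriv V (degreeOp ξ) := by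
  simp only [lieDeriv_apply, map_add, degreeOp_d, degreeOp_contract, map_sub]
  abel

theorem lieDeriv_rotation_iota (i j k : Fin n) (ξ : Forms 𝕜 U) :
    lieDeriv (rotation 𝕜 U i j) (iota k ξ) = iota k (lieDeriv (rotation 𝕜 U i j) ξ) +
      ((if k = j then iota i ξ else 0) - if k = i then iota j ξ else 0) := by
  simp only [lieDeriv_rotation, map_add, map_sub, iota_smul, iota_coeffDeriv, iota_wedge,
    iota_iota k, map_neg]
  abel

theorem lieDeriv_rotation_wedge (i j k : Fin n) (ξ : Forms 𝕜 U) :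
    lieDeriv (rotation 𝕜 U i j) (wedge k ξ) = wedge k (lieDeriv (rotation 𝕜 U i j) ξ) +
      ((if j = k then wedge i ξ else 0) - if i = k then wedge j ξ else 0) := by
  have h : ∀ a b : Fin n, wedge a (iota b (wedge k ξ)) =
      (if b = k then wedge a ξ else 0) + wedge k (wedge a (iota b ξ)) := fun a b => by
    rw [iota_wedge, map_sub, wedge_wedge a k]
    split_ifs <;> simp
  simp only [lieDeriv_rotation, map_add, map_sub, wedge_smul, wedge_coeffDeriv, h]
  abel

theorem dirDeriv_rotation_coord (i j k : Fin n) :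
    dirDeriv (rotation 𝕜 U i j) (coord 𝕜 U k) =
      (if k = j then coord 𝕜 U i else 0) - if k = i then coord 𝕜 U j else 0 := by
  rw [dirDeriv_rotation, pderiv_coord, pderiv_coord]
  split_ifs <;> simp

theorem lieDeriv_rotation_contract_euler (hmn : m ≤ n) (i j : Fin m) (ξ : Forms 𝕜 U) :
    lieDeriv (rotation 𝕜 U (Fin.castLE hmn i) (Fin.castLE hmn j)) (contract (euler 𝕜 m U) ξ) =
      contract (euler 𝕜 m U)
        (lieDeriv (rotation 𝕜 U (Fin.castLE hmn i) (Fin.castLE hmn j)) ξ) := by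
  simp only [contract_euler hmn, map_sum, lieDeriv_smul, lieDeriv_rotation_iota,
    dirDeriv_rotation_coord, (Fin.castLE_injective hmn).eq_iff, smul_add, smul_sub, sub_smul,
    smul_ite, ite_smul, smul_zero, zero_smul, Finset.sum_add_distrib, Finset.sum_sub_distrib,
    Finset.sum_ite_eq', Finset.mem_univ, if_true]
  abel

theorem lieDeriv_rotation_wedgeHalfMu (hmn : m ≤ n) (i j : Fin m) (ξ : Forms 𝕜 U) :
    lieDeriv (rotation 𝕜 U (Fin.castLE hmn i) (Fin.castLE hmn j)) (wedgeHalfMu hmn ξ) =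
      wedgeHalfMu hmn (lieDeriv (rotation 𝕜 U (Fin.castLE hmn i) (Fin.castLE hmn j)) ξ) := by
  simp only [wedgeHalfMu_apply, map_sum, lieDeriv_smul, lieDeriv_rotation_wedge,
    dirDeriv_rotation_coord, (Fin.castLE_injective hmn).eq_iff, smul_add, smul_sub, sub_smul,
    smul_ite, ite_smul, smul_zero, zero_smul, Finset.sum_add_distrib, Finset.sum_sub_distrib,
    Finset.sum_ite_eq', Finset.sum_ite_eq, Finset.mem_univ, if_true]
  abel

theorem dirDeriv_radial_euler (k : Fin n) :
    dirDeriv (radial 𝕜 U) (euler 𝕜 m U k) = euler 𝕜 m U k := by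
  rw [euler]
  split_ifs
  · exact dirDeriv_radial_coord k
  · exact dirDeriv_zero _

theorem lieDeriv_radial_wedgeHalfMu (hmn : m ≤ n) (ξ : Forms 𝕜 U) :
    lieDeriv (radial 𝕜 U) (wedgeHalfMu hmn ξ) =
      wedgeHalfMu hmn (lieDeriv (radial 𝕜 U) ξ) + (2 : 𝕜) • wedgeHalfMu hmn ξ := by
  simp only [wedgeHalfMu_apply, map_sum, Finset.smul_sum, ← Finset.sum_add_distrib]
  refine Finset.sum_congr rfl fun i _ => ?_
  rw [lieDeriv_radial_smul_coord, lieDeriv_radial_wedge, smul_add, two_smul]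
  abel

theorem coeffDeriv_wedgeHalfMu_of_le (hmn : m ≤ n) {j : Fin n} (hj : m ≤ (j : ℕ))
    (ξ : Forms 𝕜 U) : coeffDeriv j (wedgeHalfMu hmn ξ) = wedgeHalfMu hmn (coeffDeriv j ξ) := by
  simp only [wedgeHalfMu_apply, map_sum]
  refine Finset.sum_congr rfl fun i _ => ?_
  have : Fin.castLE hmn i ≠ j := by
    rintro rfl
    simp only [Fin.val_castLE] at hj
    have := i.2
    omega
  rw [coeffDeriv_smul, pderiv_coord, if_neg this, zero_smul, add_zero, wedge_coeffDeriv]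

theorem coeffDeriv_contract_euler_of_le (hmn : m ≤ n) {j : Fin n} (hj : m ≤ (j : ℕ))
    (ξ : Forms 𝕜 U) :
    coeffDeriv j (contract (euler 𝕜 m U) ξ) = contract (euler 𝕜 m U) (coeffDeriv j ξ) := by
  simp only [contract_euler hmn, map_sum]
  refine Finset.sum_congr rfl fun i _ => ?_
  have : Fin.castLE hmn i ≠ j := by
    rintro rfl
    simp only [Fin.val_castLE] at hj
    have := i.2
    omega
  rw [coeffDeriv_smul, pderiv_coord, if_neg this, zero_smul, add_zero, iota_coeffDeriv]

theorem d_ofFun (f : Smooth 𝕜 U) :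
    d 𝕜 U (Forms.ofFun f) = ∑ i, pderiv 𝕜 U i f • wedge i (1 : Forms 𝕜 U) := by
  rw [Forms.ofFun, d_tmul]
  refine Finset.sum_congr rfl fun i _ => ?_
  have h : (1 : Forms 𝕜 U) = 1 ⊗ₜ[𝕜] 1 := rfl
  rw [h, wedge_tmul, smul_tmul_form, mul_one, mul_one]

theorem wedge_mul (i : Fin n) (ξ η : Forms 𝕜 U) : wedge i ξ * η = wedge i (ξ * η) := by
  rw [wedge_eq_mul, wedge_eq_mul, mul_assoc]

theorem wedgeHalfMu_mul (hmn : m ≤ n) (ξ η : Forms 𝕜 U) :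
    wedgeHalfMu hmn ξ * η = wedgeHalfMu hmn (ξ * η) := by
  simp only [wedgeHalfMu_apply, Finset.sum_mul, smul_mul_form, wedge_mul]

theorem d_muFun (hmn : m ≤ n) :
    d 𝕜 U (Forms.ofFun (muFun 𝕜 hmn U)) = (2 : 𝕜) • wedgeHalfMu hmn (1 : Forms 𝕜 U) := by
  rw [d_ofFun, wedgeHalfMu_apply,
    sum_castLE hmn fun k => coord 𝕜 U k • wedge k (1 : Forms 𝕜 U), Finset.smul_sum]
  refine Finset.sum_congr rfl fun i _ => ?_
  rw [pderiv_muFun]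
  split_ifs
  · rw [mul_smul, two_smul, two_smul]
  · rw [zero_smul, smul_zero]

end NormalEuler

/-! ### The form `α` -/

section Alpha

variable {𝕜 : Type*} [RCLike 𝕜] {n m : ℕ} {hmn : m ≤ n} {R : ℝ}

theorem alpha_mul (ξ : Forms 𝕜 (compl hmn R)) :
    alpha 𝕜 hmn R * ξ = (2 : 𝕜) • muInv 𝕜 hmn R • wedgeHalfMu hmn ξ := by
  rw [alpha, ofFun_mul, d_muFun, smul_mul_form, smul_mul_assoc, wedgeHalfMu_mul, one_mul,
    smul_comm]

theorem alpha_eq : alpha 𝕜 hmn R = (2 : 𝕜) • muInv 𝕜 hmn R • wedgeHalfMu hmn 1 := by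
  rw [← alpha_mul, mul_one]

theorem dirDeriv_muInv {V : Fin n → Smooth 𝕜 (compl hmn R)} {c : 𝕜}
    (h : dirDeriv V (muFun 𝕜 hmn (compl hmn R)) = c • muFun 𝕜 hmn (compl hmn R)) :
    dirDeriv V (muInv 𝕜 hmn R) = -(c • muInv 𝕜 hmn R) := by
  have h1 := dirDeriv_mul V (muFun 𝕜 hmn (compl hmn R)) (muInv 𝕜 hmn R)
  rw [muFun_mul_muInv, dirDeriv_one, h, smul_mul_assoc, muFun_mul_muInv] at h1
  have h2 := congrArg (fun f => muInv 𝕜 hmn R * f) h1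
  simp only [mul_zero, mul_add, mul_smul_comm, mul_one] at h2
  rw [← mul_assoc, mul_comm (muInv 𝕜 hmn R) (muFun 𝕜 hmn (compl hmn R)), muFun_mul_muInv,
    one_mul] at h2
  exact eq_neg_of_add_eq_zero_right h2.symm

theorem contract_alpha_mul (ξ : Forms 𝕜 (compl hmn R)) :
    contract (euler 𝕜 m _) (alpha 𝕜 hmn R * ξ) =
      (2 : 𝕜) • ξ - alpha 𝕜 hmn R * contract (euler 𝕜 m _) ξ := by
  rw [alpha_mul, alpha_mul, map_smul, contract_smul, contract_wedgeHalfMu, smul_sub, smul_sub,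
    smul_smul (muInv 𝕜 hmn R), mul_comm (muInv 𝕜 hmn R), muFun_mul_muInv, one_smul]

theorem alpha_mem_poleForms : alpha 𝕜 hmn R ∈ PoleForms 𝕜 hmn R := by
  refine mem_poleForms.mpr ⟨1, d 𝕜 _ (Forms.ofFun (muFun 𝕜 hmn _)), ?_⟩
  rw [alpha, ofFun_mul, smul_smul, pow_one, muFun_mul_muInv, one_smul, ← d_restrict]
  rfl

theorem d_alpha : d 𝕜 _ (alpha 𝕜 hmn R) = 0 := by
  -- `μ α = dμ` is closed, so that `μ dα = -dμ ∧ α = 0`.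
  have h1 : Forms.ofFun (muFun 𝕜 hmn _) * alpha 𝕜 hmn R =
      d 𝕜 (compl hmn R) (Forms.ofFun (muFun 𝕜 hmn _)) := by
    rw [alpha, ofFun_mul, ofFun_mul, smul_smul, muFun_mul_muInv, one_smul]
  have h2 := congrArg (d 𝕜 (compl hmn R)) h1
  rw [d_d, d_mul, Forms.ofFun, Forms.sign_tmul, map_one] at h2
  have h3 : d 𝕜 (compl hmn R) (Forms.ofFun (muFun 𝕜 hmn _)) * alpha 𝕜 hmn R = 0 := by
    rw [d_muFun, smul_mul_assoc, wedgeHalfMu_mul, one_mul, alpha_eq, map_smul, wedgeHalfMu_smul,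
      wedgeHalfMu_wedgeHalfMu]
    simp
  rw [Forms.ofFun] at h3
  rw [h3, zero_add] at h2
  refine muFun_smul_cancel 1 ?_
  rw [pow_one, ← ofFun_mul]
  exact h2

theorem alpha_mem_closedForms : alpha 𝕜 hmn R ∈ ClosedForms 𝕜 hmn R :=
  ⟨alpha_mem_poleForms, d_alpha⟩

theorem degreeOp_alpha_mul (ξ : Forms 𝕜 (compl hmn R)) :
    degreeOp (alpha 𝕜 hmn R * ξ) = alpha 𝕜 hmn R * degreeOp ξ + alpha 𝕜 hmn R * ξ := by
  simp only [alpha_mul, map_smul, degreeOp_smul, degreeOp_wedgeHalfMu, smul_add]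

end Alpha

/-! ### Derivatives and contractions of invariant forms -/

section Invariant

variable {𝕜 : Type*} [RCLike 𝕜] {n m : ℕ} {hmn : m ≤ n} {R : ℝ} {ξ η : Forms 𝕜 (compl hmn R)}

theorem IsInvariant.add (hξ : IsInvariant ξ) (hη : IsInvariant η) : IsInvariant (ξ + η) where
  mem := add_mem hξ.mem hη.mem
  radial := by rw [map_add, hξ.radial, hη.radial, add_zero]
  coeffDeriv j hj := by rw [map_add, hξ.coeffDeriv j hj, hη.coeffDeriv j hj, add_zero]
  iota j hj := by rw [map_add, hξ.iota j hj, hη.iota j hj, add_zero]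
  rotation i j := by rw [map_add, hξ.rotation, hη.rotation, add_zero]

theorem IsInvariant.smul (c : 𝕜) (hξ : IsInvariant ξ) : IsInvariant (c • ξ) where
  mem := Subalgebra.smul_mem _ hξ.mem c
  radial := by rw [map_smul, hξ.radial, smul_zero]
  coeffDeriv j hj := by rw [map_smul, hξ.coeffDeriv j hj, smul_zero]
  iota j hj := by rw [map_smul, hξ.iota j hj, smul_zero]
  rotation i j := by rw [map_smul, hξ.rotation, smul_zero]

theorem IsInvariant.sub (hξ : IsInvariant ξ) (hη : IsInvariant η) : IsInvariant (ξ - η) := by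
  have h := hξ.add (hη.smul (-1))
  rwa [neg_one_smul, ← sub_eq_add_neg] at h

theorem IsInvariant.degreeOp (hξ : IsInvariant ξ) : IsInvariant (degreeOp ξ) where
  mem := degreeOp_mem_poleForms hξ.mem
  radial := by rw [← degreeOp_lieDeriv, hξ.radial, map_zero]
  coeffDeriv j hj := by rw [← degreeOp_coeffDeriv, hξ.coeffDeriv j hj, map_zero]
  iota j hj := by
    have h := degreeOp_iota j ξ
    rw [hξ.iota j hj, map_zero, sub_zero] at h
    exact h.symm
  rotation i j := by rw [← degreeOp_lieDeriv, hξ.rotation, map_zero]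

theorem restrictFun_euler {U V : TopologicalSpace.Opens (EuclideanSpace ℝ (Fin n))} (h : U ≤ V)
    (k : Fin n) : restrictFun 𝕜 h (euler 𝕜 m V k) = euler 𝕜 m U k := by
  rw [euler, euler]
  split_ifs
  · rfl
  · exact map_zero _

theorem IsInvariant.contract_euler (hξ : IsInvariant ξ) :
    IsInvariant (contract (euler 𝕜 m _) ξ) where
  mem := contract_mem_poleForms (restrictFun_euler _) hξ.mem
  radial := by rw [lieDeriv_radial_contract dirDeriv_radial_euler, hξ.radial, map_zero]
  coeffDeriv j hj := by
    rw [coeffDeriv_contract_euler_of_le hmn hj, hξ.coeffDeriv j hj, map_zero]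
  iota j hj := by rw [iota_contract, hξ.iota j hj, map_zero, neg_zero]
  rotation i j := by rw [lieDeriv_rotation_contract_euler, hξ.rotation, map_zero]

theorem IsInvariant.alpha_mul (hξ : IsInvariant ξ) : IsInvariant (alpha 𝕜 hmn R * ξ) where
  mem := mul_mem alpha_mem_poleForms hξ.mem
  radial := by
    rw [LocalDeRham.alpha_mul, map_smul, lieDeriv_smul, lieDeriv_radial_wedgeHalfMu, hξ.radial,
      map_zero, zero_add, dirDeriv_muInv (dirDeriv_radial_muFun hmn), neg_smul, smul_assoc,
      smul_comm (muInv 𝕜 hmn R) (2 : 𝕜), add_neg_cancel, smul_zero]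
  coeffDeriv j hj := by
    have h : dirDeriv (Pi.single j 1) (muFun 𝕜 hmn (compl hmn R)) = (0 : 𝕜) • muFun 𝕜 hmn _ := by
      rw [← pderiv_eq_dirDeriv, pderiv_muFun, if_neg (not_lt.mpr hj), zero_smul]
    rw [LocalDeRham.alpha_mul, map_smul, coeffDeriv_smul, coeffDeriv_wedgeHalfMu_of_le hmn hj,
      hξ.coeffDeriv j hj, pderiv_eq_dirDeriv, dirDeriv_muInv h]
    simp
  iota j hj := by
    rw [LocalDeRham.alpha_mul, map_smul, iota_smul, iota_wedgeHalfMu_of_le hmn hj, hξ.iota j hj]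
    simp
  rotation i j := by
    have h : dirDeriv (LocalDeRham.rotation 𝕜 _ (Fin.castLE hmn i) (Fin.castLE hmn j))
        (muFun 𝕜 hmn (compl hmn R)) = (0 : 𝕜) • muFun 𝕜 hmn _ := by
      rw [dirDeriv_rotation_muFun hmn i.2 j.2, zero_smul]
    rw [LocalDeRham.alpha_mul, map_smul, lieDeriv_smul, lieDeriv_rotation_wedgeHalfMu,
      hξ.rotation, dirDeriv_muInv h]
    simp

/-- The derivatives of the coefficients of an invariant form: `μ ∂_j ξ` is an algebraic expression in
`ξ`. -/
theorem IsInvariant.muFun_smul_coeffDeriv (hξ : IsInvariant ξ) (j : Fin m) :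
    muFun 𝕜 hmn (compl hmn R) • LocalDeRham.coeffDeriv (Fin.castLE hmn j) ξ =
      -(coord 𝕜 (compl hmn R) (Fin.castLE hmn j) • LocalDeRham.degreeOp ξ) -
        wedgeHalfMu hmn (LocalDeRham.iota (Fin.castLE hmn j) ξ) +
        wedge (Fin.castLE hmn j) (contract (euler 𝕜 m _) ξ) := by
  have h1 : ∑ i : Fin m, coord 𝕜 (compl hmn R) (Fin.castLE hmn i) •
      LocalDeRham.coeffDeriv (Fin.castLE hmn i) ξ = -LocalDeRham.degreeOp ξ := by
    have h := hξ.radial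
    rw [lieDeriv_radial] at h
    rw [← eq_neg_of_add_eq_zero_left h,
      sum_castLE hmn fun k => coord 𝕜 _ k • LocalDeRham.coeffDeriv k ξ]
    refine Finset.sum_congr rfl fun k _ => ?_
    split_ifs with hk
    · rfl
    · rw [hξ.coeffDeriv k (not_lt.mp hk), smul_zero]
  -- The sum over `i` of the equations `x_i L_{ij} ξ = 0`, `L_{ij}` the Lie derivative along the
  -- rotation of `x_i` and `x_j`.
  have h2 : ∑ i : Fin m, coord 𝕜 (compl hmn R) (Fin.castLE hmn i) • lieDeriv
      (LocalDeRham.rotation 𝕜 (compl hmn R) (Fin.castLE hmn i) (Fin.castLE hmn j)) ξ = 0 :=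
    Finset.sum_eq_zero fun i _ => by rw [hξ.rotation, smul_zero]
  simp only [lieDeriv_rotation, smul_add, smul_sub, Finset.sum_add_distrib,
    Finset.sum_sub_distrib] at h2
  rw [← muFun_smul, ← wedgeHalfMu_apply] at h2
  have h3 : ∑ i : Fin m, coord 𝕜 (compl hmn R) (Fin.castLE hmn i) • coord 𝕜 (compl hmn R) (Fin.castLE hmn j) •
      LocalDeRham.coeffDeriv (Fin.castLE hmn i) ξ =
      -(coord 𝕜 (compl hmn R) (Fin.castLE hmn j) • LocalDeRham.degreeOp ξ) := by
    rw [← smul_neg, ← h1, Finset.smul_sum]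
    exact Finset.sum_congr rfl fun i _ => smul_comm _ _ _
  have h4 : ∑ i : Fin m, coord 𝕜 (compl hmn R) (Fin.castLE hmn i) • wedge (Fin.castLE hmn j)
      (LocalDeRham.iota (Fin.castLE hmn i) ξ) =
      wedge (Fin.castLE hmn j) (contract (euler 𝕜 m (compl hmn R)) ξ) := by
    simp only [LocalDeRham.contract_euler hmn, map_sum, wedge_smul]
  rw [h3, h4] at h2
  rw [← sub_eq_zero, ← h2]
  abel

/-- The contractions `ι_i ξ` of an invariant form `ξ` with `ι_e ξ = 0`, `e` the normal Euler field,
have degree `m - 2`. Hence such a form is a sum of forms of degrees `0` and `m - 1`. -/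
theorem IsInvariant.iota_degreeOp (hξ : IsInvariant ξ)
    (hE : contract (euler 𝕜 m _) ξ = 0) (i : Fin n) :
    LocalDeRham.iota i (LocalDeRham.degreeOp ξ) = ((m : 𝕜) - 1) • LocalDeRham.iota i ξ := by
  by_cases hi : m ≤ (i : ℕ)
  · rw [hξ.degreeOp.iota i hi, hξ.iota i hi, smul_zero]
  obtain ⟨i, rfl⟩ : ∃ i' : Fin m, i = Fin.castLE hmn i' := ⟨⟨i, not_le.mp hi⟩, rfl⟩
  -- Combine `L_{ij} ξ = 0` with the formula for the derivatives of the coefficients; then contract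
  -- the equation with `∂/∂x_j` and sum over `j`.
  have h1 : ∀ j : Fin m, muFun 𝕜 hmn (compl hmn R) •
      (wedge (Fin.castLE hmn i) (LocalDeRham.iota (Fin.castLE hmn j) ξ) -
        wedge (Fin.castLE hmn j) (LocalDeRham.iota (Fin.castLE hmn i) ξ)) =
      coord 𝕜 (compl hmn R) (Fin.castLE hmn i) •
        wedgeHalfMu hmn (LocalDeRham.iota (Fin.castLE hmn j) ξ) -
      coord 𝕜 (compl hmn R) (Fin.castLE hmn j) •
        wedgeHalfMu hmn (LocalDeRham.iota (Fin.castLE hmn i) ξ) := fun j => by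
    have h := congrArg (fun ζ => muFun 𝕜 hmn (compl hmn R) • ζ) (hξ.rotation i j)
    simp only [lieDeriv_rotation, smul_add, smul_zero] at h
    rw [smul_sub, smul_comm _ (coord 𝕜 (compl hmn R) (Fin.castLE hmn i)),
      smul_comm _ (coord 𝕜 (compl hmn R) (Fin.castLE hmn j)), hξ.muFun_smul_coeffDeriv,
      hξ.muFun_smul_coeffDeriv, hE, map_zero, map_zero, add_zero, add_zero, smul_sub, smul_sub,
      smul_neg, smul_neg, smul_comm (coord 𝕜 (compl hmn R) (Fin.castLE hmn j))] at h
    rw [← sub_eq_zero, ← h]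
    abel
  have h2 := Finset.sum_congr (rfl : (Finset.univ : Finset (Fin m)) = _) fun j _ =>
    congrArg (LocalDeRham.iota (Fin.castLE hmn j)) (h1 j)
  have hN : ∑ j : Fin m, wedge (Fin.castLE hmn j) (LocalDeRham.iota (Fin.castLE hmn j)
      (LocalDeRham.iota (Fin.castLE hmn i) ξ)) =
      LocalDeRham.iota (Fin.castLE hmn i) (LocalDeRham.degreeOp ξ) -
        LocalDeRham.iota (Fin.castLE hmn i) ξ := by
    rw [← degreeOp_iota, degreeOp_apply, sum_castLE hmn fun k =>
      wedge k (LocalDeRham.iota k (LocalDeRham.iota (Fin.castLE hmn i) ξ))]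
    refine Finset.sum_congr rfl fun k _ => ?_
    split_ifs with hk
    · rfl
    · rw [iota_iota, hξ.iota k (not_lt.mp hk), map_zero, neg_zero, map_zero]
  have hA : ∑ j : Fin m, LocalDeRham.iota (Fin.castLE hmn j)
      (wedge (Fin.castLE hmn i) (LocalDeRham.iota (Fin.castLE hmn j) ξ)) =
      LocalDeRham.iota (Fin.castLE hmn i) ξ := by
    rw [Finset.sum_eq_single i]
    · rw [iota_wedge_self, iota_self, map_zero, sub_zero]
    · intro j _ hj
      rw [iota_wedge_of_ne fun e => hj (Fin.castLE_injective hmn e), iota_self, map_zero,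
        neg_zero]
    · exact fun h => absurd (Finset.mem_univ i) h
  have hB : ∑ j : Fin m, LocalDeRham.iota (Fin.castLE hmn j)
      (wedge (Fin.castLE hmn j) (LocalDeRham.iota (Fin.castLE hmn i) ξ)) =
      (m : 𝕜) • LocalDeRham.iota (Fin.castLE hmn i) ξ -
        (LocalDeRham.iota (Fin.castLE hmn i) (LocalDeRham.degreeOp ξ) -
        LocalDeRham.iota (Fin.castLE hmn i) ξ) := by
    simp only [iota_wedge_self, Finset.sum_sub_distrib, hN]
    rw [Finset.sum_const, Finset.card_univ, Fintype.card_fin, Nat.cast_smul_eq_nsmul]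
  have hC : ∑ j : Fin m, LocalDeRham.iota (Fin.castLE hmn j)
      (wedgeHalfMu hmn (LocalDeRham.iota (Fin.castLE hmn j) ξ)) = 0 := by
    simp only [iota_wedgeHalfMu, iota_self, map_zero, sub_zero]
    rw [← LocalDeRham.contract_euler hmn, hE]
  have hD : ∑ j : Fin m, coord 𝕜 (compl hmn R) (Fin.castLE hmn j) • LocalDeRham.iota (Fin.castLE hmn j)
      (wedgeHalfMu hmn (LocalDeRham.iota (Fin.castLE hmn i) ξ)) =
      muFun 𝕜 hmn (compl hmn R) • LocalDeRham.iota (Fin.castLE hmn i) ξ := by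
    rw [← LocalDeRham.contract_euler hmn, contract_wedgeHalfMu]
    have h := iota_contract (euler 𝕜 m _) (Fin.castLE hmn i) ξ
    rw [hE, map_zero] at h
    rw [neg_eq_zero.mp h.symm, map_zero, sub_zero]
  simp only [iota_smul, map_sub, ← Finset.smul_sum, Finset.sum_sub_distrib] at h2
  rw [hA, hB, hC, hD, smul_zero, zero_sub, ← smul_neg] at h2
  have h3 := muFun_smul_cancel 1 (ξ := LocalDeRham.iota (Fin.castLE hmn i) (LocalDeRham.degreeOp ξ)
    - ((m : 𝕜) - 1) • LocalDeRham.iota (Fin.castLE hmn i) ξ) (by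
      rw [pow_one]
      rw [← sub_eq_zero, ← smul_sub] at h2
      rw [← h2]
      congr 1
      rw [sub_smul, one_smul]
      abel)
  exact sub_eq_zero.mp h3

end Invariant

/-! ### Homogeneous functions with poles -/

section Functions

variable {𝕜 : Type*} [RCLike 𝕜] {n m : ℕ} {U : TopologicalSpace.Opens (EuclideanSpace ℝ (Fin n))}
  {hmn : m ≤ n} {R : ℝ}

theorem ofFun_injective : Function.Injective (Forms.ofFun : Smooth 𝕜 U → Forms 𝕜 U) :=
  Function.LeftInverse.injective scalarPart_ofFun

theorem iota_ofFun (i : Fin n) (f : Smooth 𝕜 U) : iota i (Forms.ofFun f) = 0 := by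
  rw [Forms.ofFun, iota_tmul, CliffordAlgebra.contractLeft_one, TensorProduct.tmul_zero]

theorem coeffDeriv_ofFun (i : Fin n) (f : Smooth 𝕜 U) :
    coeffDeriv i (Forms.ofFun f) = Forms.ofFun (pderiv 𝕜 U i f) := rfl

theorem smul_ofFun (c : 𝕜) (f : Smooth 𝕜 U) : c • Forms.ofFun f = Forms.ofFun (c • f) :=
  TensorProduct.smul_tmul' c f 1

theorem smul_ofFun' (g f : Smooth 𝕜 U) : g • Forms.ofFun f = Forms.ofFun (g * f) :=
  smul_tmul_form g f 1

theorem lieDeriv_radial_ofFun (f : Smooth 𝕜 U) :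
    lieDeriv (radial 𝕜 U) (Forms.ofFun f) = Forms.ofFun (dirDeriv (radial 𝕜 U) f) := by
  have h : (1 : ConstForms 𝕜 n) ∈ ⋀[𝕜]^0 (Fin n → 𝕜) := SetLike.GradedOne.one_mem
  rw [Forms.ofFun, lieDeriv_radial_tmul h, Nat.cast_zero, zero_smul, add_zero]
  rfl

theorem ofFun_mem_weightSpace {k : ℕ} {f : Smooth 𝕜 U} : Forms.ofFun f ∈ weightSpace 𝕜 U k ↔
    dirDeriv (radial 𝕜 U) f = (k : 𝕜) • f := by
  rw [mem_weightSpace, lieDeriv_radial_ofFun, smul_ofFun, ofFun_injective.eq_iff]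

/-- A homogeneous function that vanishes on an open set is zero. -/
theorem eq_zero_of_eqOn_zero {S : Set (EuclideanSpace ℝ (Fin n))} (hS : IsOpen S)
    (hne : S.Nonempty) (hSR : S ⊆ ball n R) (k : ℕ) : ∀ f : Smooth 𝕜 (ball n R),
      Forms.ofFun f ∈ weightSpace 𝕜 (ball n R) k → (∀ x ∈ S, extend f.1 x = 0) → f = 0 := by
  induction k with
  | zero =>
    intro f hf h0
    rw [mem_weightSpace, Nat.cast_zero, zero_smul] at hf
    obtain ⟨c, hc⟩ := exists_eq_smul_one_of_lieDeriv_radial hf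
    have hc' : f = c • (1 : Smooth 𝕜 (ball n R)) := ofFun_injective (hc.trans (smul_ofFun c 1))
    obtain ⟨x, hx⟩ := hne
    have h1 := h0 x hx
    rw [extend_coe f.1 ⟨x, hSR hx⟩, hc'] at h1
    have h2 : c * 1 = 0 := h1
    rw [hc', (mul_one c).symm.trans h2, zero_smul]
  | succ k ih =>
    intro f hf h0
    refine ofFun_injective ((eq_zero_of_mem_weightSpace hf (fun i => ?_)
      fun i => iota_ofFun i f).trans (TensorProduct.zero_tmul _ _).symm)
    have h1 := coeffDeriv_mem_weightSpace hf i
    rw [coeffDeriv_ofFun] at h1 ⊢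
    rw [ih _ h1]
    · exact TensorProduct.zero_tmul _ _
    · intro x hx
      rw [extend_coe (pderiv 𝕜 _ i f).1 ⟨x, hSR hx⟩]
      change fderiv ℝ (extend f.1) x _ = 0
      have h2 : extend f.1 =ᶠ[nhds x] fun _ => (0 : 𝕜) :=
        Filter.eventually_of_mem (hS.mem_nhds hx) h0
      rw [h2.fderiv_eq]
      simp

/-- The parity of homogeneous functions, by Euler's formula and induction. -/
theorem apply_neg_of_mem_weightSpace (k : ℕ) : ∀ f : Smooth 𝕜 (ball n R),
    Forms.ofFun f ∈ weightSpace 𝕜 (ball n R) k → ∀ x y : ball n R, y.1 = -x.1 →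
      f.1 y = (-1) ^ k * f.1 x := by
  induction k with
  | zero =>
    intro f hf x y _
    rw [mem_weightSpace, Nat.cast_zero, zero_smul] at hf
    obtain ⟨c, hc⟩ := exists_eq_smul_one_of_lieDeriv_radial hf
    have hc' : f = c • (1 : Smooth 𝕜 (ball n R)) := ofFun_injective (hc.trans (smul_ofFun c 1))
    rw [hc', pow_zero, one_mul]
    rfl
  | succ k ih =>
    intro f hf x y hxy
    have h1 : ∀ z : ball n R, ((k + 1 : ℕ) : 𝕜) * f.1 z =
        ∑ i, ((z.1 i : ℝ) : 𝕜) * (pderiv 𝕜 _ i f).1 z := fun z => by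
      have h := congrArg (fun g : Smooth 𝕜 (ball n R) => g.1 z) (ofFun_mem_weightSpace.mp hf)
      have h' : (dirDeriv (radial 𝕜 _) f).1 z = ((k + 1 : ℕ) : 𝕜) * f.1 z := h
      rw [← h', dirDeriv, AddSubmonoidClass.coe_finsetSum, Finset.sum_apply]
      rfl
    have h2 : ((k + 1 : ℕ) : 𝕜) ≠ 0 := by exact_mod_cast k.succ_ne_zero
    refine mul_left_cancel₀ h2 ?_
    rw [mul_left_comm, h1, h1, Finset.mul_sum]
    refine Finset.sum_congr rfl fun i _ => ?_
    rw [ih _ (coeffDeriv_ofFun i f ▸ coeffDeriv_mem_weightSpace hf i) x y hxy, hxy,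
      PiLp.neg_apply, RCLike.ofReal_neg]
    ring

/-- The point `(R/2, 0, …, 0)`. -/
def basePoint (R : ℝ) (hn : 0 < n) : EuclideanSpace ℝ (Fin n) :=
  EuclideanSpace.single ⟨0, hn⟩ (R / 2)

theorem basePoint_mem (hm : 1 ≤ m) (hR : 0 < R) :
    basePoint R (hm.trans hmn) ∈ compl hmn R := by
  refine ⟨?_, fun h => ?_⟩
  · rw [mem_ball_zero_iff, basePoint, PiLp.norm_single, Real.norm_eq_abs, abs_of_pos (by positivity)]
    linarith
  · have h' : mu hmn (basePoint R (hm.trans hmn)) = 0 := h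
    rw [mu, Finset.sum_eq_zero_iff_of_nonneg (fun i _ => sq_nonneg _)] at h'
    have h1 := pow_eq_zero_iff two_ne_zero |>.mp (h' ⟨0, hm⟩ (Finset.mem_univ _))
    simp [basePoint] at h1
    linarith

theorem exists_extension_of_ofFun_mem {f : Smooth 𝕜 (compl hmn R)}
    (hf : Forms.ofFun f ∈ PoleForms 𝕜 hmn R) : ∃ (N : ℕ) (P : Smooth 𝕜 (ball n R)),
      muFun 𝕜 hmn (compl hmn R) ^ N * f = restrictFun 𝕜 (compl_le hmn R) P := by
  obtain ⟨N, η, h⟩ := mem_poleForms.mp hf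
  refine ⟨N, scalarPart η, ?_⟩
  rw [← scalarPart_restrict, ← h, scalarPart_smul, scalarPart_ofFun]

theorem dirDeriv_restrictFun {U V : TopologicalSpace.Opens (EuclideanSpace ℝ (Fin n))} (h : U ≤ V)
    {X : Fin n → Smooth 𝕜 V} {X' : Fin n → Smooth 𝕜 U} (hX : ∀ k, restrictFun 𝕜 h (X k) = X' k)
    (f : Smooth 𝕜 V) : dirDeriv X' (restrictFun 𝕜 h f) = restrictFun 𝕜 h (dirDeriv X f) := by
  simp only [dirDeriv, map_sum, map_mul, ← hX, pderiv_restrictFun]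

/-- A function in `𝒜_μ(X)` with vanishing derivative is constant, although `X ∖ Y` is not connected
for `m = 1`: its numerator is homogeneous, hence determined by its restriction to an open set. -/
theorem exists_eq_smul_one_of_pderiv_eq_zero (hm : 1 ≤ m) (hR : 0 < R)
    {f : Smooth 𝕜 (compl hmn R)} (hf : Forms.ofFun f ∈ PoleForms 𝕜 hmn R)
    (h : ∀ i, pderiv 𝕜 _ i f = 0) : ∃ c : 𝕜, f = c • 1 := by
  obtain ⟨N, P, hP⟩ := exists_extension_of_ofFun_mem hf
  have hE : dirDeriv (radial 𝕜 (compl hmn R)) f = 0 := by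
    simp only [dirDeriv, h, mul_zero, Finset.sum_const_zero]
  have hinj := restrictFun_compl_injective (𝕜 := 𝕜) (R := R) hm hmn
  have hw : dirDeriv (radial 𝕜 _) P = ((2 * N : ℕ) : 𝕜) • P := by
    apply hinj
    rw [← dirDeriv_restrictFun _ (restrictFun_radial _), map_smul, ← hP, dirDeriv_mul,
      dirDeriv_radial_muFun_pow, hE, mul_zero, add_zero, smul_mul_assoc]
  obtain ⟨ε, hε, hball⟩ := Metric.isOpen_iff.mp (compl hmn R).isOpen _ (basePoint_mem hm hR)
  set p := basePoint R (hm.trans hmn)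
  set c := extend f.1 p
  have hconst : ∀ x ∈ Metric.ball p ε, extend f.1 x = c := fun x hx =>
    Metric.isOpen_ball.is_const_of_fderiv_eq_zero (𝕜 := ℝ) (convex_ball p ε).isPreconnected
      (fun y hy => (differentiableAt_extend f ⟨y, hball hy⟩).differentiableWithinAt)
      (fun y hy => by
        ext v
        rw [fderiv_extend_apply f ⟨y, hball hy⟩]
        simp [h])
      hx (Metric.mem_ball_self hε)
  -- Near the base point `P = c μ^N`.
  have hQ : P - c • muFun 𝕜 hmn (ball n R) ^ N = 0 := by
    refine eq_zero_of_eqOn_zero Metric.isOpen_ball ⟨p, Metric.mem_ball_self hε⟩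
      (hball.trans (compl_le hmn R)) (2 * N) _ ?_ ?_
    · have h1 : Forms.ofFun (P - c • muFun 𝕜 hmn (ball n R) ^ N) =
          Forms.ofFun P - c • Forms.ofFun (muFun 𝕜 hmn (ball n R) ^ N) := by
        rw [smul_ofFun]; exact TensorProduct.sub_tmul _ _ _
      rw [h1]
      exact sub_mem (ofFun_mem_weightSpace.mpr hw) (Submodule.smul_mem _ _
        (ofFun_mem_weightSpace.mpr (dirDeriv_radial_muFun_pow hmn N)))
    · intro x hx
      have h2 := congrArg (fun g : Smooth 𝕜 (compl hmn R) => g.1 ⟨x, hball hx⟩) hP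
      have h3 : (muFun 𝕜 hmn (compl hmn R) ^ N).1 ⟨x, hball hx⟩ * f.1 ⟨x, hball hx⟩ =
        P.1 ⟨x, compl_le hmn R (hball hx)⟩ := h2
      rw [← extend_coe f.1 ⟨x, hball hx⟩, hconst x hx] at h3
      rw [extend_coe (P - c • muFun 𝕜 hmn (ball n R) ^ N).1 ⟨x, compl_le hmn R (hball hx)⟩]
      change P.1 _ - c * (muFun 𝕜 hmn (ball n R) ^ N).1 _ = 0
      rw [← h3, mul_comm, sub_eq_zero]
      rfl
  refine ⟨c, ?_⟩
  rw [sub_eq_zero.mp hQ, map_smul, map_pow, restrictFun_muFun] at hP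
  have h4 := congrArg (fun g => muInv 𝕜 hmn R ^ N * g) hP
  simp only [← mul_assoc, mul_smul_comm] at h4
  rwa [mul_comm (muInv 𝕜 hmn R ^ N), muFun_pow_mul_muInv_pow, one_mul] at h4

end Functions

/-! ### Forms of top degree in the normal variables -/

section TopForms

variable {𝕜 : Type*} [RCLike 𝕜] {n m : ℕ} {U : TopologicalSpace.Opens (EuclideanSpace ℝ (Fin n))}
  {hmn : m ≤ n} {R : ℝ}

/-- A form of degree larger than the number of the `dx_i` that occur in it is zero. -/
theorem eq_zero_of_card_lt_degree (S : Finset (Fin n)) : ∀ (p : ℕ) (ξ : Forms 𝕜 U),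
    (∀ k, k ∉ S → iota k ξ = 0) → degreeOp ξ = (p : 𝕜) • ξ → S.card < p → ξ = 0 := by
  induction S using Finset.induction_on with
  | empty =>
    intro p ξ h hξ hp
    rw [degreeOp_apply, Finset.sum_eq_zero fun k _ => by
      rw [h k (Finset.notMem_empty k), map_zero]] at hξ
    exact (smul_eq_zero.mp hξ.symm).resolve_left (Nat.cast_ne_zero.mpr hp.ne')
  | insert j S hj ih =>
    intro p ξ h hξ hp
    rw [Finset.card_insert_of_notMem hj] at hp
    obtain ⟨p, rfl⟩ : ∃ q, p = q + 1 := ⟨p - 1, by omega⟩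
    have h1 : iota j ξ = 0 := by
      refine ih p _ (fun k hk => ?_) ?_ (by omega)
      · by_cases e : k = j
        · rw [e, iota_self]
        · rw [iota_iota, h k (by simp [e, hk]), map_zero, neg_zero]
      · rw [degreeOp_iota, hξ, map_smul, Nat.cast_succ, add_smul, one_smul, add_sub_cancel_right]
    refine ih (p + 1) ξ (fun k hk => ?_) hξ (by omega)
    by_cases e : k = j
    · rw [e, h1]
    · exact h k (by simp [e, hk])

/-- A form of degree `r` in which only `r` different `dx_i` occur is a multiple of their product. -/
theorem exists_eq_tmul_prod (l : List (Fin n)) (hl : l.Nodup) :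
    ∀ ξ : Forms 𝕜 (compl hmn R), ξ ∈ PoleForms 𝕜 hmn R → (∀ k, k ∉ l → iota k ξ = 0) →
      degreeOp ξ = (l.length : 𝕜) • ξ → ∃ h : Smooth 𝕜 (compl hmn R),
        Forms.ofFun h ∈ PoleForms 𝕜 hmn R ∧ ξ = h ⊗ₜ[𝕜] (l.map (dx 𝕜)).prod := by
  induction l with
  | nil =>
    intro ξ hξ _ hd
    rw [List.length_nil, Nat.cast_zero, zero_smul] at hd
    have h := eq_ofFun_of_degreeOp_eq_zero hd
    exact ⟨scalarPart ξ, h ▸ hξ, h⟩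
  | cons j l ih =>
    intro ξ hξ hI hd
    rw [List.nodup_cons] at hl
    have hw : wedge j ξ = 0 := by
      refine eq_zero_of_card_lt_degree (j :: l).toFinset ((j :: l).length + 1) _ (fun k hk => ?_) ?_
        (Nat.lt_succ_of_le (List.toFinset_card_le _))
      · rw [List.mem_toFinset] at hk
        rw [iota_wedge_of_ne (fun e : k = j => hk (e ▸ List.mem_cons_self)), hI k hk, map_zero, neg_zero]
      · rw [degreeOp_wedge, hd, map_smul, Nat.cast_succ, add_smul, one_smul]
    have h1 : ξ = wedge j (iota j ξ) := by
      have h := iota_wedge_self j ξ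
      rw [hw, map_zero] at h
      exact (sub_eq_zero.mp h.symm)
    obtain ⟨h, hh, e⟩ := ih hl.2 (iota j ξ) (iota_mem_poleForms j hξ) (fun k hk => by
        by_cases e : k = j
        · rw [e, iota_self]
        · rw [iota_iota, hI k (by simp [e, hk]), map_zero, neg_zero]) (by
        rw [degreeOp_iota, hd, map_smul, List.length_cons, Nat.cast_succ, add_smul, one_smul,
          add_sub_cancel_right])
    exact ⟨h, hh, by rw [h1, e, wedge_tmul, List.map_cons, List.prod_cons]⟩

theorem iota_tmul_prod_of_notMem (l : List (Fin n)) (f : Smooth 𝕜 U) {k : Fin n} (hk : k ∉ l) :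
    iota k (f ⊗ₜ[𝕜] (l.map (dx 𝕜)).prod : Forms 𝕜 U) = 0 := by
  induction l with
  | nil => exact iota_ofFun k f
  | cons j l ih =>
    rw [List.mem_cons, not_or] at hk
    rw [List.map_cons, List.prod_cons, ← wedge_tmul, iota_wedge_of_ne hk.1, ih hk.2, map_zero,
      neg_zero]

theorem tmul_prod_eq_zero (l : List (Fin n)) (hl : l.Nodup) {f : Smooth 𝕜 U}
    (h : (f ⊗ₜ[𝕜] (l.map (dx 𝕜)).prod : Forms 𝕜 U) = 0) : f = 0 := by
  induction l with
  | nil => exact ofFun_injective (h.trans (TensorProduct.zero_tmul _ _).symm)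
  | cons j l ih =>
    rw [List.nodup_cons] at hl
    refine ih hl.2 ?_
    rw [List.map_cons, List.prod_cons, ← wedge_tmul] at h
    have h1 := iota_wedge_self j (f ⊗ₜ[𝕜] (l.map (dx 𝕜)).prod : Forms 𝕜 U)
    rw [h, map_zero, iota_tmul_prod_of_notMem l f hl.1, map_zero, sub_zero] at h1
    exact h1.symm

/-- The indices `1, …, m`, as a list in `Fin n`. -/
def normalIndices (hmn : m ≤ n) : List (Fin n) := (List.finRange m).map (Fin.castLE hmn)

theorem nodup_normalIndices (hmn : m ≤ n) : (normalIndices hmn).Nodup :=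
  (List.nodup_finRange m).map (Fin.castLE_injective hmn)

theorem mem_normalIndices (hmn : m ≤ n) {k : Fin n} : k ∈ normalIndices hmn ↔ (k : ℕ) < m := by
  simp only [normalIndices, List.mem_map, List.mem_finRange, true_and]
  exact ⟨fun ⟨a, ha⟩ => ha ▸ a.2, fun h => ⟨⟨k, h⟩, rfl⟩⟩

theorem length_normalIndices (hmn : m ≤ n) : (normalIndices hmn).length = m := by
  rw [normalIndices, List.length_map, List.length_finRange]

theorem normalVolume_eq (hmn : m ≤ n) :
    normalVolume 𝕜 hmn = ((normalIndices hmn).map (dx 𝕜)).prod := by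
  rw [normalVolume, normalIndices, List.map_map]
  rfl

theorem tmul_normalVolume_eq_zero (hmn : m ≤ n) {f : Smooth 𝕜 U}
    (h : (f ⊗ₜ[𝕜] normalVolume 𝕜 hmn : Forms 𝕜 U) = 0) : f = 0 :=
  tmul_prod_eq_zero (normalIndices hmn) (nodup_normalIndices hmn) (normalVolume_eq (𝕜 := 𝕜) hmn ▸ h)

theorem tmul_normalVolume_injective (hmn : m ≤ n) {f g : Smooth 𝕜 U}
    (h : (f ⊗ₜ[𝕜] normalVolume 𝕜 hmn : Forms 𝕜 U) = g ⊗ₜ[𝕜] normalVolume 𝕜 hmn) : f = g :=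
  sub_eq_zero.mp (tmul_normalVolume_eq_zero hmn (by rw [TensorProduct.sub_tmul, h, sub_self]))

end TopForms

/-! ### Classification of the invariant forms -/

section Classification

variable {𝕜 : Type*} [RCLike 𝕜] {n m : ℕ} {hmn : m ≤ n} {R : ℝ} {ξ : Forms 𝕜 (compl hmn R)}

/-- The invariant forms of degree zero are the constants. -/
theorem IsInvariant.exists_eq_smul_one (hm : 1 ≤ m) (hR : 0 < R) (hξ : IsInvariant ξ)
    (h : LocalDeRham.degreeOp ξ = 0) : ∃ c : 𝕜, ξ = c • 1 := by
  have h0 := eq_ofFun_of_degreeOp_eq_zero h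
  set f := scalarPart ξ
  have hI : ∀ i, LocalDeRham.iota i ξ = 0 := fun i => by rw [h0, iota_ofFun]
  have hD : ∀ i, LocalDeRham.coeffDeriv i ξ = 0 := fun i => by
    by_cases hi : m ≤ (i : ℕ)
    · exact hξ.coeffDeriv i hi
    · obtain ⟨i, rfl⟩ : ∃ i' : Fin m, i = Fin.castLE hmn i' := ⟨⟨i, not_le.mp hi⟩, rfl⟩
      refine muFun_smul_cancel 1 ?_
      have hE : contract (euler 𝕜 m (compl hmn R)) ξ = 0 := by
        rw [contract_eq_sum]
        exact Finset.sum_eq_zero fun i _ => by rw [hI, smul_zero]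
      rw [pow_one, hξ.muFun_smul_coeffDeriv, h, hI, hE, map_zero, map_zero, smul_zero, neg_zero,
        sub_zero, add_zero]
  obtain ⟨c, hc⟩ := exists_eq_smul_one_of_pderiv_eq_zero hm hR (h0 ▸ hξ.mem) (fun i =>
    ofFun_injective ((coeffDeriv_ofFun i f).symm.trans
      ((h0 ▸ hD i).trans (TensorProduct.zero_tmul _ _).symm)))
  exact ⟨c, by rw [h0, hc, ← smul_ofFun]; rfl⟩

/-- An invariant form that `ι_e` annihilates has components of degrees `0` and `m - 1` only. -/
theorem IsInvariant.degreeOp_degreeOp (hξ : IsInvariant ξ) (hE : contract (euler 𝕜 m _) ξ = 0) :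
    LocalDeRham.degreeOp (LocalDeRham.degreeOp ξ) = ((m : 𝕜) - 1) • LocalDeRham.degreeOp ξ := by
  conv_lhs => rw [degreeOp_apply]
  simp only [hξ.iota_degreeOp hE, map_smul, ← Finset.smul_sum]
  rw [← degreeOp_apply]

/-- The coefficient of an invariant form of degree `m` is homogeneous of degree `-m` and depends on
`μ` only. -/
theorem IsInvariant.exists_eq_tmul_normalVolume (hξ : IsInvariant ξ)
    (hd : LocalDeRham.degreeOp ξ = (m : 𝕜) • ξ) (hH : wedgeHalfMu hmn ξ = 0) :
    ∃ h : Smooth 𝕜 (compl hmn R), Forms.ofFun h ∈ PoleForms 𝕜 hmn R ∧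
      ξ = h ⊗ₜ[𝕜] normalVolume 𝕜 hmn ∧ ∀ j, muFun 𝕜 hmn _ * pderiv 𝕜 _ j h =
        -((m : 𝕜) • (euler 𝕜 m _ j * h)) := by
  have hd' : LocalDeRham.degreeOp ξ = ((normalIndices hmn).length : 𝕜) • ξ := by
    rw [length_normalIndices, hd]
  have hI : ∀ k, k ∉ normalIndices hmn → LocalDeRham.iota k ξ = 0 := fun k hk =>
    hξ.iota k (not_lt.mp (mt (mem_normalIndices hmn).mpr hk))
  obtain ⟨h, hh, e⟩ := exists_eq_tmul_prod _ (nodup_normalIndices hmn) ξ hξ.mem hI hd'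
  rw [← normalVolume_eq] at e
  refine ⟨h, hh, e, fun j => tmul_normalVolume_injective hmn ?_⟩
  rw [← smul_tmul_form, ← coeffDeriv_tmul, TensorProduct.neg_tmul, ← TensorProduct.smul_tmul',
    ← smul_tmul_form, ← e, euler]
  split_ifs with hj
  · obtain ⟨j, rfl⟩ : ∃ j' : Fin m, j = Fin.castLE hmn j' := ⟨⟨j, hj⟩, rfl⟩
    have hw : wedge (Fin.castLE hmn j) ξ = 0 := by
      refine eq_zero_of_card_lt_degree (normalIndices hmn).toFinset (m + 1) _ (fun k hk => ?_) ?_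
        (Nat.lt_succ_of_le ((List.toFinset_card_le _).trans (length_normalIndices hmn).le))
      · rw [List.mem_toFinset] at hk
        rw [iota_wedge_of_ne (fun e : k = Fin.castLE hmn j => hk (e ▸ (mem_normalIndices hmn).mpr j.2)), hI k hk, map_zero,
          neg_zero]
      · rw [degreeOp_wedge, hd, map_smul, Nat.cast_succ, add_smul, one_smul]
    have h1 : wedge (Fin.castLE hmn j) (contract (euler 𝕜 m _) ξ) =
        coord 𝕜 (compl hmn R) (Fin.castLE hmn j) • ξ := by
      rw [LocalDeRham.contract_euler hmn, map_sum, Finset.sum_eq_single j]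
      · have h2 := iota_wedge_self (Fin.castLE hmn j) ξ
        rw [hw, map_zero] at h2
        rw [wedge_smul, ← sub_eq_zero.mp h2.symm]
      · intro i _ hij
        have h2 := iota_wedge_of_ne (fun e => hij (Fin.castLE_injective hmn e)) ξ
        rw [hw, map_zero] at h2
        rw [wedge_smul, neg_eq_zero.mp h2.symm, smul_zero]
      · exact fun h => absurd (Finset.mem_univ j) h
    have h3 := iota_wedgeHalfMu hmn j ξ
    rw [hH, map_zero] at h3
    rw [hξ.muFun_smul_coeffDeriv, h1, ← sub_eq_zero.mp h3.symm, hd, smul_comm, sub_add_cancel]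
  · rw [hξ.coeffDeriv j (not_lt.mp hj), zero_smul, smul_zero, smul_zero, neg_zero]

theorem pderiv_pow_mul {f : Smooth 𝕜 (compl hmn R)} {j : Fin n} {c : 𝕜} {g : Smooth 𝕜 (compl hmn R)}
    (h : muFun 𝕜 hmn _ * pderiv 𝕜 _ j f = c • (g * f)) (b : ℕ) :
    muFun 𝕜 hmn _ * pderiv 𝕜 _ j (f ^ b) = ((b : 𝕜) * c) • (g * f ^ b) := by
  induction b with
  | zero => rw [pow_zero, pderiv_one, mul_zero, Nat.cast_zero, zero_mul, zero_smul]
  | succ b ih =>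
    rw [pow_succ, pderiv_mul, mul_add, ← mul_assoc, ih, mul_left_comm, h]
    push_cast
    rw [add_mul, one_mul, add_smul, smul_mul_assoc, mul_smul_comm]
    congr 2 <;> ring

/-- If `h` is homogeneous of degree `-m` and depends on `μ` only, then `μ^a h^b` is constant if
`2a = mb`. -/
theorem exists_muFun_pow_mul_pow_eq (hm : 1 ≤ m) (hR : 0 < R) {h : Smooth 𝕜 (compl hmn R)}
    (hh : Forms.ofFun h ∈ PoleForms 𝕜 hmn R)
    (hd : ∀ j, muFun 𝕜 hmn _ * pderiv 𝕜 _ j h = -((m : 𝕜) • (euler 𝕜 m _ j * h))) {a b : ℕ}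
    (hab : 2 * a = m * b) : ∃ c : 𝕜, muFun 𝕜 hmn (compl hmn R) ^ a * h ^ b = c • 1 := by
  refine exists_eq_smul_one_of_pderiv_eq_zero hm hR ?_ fun j => ?_
  · have h1 : Forms.ofFun (h ^ b) ∈ PoleForms 𝕜 hmn R := by
      have h2 : Forms.ofFun (h ^ b) = Forms.ofFun h ^ b := by
        rw [Forms.ofFun, Forms.ofFun, Algebra.TensorProduct.tmul_pow, one_pow]
      exact h2 ▸ pow_mem hh b
    have h2 := smul_mem_poleForms (muFun 𝕜 hmn (ball n R) ^ a) h1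
    rwa [map_pow, restrictFun_muFun, smul_ofFun'] at h2
  · have h1 : muFun 𝕜 hmn (compl hmn R) * pderiv 𝕜 _ j (muFun 𝕜 hmn (compl hmn R)) =
        (2 : 𝕜) • (euler 𝕜 m _ j * muFun 𝕜 hmn _) := by
      rw [pderiv_muFun, euler]
      split_ifs
      · rw [← mul_smul_comm, mul_comm, Algebra.smul_def, map_ofNat]
        ring
      · rw [mul_zero, zero_mul, smul_zero]
    have h2 := pderiv_pow_mul h1 a
    have h3 := pderiv_pow_mul (j := j) (c := -(m : 𝕜)) (by rw [hd, neg_smul]) b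
    have h4 : muFun 𝕜 hmn (compl hmn R) *
        pderiv 𝕜 _ j (muFun 𝕜 hmn (compl hmn R) ^ a * h ^ b) = 0 := by
      have hc : (a : 𝕜) * 2 + (b : 𝕜) * -(m : 𝕜) = 0 := by
        have : (2 : 𝕜) * a = m * b := by exact_mod_cast hab
        linear_combination this
      rw [pderiv_mul, mul_add, ← mul_assoc, h2, mul_left_comm, h3, smul_mul_assoc, mul_smul_comm,
        mul_left_comm, ← mul_assoc, ← add_smul, hc, zero_smul]
    have h5 := congrArg (fun g => muInv 𝕜 hmn R * g) h4
    simp only [mul_zero, ← mul_assoc] at h5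
    rwa [mul_comm (muInv 𝕜 hmn R), muFun_mul_muInv, one_mul] at h5

/-- A homogeneous function of odd degree that depends on `μ` only vanishes at the base point: it is
constant on the circle through the base point and its antipode. -/
theorem apply_basePoint_eq_zero (hmn : m ≤ n) (hm : 2 ≤ m) (hR : 0 < R) {f : Smooth 𝕜 (ball n R)} {k : ℕ}
    (hk : Odd k) (hw : Forms.ofFun f ∈ weightSpace 𝕜 (ball n R) k)
    (hrot : ∀ i j : Fin n, (i : ℕ) < m → (j : ℕ) < m →
      dirDeriv (LocalDeRham.rotation 𝕜 (ball n R) i j) f = 0) :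
    extend f.1 (basePoint R (zero_lt_two.trans_le (hm.trans hmn))) = 0 := by
  have h0n : 0 < n := by omega
  set i0 : Fin n := ⟨0, h0n⟩
  set i1 : Fin n := ⟨1, by omega⟩
  have h01 : i1 ≠ i0 := by simp [i0, i1]
  -- The circle of radius `R / 2` in the plane of `x_1` and `x_2`.
  set γ : ℝ → EuclideanSpace ℝ (Fin n) := fun t =>
    Real.cos t • EuclideanSpace.single i0 (R / 2) + Real.sin t • EuclideanSpace.single i1 (R / 2)
  have hγ : ∀ t, γ t ∈ ball n R := fun t => by
    have h1 : ‖γ t‖ ^ 2 = (R / 2) ^ 2 := by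
      rw [EuclideanSpace.real_norm_sq_eq, Finset.sum_eq_add i0 i1 h01.symm]
      · simp [γ, h01, h01.symm]
        linear_combination (R / 2) ^ 2 * Real.sin_sq_add_cos_sq t
      · intro c _ hc
        simp [γ, hc.1, hc.2]
      · simp
      · simp
    change γ t ∈ Metric.ball 0 R
    rw [mem_ball_zero_iff]
    nlinarith [norm_nonneg (γ t)]
  have hderiv : ∀ t, HasDerivAt (fun t => extend f.1 (γ t)) 0 t := fun t => by
    have h1 : HasDerivAt γ (-Real.sin t • EuclideanSpace.single i0 (R / 2) +
        Real.cos t • EuclideanSpace.single i1 (R / 2)) t :=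
      ((Real.hasDerivAt_cos t).smul_const _).add ((Real.hasDerivAt_sin t).smul_const _)
    have h2 := (differentiableAt_extend f ⟨γ t, hγ t⟩).hasFDerivAt.comp_hasDerivAt t h1
    refine h2.congr_deriv ?_
    have h3 := congrArg (fun g : Smooth 𝕜 (ball n R) => g.1 ⟨γ t, hγ t⟩)
      (hrot i0 i1 (by simp only [i0]; omega) (by simp only [i1]; omega))
    rw [dirDeriv_rotation] at h3
    have h4 : (((γ t) i0 : ℝ) : 𝕜) * (pderiv 𝕜 _ i1 f).1 ⟨γ t, hγ t⟩ -
      (((γ t) i1 : ℝ) : 𝕜) * (pderiv 𝕜 _ i0 f).1 ⟨γ t, hγ t⟩ = 0 := h3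
    rw [fderiv_extend_apply f ⟨γ t, hγ t⟩, Finset.sum_eq_add i0 i1 h01.symm]
    · simp [γ, h01, h01.symm] at h4 ⊢
      linear_combination h4
    · intro c _ hc
      simp [hc.1, hc.2]
    · simp
    · simp
  have hconst := is_const_of_deriv_eq_zero (fun t => (hderiv t).differentiableAt)
    (fun t => (hderiv t).deriv) Real.pi 0
  have e0 : γ 0 = basePoint R h0n := by simp [γ, basePoint, i0]
  have e1 : γ Real.pi = -basePoint R h0n := by simp [γ, basePoint, i0]
  have h5 := apply_neg_of_mem_weightSpace k f hw ⟨γ 0, hγ 0⟩ ⟨γ Real.pi, hγ Real.pi⟩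
    (e1.trans (congrArg Neg.neg e0.symm))
  rw [← extend_coe f.1, ← extend_coe f.1 ⟨γ 0, hγ 0⟩, hk.neg_one_pow, neg_one_mul] at h5
  change extend f.1 (γ Real.pi) = -extend f.1 (γ 0) at h5
  change extend f.1 (γ Real.pi) = extend f.1 (γ 0) at hconst
  rw [hconst, e0] at h5
  exact self_eq_neg.mp h5

/-- For odd `m ≥ 3` there is no nonzero invariant form `h dx_1 ∧ ⋯ ∧ dx_m`: the numerator of `h` is
homogeneous of odd degree and depends on `μ` only, so that `h` vanishes at the base point, and
`μ^m h²` is constant. -/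
theorem eq_zero_of_odd (hm : 2 ≤ m) (hodd : Odd m) (hR : 0 < R) {h : Smooth 𝕜 (compl hmn R)}
    (hh : Forms.ofFun h ∈ PoleForms 𝕜 hmn R)
    (hd : ∀ j, muFun 𝕜 hmn _ * pderiv 𝕜 _ j h = -((m : 𝕜) • (euler 𝕜 m _ j * h))) : h = 0 := by
  have hm1 : 1 ≤ m := by omega
  obtain ⟨N₀, P₀, hP₀⟩ := exists_extension_of_ofFun_mem hh
  -- Increase the exponent, so that the degree `2N - m` of the numerator is nonnegative.
  obtain ⟨N, P, hN, hP⟩ : ∃ (N : ℕ) (P : Smooth 𝕜 (ball n R)), m ≤ 2 * N ∧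
      muFun 𝕜 hmn (compl hmn R) ^ N * h = restrictFun 𝕜 (compl_le hmn R) P :=
    ⟨N₀ + m, muFun 𝕜 hmn (ball n R) ^ m * P₀, by omega, by
      rw [map_mul, map_pow, restrictFun_muFun, ← hP₀, pow_add]; ring⟩
  have hinj := restrictFun_compl_injective (𝕜 := 𝕜) (R := R) hm1 hmn
  have hcancel : ∀ g : Smooth 𝕜 (compl hmn R), muFun 𝕜 hmn _ * g = 0 → g = 0 := fun g hg => by
    have h5 := congrArg (fun g => muInv 𝕜 hmn R * g) hg
    simp only [mul_zero, ← mul_assoc] at h5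
    rwa [mul_comm (muInv 𝕜 hmn R), muFun_mul_muInv, one_mul] at h5
  have hE : dirDeriv (LocalDeRham.radial 𝕜 (compl hmn R)) h = -((m : 𝕜) • h) := by
    refine sub_eq_zero.mp (hcancel _ ?_)
    have h1 : muFun 𝕜 hmn (compl hmn R) * dirDeriv (LocalDeRham.radial 𝕜 (compl hmn R)) h =
        -((m : 𝕜) • (muFun 𝕜 hmn _ * h)) := by
      rw [dirDeriv, Finset.mul_sum, muFun_eq_sum, Finset.sum_mul, Finset.smul_sum,
        ← Finset.sum_neg_distrib, sum_castLE hmn fun k =>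
          -((m : 𝕜) • (coord 𝕜 _ k * coord 𝕜 _ k * h)), ← muFun_eq_sum]
      refine Finset.sum_congr rfl fun k _ => ?_
      rw [mul_left_comm, hd, euler]
      split_ifs
      · rw [mul_neg, mul_smul_comm, mul_assoc]; rfl
      · rw [zero_mul, smul_zero, neg_zero, mul_zero]
    rw [mul_sub, h1, mul_neg, mul_smul_comm, sub_self]
  have hw : Forms.ofFun P ∈ weightSpace 𝕜 (ball n R) (2 * N - m) := by
    refine ofFun_mem_weightSpace.mpr (hinj ?_)
    rw [← dirDeriv_restrictFun _ (restrictFun_radial _), map_smul, ← hP, dirDeriv_mul,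
      dirDeriv_radial_muFun_pow, hE, mul_neg, mul_smul_comm, smul_mul_assoc, ← sub_eq_add_neg,
      ← sub_smul, Nat.cast_sub hN]
  have hrot : ∀ i j : Fin n, (i : ℕ) < m → (j : ℕ) < m →
      dirDeriv (LocalDeRham.rotation 𝕜 (ball n R) i j) P = 0 := fun i j hi hj => by
    apply hinj
    rw [← dirDeriv_restrictFun _ (restrictFun_rotation _ i j), map_zero, ← hP, dirDeriv_mul,
      dirDeriv_pow_eq_zero (dirDeriv_rotation_muFun hmn hi hj), zero_mul, zero_add,
      hcancel (dirDeriv (LocalDeRham.rotation 𝕜 (compl hmn R) i j) h) ?_, mul_zero]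
    rw [dirDeriv_rotation, mul_sub, mul_left_comm, hd, mul_left_comm, hd, euler, euler, if_pos hi,
      if_pos hj, mul_neg, mul_neg, mul_smul_comm, mul_smul_comm, mul_left_comm, sub_self]
  have hP0 := apply_basePoint_eq_zero hmn hm hR
    (Nat.Even.sub_odd hN (even_two_mul N) hodd) hw hrot
  set p : compl hmn R := ⟨basePoint R (zero_lt_two.trans_le (hm.trans hmn)), basePoint_mem hm1 hR⟩
  have hp : h.1 p = 0 := by
    have h1 := congrArg (fun g : Smooth 𝕜 (compl hmn R) => g.1 p) hP
    have h2 : (muFun 𝕜 hmn (compl hmn R) ^ N).1 p * h.1 p = P.1 ⟨p.1, compl_le hmn R p.2⟩ := h1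
    rw [← extend_coe P.1 ⟨p.1, compl_le hmn R p.2⟩, hP0] at h2
    refine (mul_eq_zero.mp h2).resolve_left (pow_ne_zero N ?_)
    exact RCLike.ofReal_ne_zero.mpr (mu_ne_zero p.2)
  obtain ⟨c, hc⟩ := exists_muFun_pow_mul_pow_eq hm1 hR hh hd (a := m) (b := 2) (mul_comm 2 m)
  have hval : ∀ x : compl hmn R, (muFun 𝕜 hmn (compl hmn R) ^ m).1 x * h.1 x ^ 2 = c * 1 :=
    fun x => congrArg (fun g : Smooth 𝕜 (compl hmn R) => g.1 x) hc
  ext x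
  have h3 := (hval x).trans (hval p).symm
  rw [hp, zero_pow two_ne_zero, mul_zero] at h3
  refine pow_eq_zero_iff two_ne_zero |>.mp ((mul_eq_zero.mp h3).resolve_left (pow_ne_zero m ?_))
  exact RCLike.ofReal_ne_zero.mpr (mu_ne_zero x.2)

/-- An invariant form `ξ` with `ι_e ξ = 0` is a constant plus `ι_e (h dx_1 ∧ ⋯ ∧ dx_m)`, where `h` is
homogeneous of degree `-m` and depends on `μ` only; for `m = 1` it is a constant. -/
theorem IsInvariant.exists_eq_add_contract (hm : 1 ≤ m) (hR : 0 < R) (hξ : IsInvariant ξ)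
    (hE : contract (euler 𝕜 m _) ξ = 0) : ∃ c : 𝕜,
      (ξ = c • 1 ∨ (2 ≤ m ∧ ∃ h : Smooth 𝕜 (compl hmn R), Forms.ofFun h ∈ PoleForms 𝕜 hmn R ∧
        (∀ j, muFun 𝕜 hmn _ * pderiv 𝕜 _ j h = -((m : 𝕜) • (euler 𝕜 m _ j * h))) ∧
        ξ = c • 1 + contract (euler 𝕜 m _) (h ⊗ₜ[𝕜] normalVolume 𝕜 hmn))) := by
  have hdd := hξ.degreeOp_degreeOp hE
  rcases hm.eq_or_lt with rfl | hm2
  · rw [Nat.cast_one, sub_self, zero_smul] at hdd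
    have h1 := eq_ofFun_of_degreeOp_eq_zero hdd
    rw [scalarPart_degreeOp] at h1
    obtain ⟨c, hc⟩ := hξ.exists_eq_smul_one hm hR (h1.trans (TensorProduct.zero_tmul _ _))
    exact ⟨c, Or.inl hc⟩
  have hm0 : (m : 𝕜) - 1 ≠ 0 := sub_ne_zero.mpr (by exact_mod_cast hm2.ne')
  set ξ₁ := ((m : 𝕜) - 1)⁻¹ • LocalDeRham.degreeOp ξ with hξ₁
  have hi₁ : IsInvariant ξ₁ := hξ.degreeOp.smul _
  have hd₁ : LocalDeRham.degreeOp ξ₁ = ((m : 𝕜) - 1) • ξ₁ := by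
    rw [hξ₁, map_smul, hdd, smul_comm]
  have hE₁ : contract (euler 𝕜 m _) ξ₁ = 0 := by
    have h := degreeOp_contract (euler 𝕜 m _) ξ
    rw [hE, map_zero, sub_zero] at h
    rw [hξ₁, map_smul, ← h, smul_zero]
  obtain ⟨c, hc⟩ := (hξ.sub hi₁).exists_eq_smul_one hm hR (by
    rw [map_sub, hd₁, hξ₁, smul_inv_smul₀ hm0, sub_self])
  -- The form `½ α ξ₁` has degree `m`, and its contraction with `e` is `ξ₁`.
  have hv := hi₁.alpha_mul.smul (2⁻¹ : 𝕜)
  obtain ⟨h, hh, e, hd⟩ := hv.exists_eq_tmul_normalVolume (by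
    rw [map_smul, degreeOp_alpha_mul, hd₁, mul_smul_comm, sub_smul, one_smul, sub_add_cancel,
      smul_comm]) (by
    rw [LocalDeRham.alpha_mul, map_smul, map_smul, wedgeHalfMu_smul, wedgeHalfMu_wedgeHalfMu,
      smul_zero, smul_zero, smul_zero])
  refine ⟨c, Or.inr ⟨hm2, h, hh, hd, ?_⟩⟩
  rw [← e, map_smul, contract_alpha_mul, hE₁, mul_zero, sub_zero, inv_smul_smul₀ two_ne_zero, ← hc,
    sub_add_cancel]

/-- Every invariant form is `α ξ₁ + ξ₀` with invariant `ξ₀`, `ξ₁` that are annihilated by `ι_e`. -/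
theorem IsInvariant.exists_eq_alpha_mul_add (hξ : IsInvariant ξ) :
    ∃ ξ₀ ξ₁ : Forms 𝕜 (compl hmn R), IsInvariant ξ₀ ∧ IsInvariant ξ₁ ∧
      contract (euler 𝕜 m _) ξ₀ = 0 ∧ contract (euler 𝕜 m _) ξ₁ = 0 ∧
      ξ = ξ₀ + alpha 𝕜 hmn R * ξ₁ := by
  have h1 : contract (euler 𝕜 m _) ((2⁻¹ : 𝕜) • contract (euler 𝕜 m _) ξ) = 0 := by
    rw [map_smul, contract_contract, smul_zero]
  have hi := hξ.contract_euler.smul (2⁻¹ : 𝕜)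
  refine ⟨ξ - alpha 𝕜 hmn R * ((2⁻¹ : 𝕜) • contract (euler 𝕜 m _) ξ), _, hξ.sub hi.alpha_mul, hi,
    ?_, h1, (sub_add_cancel _ _).symm⟩
  rw [map_sub, contract_alpha_mul, h1, mul_zero, sub_zero, smul_inv_smul₀ two_ne_zero, sub_self]

/-- For odd `m` the invariant forms are the combinations of `1` and `α`. -/
theorem IsInvariant.exists_eq_of_odd (hm : 1 ≤ m) (hodd : Odd m) (hR : 0 < R)
    (hξ : IsInvariant ξ) : ∃ a b : 𝕜, ξ = a • 1 + b • alpha 𝕜 hmn R := by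
  have key : ∀ ζ : Forms 𝕜 (compl hmn R), IsInvariant ζ → contract (euler 𝕜 m _) ζ = 0 →
      ∃ c : 𝕜, ζ = c • 1 := fun ζ hζ hE => by
    obtain ⟨c, h | ⟨hm2, h, hh, hd, e⟩⟩ := hζ.exists_eq_add_contract hm hR hE
    · exact ⟨c, h⟩
    · refine ⟨c, ?_⟩
      rw [e, eq_zero_of_odd hm2 hodd hR hh hd, TensorProduct.zero_tmul, map_zero, add_zero]
  obtain ⟨ξ₀, ξ₁, h₀, h₁, hE₀, hE₁, e⟩ := hξ.exists_eq_alpha_mul_add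
  obtain ⟨a, rfl⟩ := key ξ₀ h₀ hE₀
  obtain ⟨b, rfl⟩ := key ξ₁ h₁ hE₁
  exact ⟨a, b, by rw [e, mul_smul_comm, mul_one]⟩

end Classification

/-! ### Graded commutativity -/

section GradedCommutativity

variable {𝕜 : Type*} [RCLike 𝕜] {n : ℕ} {U : TopologicalSpace.Opens (EuclideanSpace ℝ (Fin n))}

/-- The sign rule for constant forms, by induction on the degree of one factor. -/
theorem mul_eq_involute_mul {p : ℕ} {u : ConstForms 𝕜 n} (hu : u ∈ ⋀[𝕜]^p (Fin n → 𝕜)) :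
    (∀ v : ConstForms 𝕜 n, u * v = (CliffordAlgebra.involute^[p] v) * u) ∧
      CliffordAlgebra.involute u = (-1 : 𝕜) ^ p • u := by
  induction hu using Submodule.pow_induction_on_left' with
  | algebraMap r =>
    refine ⟨fun v => Algebra.commutes r v, ?_⟩
    rw [pow_zero, one_smul]
    exact AlgHom.commutes _ r
  | add x y i hx hy ihx ihy =>
    refine ⟨fun v => ?_, ?_⟩
    · rw [add_mul, ihx.1, ihy.1, mul_add]
    · rw [map_add, ihx.2, ihy.2, smul_add]
  | mem_mul a ha i x hx ih =>
    obtain ⟨w, rfl⟩ := ha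
    have h1 : ∀ v : ConstForms 𝕜 n,
        ExteriorAlgebra.ι 𝕜 w * v = CliffordAlgebra.involute v * ExteriorAlgebra.ι 𝕜 w := fun v => by
      rw [ι_eq_sum_dx, Finset.sum_mul, Finset.mul_sum]
      refine Finset.sum_congr rfl fun i _ => ?_
      rw [smul_mul_assoc, dx_mul, mul_smul_comm]
    refine ⟨fun v => ?_, ?_⟩
    · rw [mul_assoc, ih.1, ← mul_assoc, h1, Function.iterate_succ_apply', mul_assoc]
    · rw [map_mul, ih.2, show CliffordAlgebra.involute (ExteriorAlgebra.ι 𝕜 w) =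
        -ExteriorAlgebra.ι 𝕜 w from CliffordAlgebra.involute_ι _, mul_smul_comm, neg_mul,
        pow_succ, mul_neg_one, neg_smul, smul_neg]

theorem sign_of_mem_degree {p : ℕ} {ξ : Forms 𝕜 U} (hξ : ξ ∈ Forms.degree 𝕜 U p) :
    Forms.sign 𝕜 U ξ = (-1 : 𝕜) ^ p • ξ := by
  obtain ⟨ζ, rfl⟩ := hξ
  induction ζ using TensorProduct.induction_on with
  | zero => rw [map_zero, map_zero, smul_zero]
  | add a b ha hb => rw [map_add, map_add, ha, hb, smul_add]
  | tmul f u =>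
    rw [LinearMap.lTensor_tmul, Forms.sign_tmul, Submodule.subtype_apply,
      (mul_eq_involute_mul u.2).2, TensorProduct.tmul_smul]

theorem mul_of_mem_degree_odd {p : ℕ} (hp : Odd p) {ξ : Forms 𝕜 U}
    (hξ : ξ ∈ Forms.degree 𝕜 U p) (η : Forms 𝕜 U) : ξ * η = Forms.sign 𝕜 U η * ξ := by
  obtain ⟨ζ, rfl⟩ := hξ
  induction ζ using TensorProduct.induction_on with
  | zero => rw [map_zero, zero_mul, mul_zero]
  | add a b ha hb => rw [map_add, add_mul, ha, hb, mul_add]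
  | tmul f u =>
    induction η using TensorProduct.induction_on with
    | zero => rw [map_zero, zero_mul, mul_zero]
    | add a b ha hb => rw [map_add, add_mul, mul_add, ha, hb]
    | tmul g v =>
      have h : CliffordAlgebra.involute^[p] v = CliffordAlgebra.involute v := by
        have h2 : Function.Involutive (CliffordAlgebra.involute (Q := (0 : QuadraticForm 𝕜 (Fin n → 𝕜)))) :=
          CliffordAlgebra.involute_involutive
        rw [h2.iterate_odd hp]
      rw [LinearMap.lTensor_tmul, Forms.sign_tmul, Submodule.subtype_apply,
        Algebra.TensorProduct.tmul_mul_tmul, Algebra.TensorProduct.tmul_mul_tmul,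
        (mul_eq_involute_mul u.2).1, h, mul_comm]

theorem mul_self_of_mem_degree_odd {p : ℕ} (hp : Odd p) {ξ : Forms 𝕜 U}
    (hξ : ξ ∈ Forms.degree 𝕜 U p) : ξ * ξ = 0 := by
  have h := mul_of_mem_degree_odd hp hξ ξ
  rw [sign_of_mem_degree hξ, hp.neg_one_pow, neg_one_smul, neg_mul] at h
  have h2 : (2 : 𝕜) • (ξ * ξ) = 0 := by
    rw [two_smul]
    exact eq_neg_iff_add_eq_zero.mp h
  exact (smul_eq_zero.mp h2).resolve_left two_ne_zero

theorem mul_comm_of_mem_degree_odd {p q : ℕ} (hp : Odd p) (hq : Odd q) {ξ η : Forms 𝕜 U}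
    (hξ : ξ ∈ Forms.degree 𝕜 U p) (hη : η ∈ Forms.degree 𝕜 U q) : ξ * η = -(η * ξ) := by
  rw [mul_of_mem_degree_odd hp hξ, sign_of_mem_degree hη, hq.neg_one_pow, neg_one_smul, neg_mul]

theorem mul_mem_degree {p q : ℕ} {ξ η : Forms 𝕜 U}
    (hξ : ξ ∈ Forms.degree 𝕜 U p) (hη : η ∈ Forms.degree 𝕜 U q) :
    ξ * η ∈ Forms.degree 𝕜 U (p + q) := by
  obtain ⟨ζ, rfl⟩ := hξ
  obtain ⟨θ, rfl⟩ := hη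
  induction ζ using TensorProduct.induction_on with
  | zero => rw [map_zero, zero_mul]; exact zero_mem _
  | add a b ha hb => rw [map_add, add_mul]; exact add_mem ha hb
  | tmul f u =>
    induction θ using TensorProduct.induction_on with
    | zero => rw [map_zero, mul_zero]; exact zero_mem _
    | add a b ha hb => rw [map_add, mul_add]; exact add_mem ha hb
    | tmul g v => exact ⟨(f * g) ⊗ₜ[𝕜] ⟨u.1 * v.1, SetLike.GradedMul.mul_mem u.2 v.2⟩, by
      simp only [LinearMap.lTensor_tmul, Algebra.TensorProduct.tmul_mul_tmul,
        Submodule.subtype_apply]⟩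

theorem tmul_mem_degree {p : ℕ} (f : Smooth 𝕜 U) {u : ConstForms 𝕜 n}
    (hu : u ∈ ⋀[𝕜]^p (Fin n → 𝕜)) : (f ⊗ₜ[𝕜] u : Forms 𝕜 U) ∈ Forms.degree 𝕜 U p :=
  ⟨f ⊗ₜ[𝕜] ⟨u, hu⟩, rfl⟩

theorem prod_dx_mem {ι : Type*} (l : List ι) (F : ι → Fin n) :
    (l.map fun i => dx 𝕜 (F i)).prod ∈ ⋀[𝕜]^l.length (Fin n → 𝕜) := by
  induction l with
  | nil => exact SetLike.GradedOne.one_mem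
  | cons j l ih =>
    rw [List.map_cons, List.prod_cons, List.length_cons]
    have h : LinearMap.range (ExteriorAlgebra.ι 𝕜 (M := Fin n → 𝕜)) ^ (l.length + 1) =
      LinearMap.range (ExteriorAlgebra.ι 𝕜 (M := Fin n → 𝕜)) *
        LinearMap.range (ExteriorAlgebra.ι 𝕜 (M := Fin n → 𝕜)) ^ l.length := pow_succ' _ _
    change _ ∈ LinearMap.range (ExteriorAlgebra.ι 𝕜 (M := Fin n → 𝕜)) ^ (l.length + 1)
    rw [h]
    exact Submodule.mul_mem_mul ⟨_, rfl⟩ ih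

end GradedCommutativity

/-! ### The form `β` -/

section Beta

variable {𝕜 : Type*} [RCLike 𝕜] {n m : ℕ} {hmn : m ≤ n} {R : ℝ}
  {U : TopologicalSpace.Opens (EuclideanSpace ℝ (Fin n))}

/-- The sign of the `i`-th term of `β` is the sign of the contraction of the volume form with
`∂/∂x_i`. -/
theorem iota_tmul_prod_of_mem (hmn : m ≤ n) (f : Smooth 𝕜 U) (l : List (Fin m)) (hl : l.Nodup)
    {i : Fin m} (hi : i ∈ l) :
    iota (Fin.castLE hmn i) (f ⊗ₜ[𝕜] (l.map fun j => dx 𝕜 (Fin.castLE hmn j)).prod : Forms 𝕜 U) =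
      (-1 : 𝕜) ^ l.idxOf i • (f ⊗ₜ[𝕜]
        ((l.filter (· ≠ i)).map fun j => dx 𝕜 (Fin.castLE hmn j)).prod : Forms 𝕜 U) := by
  induction l with
  | nil => exact absurd hi List.not_mem_nil
  | cons j l ih =>
    rw [List.nodup_cons] at hl
    rw [List.map_cons, List.prod_cons, ← wedge_tmul]
    by_cases e : j = i
    · subst e
      have h1 : (l.map fun k => dx 𝕜 (Fin.castLE hmn k)) =
          (l.map (Fin.castLE hmn)).map (dx 𝕜) := by rw [List.map_map]; rfl
      have h2 : l.filter (· ≠ j) = l := List.filter_eq_self.mpr fun k hk => by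
        simpa using fun e : k = j => hl.1 (e ▸ hk)
      have h3 : Fin.castLE hmn j ∉ l.map (Fin.castLE hmn) := fun h => by
        obtain ⟨k, hk, e⟩ := List.mem_map.mp h
        exact hl.1 (Fin.castLE_injective hmn e ▸ hk)
      rw [iota_wedge_self, h1, iota_tmul_prod_of_notMem _ f h3, map_zero, sub_zero,
        List.idxOf_cons_self, pow_zero, one_smul, List.filter_cons_of_neg (by simp), h2, h1]
    · have hi' : i ∈ l := (List.mem_cons.mp hi).resolve_left (Ne.symm e)
      rw [iota_wedge_of_ne (fun e' => e (Fin.castLE_injective hmn e').symm), ih hl.2 hi', map_smul,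
        List.idxOf_cons_ne _ e, List.filter_cons_of_pos (by simpa using e), List.map_cons,
        List.prod_cons, wedge_tmul, pow_succ, mul_neg_one, neg_smul]

/-- The form `μ^{-m/2} dx_1 ∧ ⋯ ∧ dx_m` for even `m`. -/
def invariantVolume (𝕜 : Type*) [RCLike 𝕜] {n m : ℕ} (hmn : m ≤ n) (R : ℝ) :
    Forms 𝕜 (compl hmn R) :=
  (muInv 𝕜 hmn R ^ (m / 2)) ⊗ₜ[𝕜] normalVolume 𝕜 hmn

/-- `β` is the contraction of the invariant volume form with the normal Euler field. -/
theorem beta_eq_contract :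
    beta 𝕜 hmn R = contract (euler 𝕜 m _) (invariantVolume 𝕜 hmn R) := by
  rw [beta, contract_euler hmn]
  refine Finset.sum_congr rfl fun i _ => ?_
  rw [invariantVolume, normalVolume, iota_tmul_prod_of_mem hmn _ _ (List.nodup_finRange m)
    (List.mem_finRange i), List.idxOf_finRange, smul_comm, smul_tmul_form]

theorem iota_invariantVolume {j : Fin n} (hj : m ≤ (j : ℕ)) :
    iota j (invariantVolume 𝕜 hmn R) = 0 := by
  rw [invariantVolume, normalVolume_eq]
  exact iota_tmul_prod_of_notMem _ _ (mt (mem_normalIndices hmn).mp (not_lt.mpr hj))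

theorem normalVolume_mem : normalVolume 𝕜 hmn ∈ ⋀[𝕜]^m (Fin n → 𝕜) := by
  have h := prod_dx_mem (𝕜 := 𝕜) (List.finRange m) (Fin.castLE hmn)
  rwa [List.length_finRange] at h

theorem degreeOp_invariantVolume :
    degreeOp (invariantVolume 𝕜 hmn R) = (m : 𝕜) • invariantVolume 𝕜 hmn R :=
  degreeOp_tmul normalVolume_mem _

theorem wedge_invariantVolume {j : Fin n} (hj : (j : ℕ) < m) :
    wedge j (invariantVolume 𝕜 hmn R) = 0 := by
  refine eq_zero_of_card_lt_degree (normalIndices hmn).toFinset (m + 1) _ (fun k hk => ?_) ?_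
    (Nat.lt_succ_of_le ((List.toFinset_card_le _).trans (length_normalIndices hmn).le))
  · rw [List.mem_toFinset, mem_normalIndices] at hk
    rw [iota_wedge_of_ne (fun e : k = j => hk (e ▸ hj)), iota_invariantVolume (not_lt.mp hk),
      map_zero, neg_zero]
  · rw [degreeOp_wedge, degreeOp_invariantVolume, map_smul, Nat.cast_succ, add_smul, one_smul]

theorem alpha_mul_invariantVolume : alpha 𝕜 hmn R * invariantVolume 𝕜 hmn R = 0 := by
  rw [alpha_mul, wedgeHalfMu_apply, Finset.sum_eq_zero, smul_zero, smul_zero]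
  intro i _
  rw [wedge_invariantVolume (by rw [Fin.val_castLE]; exact i.2), smul_zero]

theorem invariantVolume_mem_poleForms : invariantVolume 𝕜 hmn R ∈ PoleForms 𝕜 hmn R := by
  have h := muInv_pow_smul_mem_poleForms (m / 2) (restrict_mem_poleForms (hmn := hmn)
    (1 ⊗ₜ[𝕜] normalVolume 𝕜 hmn : Forms 𝕜 (ball n R)))
  rwa [restrict_tmul, map_one, smul_tmul_form, mul_one] at h

theorem contract_eq_of_iota {ξ : Forms 𝕜 (compl hmn R)}
    (h : ∀ j : Fin n, m ≤ (j : ℕ) → iota j ξ = 0) :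
    contract (radial 𝕜 _) ξ = contract (euler 𝕜 m _) ξ := by
  rw [contract_eq_sum, contract_eq_sum]
  refine Finset.sum_congr rfl fun k _ => ?_
  by_cases hk : (k : ℕ) < m
  · rw [euler, if_pos hk]; rfl
  · rw [h k (not_lt.mp hk), smul_zero, smul_zero]

theorem pderiv_muInv_of_le {j : Fin n} (hj : m ≤ (j : ℕ)) :
    pderiv 𝕜 _ j (muInv 𝕜 hmn R) = 0 := by
  have h : dirDeriv (Pi.single j 1) (muFun 𝕜 hmn (compl hmn R)) = (0 : 𝕜) • muFun 𝕜 hmn _ := by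
    rw [← pderiv_eq_dirDeriv, pderiv_muFun, if_neg (not_lt.mpr hj), zero_smul]
  rw [pderiv_eq_dirDeriv, dirDeriv_muInv h, zero_smul, neg_zero]

theorem d_invariantVolume : d 𝕜 _ (invariantVolume 𝕜 hmn R) = 0 := by
  rw [d_eq_sum]
  refine Finset.sum_eq_zero fun j _ => ?_
  by_cases hj : (j : ℕ) < m
  · rw [wedge_invariantVolume hj, map_zero]
  · rw [← wedge_coeffDeriv, invariantVolume, coeffDeriv_tmul, pderiv_eq_dirDeriv,
      dirDeriv_pow_eq_zero, TensorProduct.zero_tmul, map_zero]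
    rw [← pderiv_eq_dirDeriv, pderiv_muInv_of_le (not_lt.mp hj)]

theorem lieDeriv_radial_invariantVolume (hm : Even m) :
    lieDeriv (radial 𝕜 _) (invariantVolume 𝕜 hmn R) = 0 := by
  have h := dirDeriv_pow_of_eq_smul (c := (-2 : 𝕜))
    ((dirDeriv_muInv (dirDeriv_radial_muFun (U := compl hmn R) hmn)).trans (neg_smul _ _).symm)
    (m / 2)
  have hc : ((m / 2 : ℕ) : 𝕜) * -2 + m = 0 := by
    obtain ⟨s, rfl⟩ := hm
    rw [← two_mul, Nat.mul_div_cancel_left s two_pos]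
    push_cast
    ring
  rw [invariantVolume, lieDeriv_radial_tmul normalVolume_mem, h, ← add_smul, hc, zero_smul,
    TensorProduct.zero_tmul]

/-- By Cartan's formula `d ι_E v = L_E v - ι_E dv = 0` for the invariant volume form `v`, and
`ι_E v = ι_e v`. -/
theorem d_beta (hm : Even m) : d 𝕜 _ (beta 𝕜 hmn R) = 0 := by
  have h := lieDeriv_apply (radial 𝕜 _) (invariantVolume 𝕜 hmn R)
  rw [lieDeriv_radial_invariantVolume hm, d_invariantVolume, map_zero, add_zero,
    contract_eq_of_iota fun j hj => iota_invariantVolume hj, ← beta_eq_contract] at h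
  exact h.symm

theorem contract_beta : contract (euler 𝕜 m _) (beta 𝕜 hmn R) = 0 := by
  rw [beta_eq_contract, contract_contract]

theorem beta_mem_poleForms : beta 𝕜 hmn R ∈ PoleForms 𝕜 hmn R := by
  rw [beta_eq_contract]
  exact contract_mem_poleForms (restrictFun_euler _) invariantVolume_mem_poleForms

theorem beta_mem_closedForms (hm : Even m) : beta 𝕜 hmn R ∈ ClosedForms 𝕜 hmn R :=
  ⟨beta_mem_poleForms, d_beta hm⟩

theorem isBasic_beta (hm : Even m) : IsBasic (beta 𝕜 hmn R) := by
  refine ⟨⟨contract_beta, ?_⟩, fun j hj => ?_⟩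
  · rw [lieDeriv_apply, contract_beta, d_beta hm, map_zero, map_zero, add_zero]
  · have h : contract (Pi.single j (1 : Smooth 𝕜 (compl hmn R))) (beta 𝕜 hmn R) = 0 := by
      rw [contract_eq_sum, sum_single_smul, one_smul, beta_eq_contract, iota_contract,
        iota_invariantVolume hj, map_zero, neg_zero]
    exact ⟨h, by rw [lieDeriv_apply, h, d_beta hm, map_zero, map_zero, add_zero]⟩

theorem alpha_mul_beta_eq_smul :
    alpha 𝕜 hmn R * beta 𝕜 hmn R = (2 : 𝕜) • invariantVolume 𝕜 hmn R := by
  have h := contract_alpha_mul (invariantVolume 𝕜 hmn R)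
  rw [alpha_mul_invariantVolume, map_zero, ← beta_eq_contract] at h
  exact (sub_eq_zero.mp h.symm).symm

theorem alpha_mul_beta : alpha 𝕜 hmn R * beta 𝕜 hmn R =
    (2 * muInv 𝕜 hmn R ^ (m / 2)) ⊗ₜ[𝕜] normalVolume 𝕜 hmn := by
  rw [alpha_mul_beta_eq_smul, invariantVolume, TensorProduct.smul_tmul', Algebra.smul_def,
    map_ofNat]

theorem beta_mem_degree : beta 𝕜 hmn R ∈ Forms.degree 𝕜 (compl hmn R) (m - 1) := by
  refine sum_mem fun i _ => Submodule.smul_mem _ _ (tmul_mem_degree _ ?_)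
  have h := prod_dx_mem (𝕜 := 𝕜) ((List.finRange m).filter (· ≠ i)) (Fin.castLE hmn)
  have hl : ((List.finRange m).filter (· ≠ i)).length = m - 1 := by
    have h2 := List.length_erase_of_mem (List.mem_finRange i)
    rw [List.Nodup.erase_eq_filter (List.nodup_finRange m), List.length_finRange] at h2
    rw [← h2]
    congr 2
    ext k
    by_cases e : k = i <;> simp [e]
  rwa [hl] at h

theorem alpha_mem_degree : alpha 𝕜 hmn R ∈ Forms.degree 𝕜 (compl hmn R) 1 := by
  rw [alpha, Forms.ofFun, Forms.ofFun, d_tmul, Finset.mul_sum]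
  refine sum_mem fun i _ => ?_
  rw [Algebra.TensorProduct.tmul_mul_tmul, one_mul, mul_one]
  refine tmul_mem_degree _ ?_
  have h := prod_dx_mem (𝕜 := 𝕜) [i] id
  rwa [List.map_singleton, List.prod_singleton] at h

end Beta

/-! ### Alternating maps of top degree -/

section AlternatingMaps

/-- A module-valued alternating map in `m` variables on an `m`-dimensional space is a multiple of
the determinant. -/
theorem alternatingMap_apply_eq_det {𝕜 M : Type*} [Field 𝕜] [AddCommGroup M] [Module 𝕜 M] {m : ℕ}
    (f : (Fin m → 𝕜) [⋀^Fin m]→ₗ[𝕜] M) (v : Fin m → Fin m → 𝕜) :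
    f v = (Matrix.of v).det • f (Pi.basisFun 𝕜 (Fin m)) := by
  have h : f = (LinearMap.toSpanSingleton 𝕜 M (f (Pi.basisFun 𝕜 (Fin m)))).compAlternatingMap
      Matrix.detRowAlternating := by
    refine Module.Basis.ext_alternating (Pi.basisFun 𝕜 (Fin m)) fun σ hσ => ?_
    set τ : Equiv.Perm (Fin m) := Equiv.ofBijective σ (Finite.injective_iff_bijective.mp hσ)
    have e : (fun i => Pi.basisFun 𝕜 (Fin m) (σ i)) = (Pi.basisFun 𝕜 (Fin m)) ∘ τ := rfl
    rw [e, AlternatingMap.map_perm, AlternatingMap.map_perm]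
    congr 1
    have h1 : Matrix.detRowAlternating (R := 𝕜) (Pi.basisFun 𝕜 (Fin m)) = 1 := by
      rw [← Matrix.det_one (n := Fin m) (R := 𝕜)]
      refine congrArg Matrix.det ?_
      ext i j
      simp [Matrix.one_apply, Pi.single_apply, eq_comm]
    rw [LinearMap.compAlternatingMap_apply, h1, LinearMap.toSpanSingleton_apply, one_smul]
  conv_lhs => rw [h]
  rfl

end AlternatingMaps

/-! ### Pullback along linear maps -/

section Pullback

variable {𝕜 : Type*} [RCLike 𝕜] {n m : ℕ} {hmn : m ≤ n} {R : ℝ}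
  {U V : TopologicalSpace.Opens (EuclideanSpace ℝ (Fin n))}

/-- The action of a linear map `g` on the forms with constant coefficients of degree one,
`dx_i ↦ ∑_j g_{ij} dx_j`. -/
def transposeMap (𝕜 : Type*) [RCLike 𝕜] {n : ℕ}
    (g : EuclideanSpace ℝ (Fin n) →L[ℝ] EuclideanSpace ℝ (Fin n)) :
    (Fin n → 𝕜) →ₗ[𝕜] (Fin n → 𝕜) :=
  Matrix.toLin' (Matrix.of fun j i : Fin n => ((g (EuclideanSpace.single j 1) i : ℝ) : 𝕜))

theorem transposeMap_apply (g : EuclideanSpace ℝ (Fin n) →L[ℝ] EuclideanSpace ℝ (Fin n))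
    (v : Fin n → 𝕜) (j : Fin n) : transposeMap 𝕜 g v j =
      ∑ i, ((g (EuclideanSpace.single j 1) i : ℝ) : 𝕜) * v i := rfl

/-- The composition of functions with a linear map. -/
def pullbackFun (𝕜 : Type*) [RCLike 𝕜] {n : ℕ}
    {U V : TopologicalSpace.Opens (EuclideanSpace ℝ (Fin n))}
    (g : EuclideanSpace ℝ (Fin n) →L[ℝ] EuclideanSpace ℝ (Fin n)) (hg : Set.MapsTo g U V)
    (f : Smooth 𝕜 V) : Smooth 𝕜 U :=
  ⟨fun x => f.1 ⟨g x, hg x.2⟩, contDiffOn_extend_of_eq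
    (ContDiffOn.comp f.2 g.contDiff.contDiffOn hg) fun x => (extend_coe f.1 ⟨g x, hg x.2⟩).symm⟩

theorem pullback_tmul (g : EuclideanSpace ℝ (Fin n) →L[ℝ] EuclideanSpace ℝ (Fin n))
    (hg : Set.MapsTo g U V) (f : Smooth 𝕜 V) (u : ConstForms 𝕜 n) :
    pullback 𝕜 g hg (f ⊗ₜ[𝕜] u) =
      pullbackFun 𝕜 g hg f ⊗ₜ[𝕜] ExteriorAlgebra.map (transposeMap 𝕜 g) u :=
  Algebra.TensorProduct.map_tmul _ _ _ _

/-- Contraction is natural for linear maps. -/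
theorem contractLeft_map {A : (Fin n → 𝕜) →ₗ[𝕜] (Fin n → 𝕜)} (φ : (Fin n → 𝕜) →ₗ[𝕜] 𝕜)
    (u : ConstForms 𝕜 n) :
    CliffordAlgebra.contractLeft φ (ExteriorAlgebra.map A u) =
      ExteriorAlgebra.map A (CliffordAlgebra.contractLeft (φ ∘ₗ A) u) := by
  induction u using CliffordAlgebra.left_induction with
  | algebraMap r =>
    rw [CliffordAlgebra.contractLeft_algebraMap, map_zero]
    refine (congrArg _ (AlgHom.commutes (ExteriorAlgebra.map A) r)).trans ?_
    exact CliffordAlgebra.contractLeft_algebraMap _ _ _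
  | add a b ha hb => rw [map_add, map_add, ha, hb, map_add, map_add]
  | ι_mul u v ih =>
    have h1 : ExteriorAlgebra.map A (CliffordAlgebra.ι 0 v * u) =
        ExteriorAlgebra.ι 𝕜 (A v) * ExteriorAlgebra.map A u := by
      rw [map_mul]
      exact congrArg (· * _) (ExteriorAlgebra.map_apply_ι A v)
    have h2 : ∀ w, ExteriorAlgebra.map A (CliffordAlgebra.ι 0 v * w) =
        ExteriorAlgebra.ι 𝕜 (A v) * ExteriorAlgebra.map A w := fun w => by
      rw [map_mul]
      exact congrArg (· * _) (ExteriorAlgebra.map_apply_ι A v)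
    rw [h1]
    refine (CliffordAlgebra.contractLeft_ι_mul φ (A v) _).trans ?_
    rw [CliffordAlgebra.contractLeft_ι_mul, map_sub, map_smul, h2, ih]
    rfl

/-- The Euler field is invariant under linear maps. -/
theorem contract_radial_pullback (g : EuclideanSpace ℝ (Fin n) →L[ℝ] EuclideanSpace ℝ (Fin n))
    (hg : Set.MapsTo g U V) (ξ : Forms 𝕜 V) :
    contract (radial 𝕜 U) (pullback 𝕜 g hg ξ) = pullback 𝕜 g hg (contract (radial 𝕜 V) ξ) := by
  induction ξ using TensorProduct.induction_on with
  | zero => simp only [map_zero]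
  | add a b ha hb => simp only [map_add, ha, hb]
  | tmul f u =>
    have hφ : ∀ i : Fin n, (LinearMap.proj i : (Fin n → 𝕜) →ₗ[𝕜] 𝕜) ∘ₗ transposeMap 𝕜 g =
        ∑ k, ((g (EuclideanSpace.single i 1) k : ℝ) : 𝕜) •
          (LinearMap.proj k : (Fin n → 𝕜) →ₗ[𝕜] 𝕜) := fun i => by
      ext v
      simp [transposeMap_apply, RCLike.real_smul_eq_coe_mul]
    have hx : ∀ k : Fin n, pullbackFun 𝕜 g hg (coord 𝕜 V k) =
        ∑ i, ((g (EuclideanSpace.single i 1) k : ℝ) : 𝕜) • coord 𝕜 U i := fun k => by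
      ext x
      have hv : (x : EuclideanSpace ℝ (Fin n)) = ∑ i, x.1 i • EuclideanSpace.single i (1 : ℝ) := by
        ext j
        simp [Pi.single_apply]
      rw [AddSubmonoidClass.coe_finsetSum, Finset.sum_apply]
      change ((g x.1 k : ℝ) : 𝕜) = ∑ i, ((g (EuclideanSpace.single i 1) k : ℝ) : 𝕜) * (x.1 i : 𝕜)
      conv_lhs => rw [hv, map_sum]
      simp [mul_comm]
    have hmul : ∀ k, pullbackFun 𝕜 g hg (coord 𝕜 V k * f) =
        pullbackFun 𝕜 g hg (coord 𝕜 V k) * pullbackFun 𝕜 g hg f := fun k => rfl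
    rw [pullback_tmul, contract_eq_sum, contract_eq_sum, map_sum]
    simp only [iota_tmul, smul_tmul_form, radial, pullback_tmul, hmul, hx, contractLeft_map, hφ,
      map_sum, LinearMap.sum_apply, map_smul, LinearMap.smul_apply, TensorProduct.tmul_sum,
      Finset.sum_mul, TensorProduct.sum_tmul, Finset.smul_sum]
    rw [Finset.sum_comm]
    refine Finset.sum_congr rfl fun k _ => Finset.sum_congr rfl fun i _ => ?_
    rw [TensorProduct.tmul_smul, TensorProduct.smul_tmul', smul_mul_assoc]

/-! ### Rotation invariance of `β` -/

section Rotation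

variable {g : EuclideanSpace ℝ (Fin n) ≃ₗᵢ[ℝ] EuclideanSpace ℝ (Fin n)}

theorem mu_isometry (hfix : ∀ (x : EuclideanSpace ℝ (Fin n)) (j : Fin n), m ≤ (j : ℕ) → g x j = x j)
    (x : EuclideanSpace ℝ (Fin n)) : mu hmn (g x) = mu hmn x := by
  have key : ∀ y : EuclideanSpace ℝ (Fin n),
      mu hmn y = ‖y‖ ^ 2 - ∑ i : Fin n, if (i : ℕ) < m then 0 else y i ^ 2 := fun y => by
    rw [mu, EuclideanSpace.real_norm_sq_eq, sum_castLE hmn fun k => y k ^ 2,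
      ← Finset.sum_sub_distrib]
    refine Finset.sum_congr rfl fun i _ => ?_
    split_ifs <;> simp
  rw [key, key, LinearIsometryEquiv.norm_map]
  congr 1
  refine Finset.sum_congr rfl fun i _ => ?_
  split_ifs with hi
  · rfl
  · rw [hfix x i (not_lt.mp hi)]

/-- The images of the vectors `e_j`, `j > m`, under a rotation of `x_1, …, x_m` have no components in
the directions `e_1, …, e_m`. -/
theorem isometry_single (hfix : ∀ (x : EuclideanSpace ℝ (Fin n)) (j : Fin n),
    m ≤ (j : ℕ) → g x j = x j) {j : Fin n} (hj : m ≤ (j : ℕ)) {i : Fin n} (hi : (i : ℕ) < m) :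
    g (EuclideanSpace.single j 1) i = 0 := by
  have h1 : ‖g (EuclideanSpace.single j 1)‖ ^ 2 = 1 := by
    rw [LinearIsometryEquiv.norm_map, PiLp.norm_single, norm_one, one_pow]
  have h2 : g (EuclideanSpace.single j 1) j = 1 := by rw [hfix _ j hj]; simp
  have hij : i ≠ j := by rintro rfl; omega
  rw [EuclideanSpace.real_norm_sq_eq, ← Finset.add_sum_erase _ _ (Finset.mem_univ j), h2, one_pow,
    add_eq_left, Finset.sum_eq_zero_iff_of_nonneg fun i _ => sq_nonneg _] at h1
  exact pow_eq_zero_iff two_ne_zero |>.mp (h1 i (Finset.mem_erase.mpr ⟨hij, Finset.mem_univ i⟩))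

/-- The matrix of a rotation of `x_1, …, x_m` is block triangular with an identity block. -/
theorem det_block_eq_one (hdet : LinearMap.det
      (g.toLinearEquiv : EuclideanSpace ℝ (Fin n) →ₗ[ℝ] EuclideanSpace ℝ (Fin n)) = 1)
    (hfix : ∀ (x : EuclideanSpace ℝ (Fin n)) (j : Fin n), m ≤ (j : ℕ) → g x j = x j) :
    (Matrix.of fun i j : Fin m =>
      g (EuclideanSpace.single (Fin.castLE hmn j) 1) (Fin.castLE hmn i)).det = 1 := by
  set G : Matrix (Fin n) (Fin n) ℝ := Matrix.of fun i j => g (EuclideanSpace.single j 1) i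
  have hG : G.det = 1 := by
    rw [← hdet, ← LinearMap.det_toMatrix (EuclideanSpace.basisFun (Fin n) ℝ).toBasis]
    congr 1
  have hfix' : ∀ i j : Fin n, m ≤ (i : ℕ) → G i j = if i = j then 1 else 0 := fun i j hi => by
    simp [G, hfix _ i hi]
  have h1 := Matrix.twoBlockTriangular_det G (fun i : Fin n => (i : ℕ) < m) fun i hi j hj => by
    rw [hfix' i j (not_lt.mp hi), if_neg (by rintro rfl; exact hi hj)]
  have h2 : G.toSquareBlockProp (fun i : Fin n => ¬(i : ℕ) < m) = 1 := by
    ext i j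
    rw [Matrix.toSquareBlockProp_def, Matrix.of_apply, hfix' _ _ (not_lt.mp i.2),
      Matrix.one_apply]
    simp only [Subtype.ext_iff]
  rw [hG, h2, Matrix.det_one, mul_one] at h1
  let e : Fin m ≃ {i : Fin n // (i : ℕ) < m} :=
    { toFun := fun i => ⟨Fin.castLE hmn i, i.2⟩
      invFun := fun i => ⟨i.1, i.2⟩
      left_inv := fun i => rfl
      right_inv := fun i => rfl }
  exact (Matrix.det_submatrix_equiv_self e _).trans h1.symm

/-- The form `dx_1 ∧ ⋯ ∧ dx_m` is multiplied with the determinant of the block. -/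
theorem map_normalVolume (hdet : LinearMap.det
      (g.toLinearEquiv : EuclideanSpace ℝ (Fin n) →ₗ[ℝ] EuclideanSpace ℝ (Fin n)) = 1)
    (hfix : ∀ (x : EuclideanSpace ℝ (Fin n)) (j : Fin n), m ≤ (j : ℕ) → g x j = x j) :
    ExteriorAlgebra.map (transposeMap 𝕜 (g.toContinuousLinearEquiv :
      EuclideanSpace ℝ (Fin n) →L[ℝ] EuclideanSpace ℝ (Fin n))) (normalVolume 𝕜 hmn) =
      normalVolume 𝕜 hmn := by
  set A := transposeMap 𝕜 (g.toContinuousLinearEquiv :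
      EuclideanSpace ℝ (Fin n) →L[ℝ] EuclideanSpace ℝ (Fin n))
  -- The inclusion of the first `m` coordinates.
  set ext : (Fin m → 𝕜) →ₗ[𝕜] (Fin n → 𝕜) :=
    ∑ i : Fin m, (LinearMap.single 𝕜 (fun _ => 𝕜) (Fin.castLE hmn i)) ∘ₗ LinearMap.proj i
  have hext : ∀ i : Fin m, ext (Pi.basisFun 𝕜 (Fin m) i) = Pi.single (Fin.castLE hmn i) 1 :=
    fun i => by
    simp only [ext, LinearMap.sum_apply, LinearMap.comp_apply, LinearMap.proj_apply,
      Pi.basisFun_apply]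
    rw [Finset.sum_eq_single i]
    · simp
    · intro j _ hj
      simp [hj]
    · simp
  set B : Matrix (Fin m) (Fin m) 𝕜 := Matrix.of fun i j =>
    ((g (EuclideanSpace.single (Fin.castLE hmn j) 1) (Fin.castLE hmn i) : ℝ) : 𝕜)
  have hA : ∀ i : Fin m, A (Pi.single (Fin.castLE hmn i) 1) = ext (B i) := fun i => by
    ext k
    have h1 : A (Pi.single (Fin.castLE hmn i) 1) k =
        ((g (EuclideanSpace.single k 1) (Fin.castLE hmn i) : ℝ) : 𝕜) := by
      rw [transposeMap_apply, Finset.sum_eq_single (Fin.castLE hmn i)]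
      · simp
      · intro j _ hj
        simp [hj]
      · simp
    have h2 : ext (B i) k = ∑ j : Fin m, if k = Fin.castLE hmn j then B i j else 0 := by
      simp only [ext, LinearMap.sum_apply, LinearMap.comp_apply, LinearMap.proj_apply,
        Finset.sum_apply, LinearMap.single_apply, Pi.single_apply]
    rw [h1, h2]
    by_cases hk : (k : ℕ) < m
    · obtain ⟨k, rfl⟩ : ∃ k' : Fin m, k = Fin.castLE hmn k' := ⟨⟨k, hk⟩, rfl⟩
      simp only [(Fin.castLE_injective hmn).eq_iff, Finset.sum_ite_eq, Finset.mem_univ, if_true]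
      rfl
    · rw [isometry_single hfix (not_lt.mp hk) (by rw [Fin.val_castLE]; exact i.2), Finset.sum_eq_zero,
        RCLike.ofReal_zero]
      intro j _
      rw [if_neg]
      rintro rfl
      exact hk j.2
  have hB : B.det = 1 := by
    have h1 := congrArg (fun r : ℝ => (r : 𝕜)) (det_block_eq_one (hmn := hmn) hdet hfix)
    have h2 := RingHom.map_det (algebraMap ℝ 𝕜) (Matrix.of fun i j : Fin m =>
      g (EuclideanSpace.single (Fin.castLE hmn j) 1) (Fin.castLE hmn i))
    rw [← RCLike.algebraMap_eq_ofReal] at h1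
    simp only [h2, map_one] at h1
    exact h1
  have hvol : normalVolume 𝕜 hmn =
      ExteriorAlgebra.ιMulti 𝕜 m fun i => Pi.single (Fin.castLE hmn i) (1 : 𝕜) := by
    rw [ExteriorAlgebra.ιMulti_apply, normalVolume, List.ofFn_eq_map]
    rfl
  rw [hvol, ExteriorAlgebra.map_apply_ιMulti]
  have h3 := alternatingMap_apply_eq_det
    ((ExteriorAlgebra.ιMulti 𝕜 m).compLinearMap ext) fun i => B i
  have h4 : (Matrix.of fun i => B i) = B := rfl
  rw [h4, hB, one_smul, AlternatingMap.compLinearMap_apply, AlternatingMap.compLinearMap_apply] at h3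
  simp only [Function.comp_def, hA]
  refine h3.trans ?_
  simp only [hext]

theorem isRotationInvariant_beta : IsRotationInvariant (beta 𝕜 hmn R) := by
  intro g hdet hfix hg
  rw [beta_eq_contract, ← contract_eq_of_iota fun j hj => iota_invariantVolume hj,
    ← contract_radial_pullback, invariantVolume, pullback_tmul, map_normalVolume hdet hfix]
  congr 3
  ext x
  change (((mu hmn (g x.1))⁻¹ : ℝ) : 𝕜) ^ (m / 2) = (((mu hmn x.1)⁻¹ : ℝ) : 𝕜) ^ (m / 2)
  rw [mu_isometry hfix]

end Rotation
end Pullback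

/-! ### Bases of the invariant forms -/

section Bases

variable {𝕜 : Type*} [RCLike 𝕜] {n m : ℕ} {hmn : m ≤ n} {R : ℝ} {ξ : Forms 𝕜 (compl hmn R)}

theorem isInvariant_zero : IsInvariant (0 : Forms 𝕜 (compl hmn R)) where
  mem := zero_mem _
  radial := map_zero _
  coeffDeriv _ _ := map_zero _
  iota _ _ := map_zero _
  rotation _ _ := map_zero _

theorem IsInvariant.sum {ι : Type*} (s : Finset ι) {F : ι → Forms 𝕜 (compl hmn R)}
    (h : ∀ i ∈ s, IsInvariant (F i)) : IsInvariant (∑ i ∈ s, F i) :=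
  Finset.sum_induction F IsInvariant (fun _ _ => IsInvariant.add) isInvariant_zero h

theorem isInvariant_one : IsInvariant (1 : Forms 𝕜 (compl hmn R)) := by
  have hD : ∀ j : Fin n, coeffDeriv j (1 : Forms 𝕜 (compl hmn R)) = 0 := fun j =>
    (coeffDeriv_ofFun j 1).trans (by rw [pderiv_one]; exact TensorProduct.zero_tmul _ _)
  have hI : ∀ j : Fin n, iota j (1 : Forms 𝕜 (compl hmn R)) = 0 := fun j => iota_ofFun j 1
  have hL : ∀ V : Fin n → Smooth 𝕜 (compl hmn R), lieDeriv V (1 : Forms 𝕜 (compl hmn R)) = 0 :=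
    fun V => by
      rw [lieDeriv_eq_sum, Finset.sum_eq_zero fun k _ => by rw [hD, smul_zero],
        Finset.sum_eq_zero fun k _ => Finset.sum_eq_zero fun l _ => by
          rw [hI, map_zero, smul_zero], add_zero]
  exact ⟨one_mem _, hL _, fun j _ => hD j, fun j _ => hI j, fun i j => hL _⟩

theorem isInvariant_invariantVolume (hm : Even m) :
    IsInvariant (invariantVolume 𝕜 hmn R) where
  mem := invariantVolume_mem_poleForms
  radial := lieDeriv_radial_invariantVolume hm
  coeffDeriv j hj := by
    rw [invariantVolume, coeffDeriv_tmul, pderiv_eq_dirDeriv, dirDeriv_pow_eq_zero,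
      TensorProduct.zero_tmul]
    rw [← pderiv_eq_dirDeriv, pderiv_muInv_of_le hj]
  iota j hj := iota_invariantVolume hj
  rotation i j := by
    have h1 : dirDeriv (rotation 𝕜 _ (Fin.castLE hmn i) (Fin.castLE hmn j))
        (muInv 𝕜 hmn R ^ (m / 2)) = 0 := by
      refine dirDeriv_pow_eq_zero ?_ _
      have h : dirDeriv (rotation 𝕜 _ (Fin.castLE hmn i) (Fin.castLE hmn j))
          (muFun 𝕜 hmn (compl hmn R)) = (0 : 𝕜) • muFun 𝕜 hmn _ := by
        rw [dirDeriv_rotation_muFun hmn i.2 j.2, zero_smul]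
      rw [dirDeriv_muInv h, zero_smul, neg_zero]
    rcases eq_or_ne i j with rfl | hij
    · rw [lieDeriv_rotation]
      abel
    have h2 : ∀ a b : Fin m, a ≠ b → wedge (Fin.castLE hmn a) (LocalDeRham.iota
        (Fin.castLE hmn b) (invariantVolume 𝕜 hmn R)) = 0 := fun a b hab => by
      have h := iota_wedge_of_ne (fun e => hab (Fin.castLE_injective hmn e).symm)
        (invariantVolume 𝕜 hmn R)
      rw [wedge_invariantVolume (by rw [Fin.val_castLE]; exact a.2), map_zero] at h
      exact neg_eq_zero.mp h.symm
    rw [dirDeriv_rotation] at h1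
    rw [lieDeriv_rotation, h2 i j hij, h2 j i hij.symm, invariantVolume, coeffDeriv_tmul,
      coeffDeriv_tmul, smul_tmul_form, smul_tmul_form, sub_zero, add_zero,
      ← TensorProduct.sub_tmul, h1, TensorProduct.zero_tmul]

theorem isInvariant_alpha : IsInvariant (alpha 𝕜 hmn R) := by
  have h := (isInvariant_one (𝕜 := 𝕜) (hmn := hmn) (R := R)).alpha_mul
  rwa [mul_one] at h

theorem isInvariant_beta (hm : Even m) : IsInvariant (beta 𝕜 hmn R) := by
  rw [beta_eq_contract]
  exact (isInvariant_invariantVolume hm).contract_euler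

/-- For even `m` the invariant forms are the combinations of `1`, `α`, `β` and `αβ`. -/
theorem IsInvariant.exists_eq_of_even (hm : 1 ≤ m) (heven : Even m) (hR : 0 < R)
    (hξ : IsInvariant ξ) : ∃ a b c e : 𝕜, ξ = a • 1 + b • alpha 𝕜 hmn R + c • beta 𝕜 hmn R +
      e • (alpha 𝕜 hmn R * beta 𝕜 hmn R) := by
  have key : ∀ ζ : Forms 𝕜 (compl hmn R), IsInvariant ζ → contract (euler 𝕜 m _) ζ = 0 →
      ∃ a b : 𝕜, ζ = a • 1 + b • beta 𝕜 hmn R := fun ζ hζ hE => by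
    obtain ⟨a, h | ⟨hm2, h, hh, hd, e⟩⟩ := hζ.exists_eq_add_contract hm hR hE
    · exact ⟨a, 0, by rw [h, zero_smul, add_zero]⟩
    · obtain ⟨b, hb⟩ := exists_muFun_pow_mul_pow_eq hm hR hh hd (a := m / 2) (b := 1)
        (by rw [mul_one, Nat.two_mul_div_two_of_even heven])
      refine ⟨a, b, ?_⟩
      have h1 : h = b • muInv 𝕜 hmn R ^ (m / 2) := by
        have h2 := congrArg (fun g => muInv 𝕜 hmn R ^ (m / 2) * g) hb
        simp only [← mul_assoc, mul_smul_comm, mul_one, pow_one] at h2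
        rwa [mul_comm (muInv 𝕜 hmn R ^ (m / 2)), muFun_pow_mul_muInv_pow, one_mul] at h2
      rw [e, h1, ← TensorProduct.smul_tmul', map_smul, beta_eq_contract]
      rfl
  obtain ⟨ξ₀, ξ₁, h₀, h₁, hE₀, hE₁, e⟩ := hξ.exists_eq_alpha_mul_add
  obtain ⟨a, c, rfl⟩ := key ξ₀ h₀ hE₀
  obtain ⟨b, e', rfl⟩ := key ξ₁ h₁ hE₁
  refine ⟨a, b, c, e', ?_⟩
  rw [e, mul_add, mul_smul_comm, mul_smul_comm, mul_one]
  abel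

theorem smul_one_eq_zero (hm : 1 ≤ m) (hR : 0 < R) {c : 𝕜}
    (h : c • (1 : Forms 𝕜 (compl hmn R)) = 0) : c = 0 := by
  have h1 := congrArg scalarPart h
  rw [map_smul, map_zero, show (1 : Forms 𝕜 (compl hmn R)) = Forms.ofFun 1 from rfl,
    scalarPart_ofFun] at h1
  have h2 := congrArg (fun g : Smooth 𝕜 (compl hmn R) => g.1 ⟨_, basePoint_mem hm hR⟩) h1
  have h3 : c * 1 = 0 := h2
  rwa [mul_one] at h3

theorem contract_one : contract (euler 𝕜 m _) (1 : Forms 𝕜 (compl hmn R)) = 0 := by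
  rw [contract_eq_sum]
  exact Finset.sum_eq_zero fun i _ => (congrArg _ (iota_ofFun i 1)).trans (smul_zero _)

theorem contract_alpha : contract (euler 𝕜 m _) (alpha 𝕜 hmn R) = (2 : 𝕜) • 1 := by
  have h := contract_alpha_mul (1 : Forms 𝕜 (compl hmn R))
  rwa [contract_one, mul_zero, sub_zero, mul_one] at h

theorem smul_one_add_smul_alpha_eq_zero (hm : 1 ≤ m) (hR : 0 < R) {a b : 𝕜}
    (h : a • 1 + b • alpha 𝕜 hmn R = 0) : a = 0 ∧ b = 0 := by
  have h1 := congrArg (contract (euler 𝕜 m _)) h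
  rw [map_add, map_smul, map_smul, contract_one, smul_zero, zero_add, contract_alpha, smul_smul,
    map_zero] at h1
  have hb := (mul_eq_zero.mp (smul_one_eq_zero hm hR h1)).resolve_right two_ne_zero
  rw [hb, zero_smul, add_zero] at h
  exact ⟨smul_one_eq_zero hm hR h, hb⟩

/-- Compare the components of degree zero, which is not the degree of `β`; then multiply with `α`. -/
theorem smul_one_add_smul_beta_eq_zero (hm : 2 ≤ m) (hR : 0 < R) {a b : 𝕜}
    (h : a • 1 + b • beta 𝕜 hmn R = 0) : a = 0 ∧ b = 0 := by
  have hm1 : 1 ≤ m := by omega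
  have h1 : scalarPart (beta 𝕜 hmn R) = 0 := by
    have h2 := congrArg scalarPart (degreeOp_of_mem_degree (beta_mem_degree (𝕜 := 𝕜) (hmn := hmn)
      (R := R)))
    rw [scalarPart_degreeOp, map_smul] at h2
    exact (smul_eq_zero.mp h2.symm).resolve_left (Nat.cast_ne_zero.mpr (by omega))
  have ha : a = 0 := by
    have h2 := congrArg scalarPart h
    rw [map_add, map_smul, map_smul, h1, smul_zero, add_zero, map_zero] at h2
    refine smul_one_eq_zero (hmn := hmn) hm1 hR (?_ : a • Forms.ofFun 1 = 0)
    rw [smul_ofFun]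
    rw [show (1 : Forms 𝕜 (compl hmn R)) = Forms.ofFun 1 from rfl, scalarPart_ofFun] at h2
    rw [h2]
    exact TensorProduct.zero_tmul _ _
  refine ⟨ha, ?_⟩
  rw [ha, zero_smul, zero_add] at h
  have h2 := congrArg (fun ζ => alpha 𝕜 hmn R * ζ) h
  simp only [mul_smul_comm, mul_zero, alpha_mul_beta_eq_smul, smul_smul] at h2
  rw [invariantVolume, TensorProduct.smul_tmul'] at h2
  have h3 := congrArg (fun g => muFun 𝕜 hmn (compl hmn R) ^ (m / 2) * g)
    (tmul_normalVolume_eq_zero hmn h2)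
  simp only [mul_smul_comm, mul_zero, muFun_pow_mul_muInv_pow] at h3
  have h4 : (b * 2) • (1 : Forms 𝕜 (compl hmn R)) = 0 := by
    refine (smul_ofFun (b * 2) 1).trans ?_
    rw [h3]
    exact TensorProduct.zero_tmul _ _
  exact (mul_eq_zero.mp (smul_one_eq_zero hm1 hR h4)).resolve_right two_ne_zero

/-- Contract with the normal Euler field to separate the terms with `α` from the others. -/
theorem linear_combination_eq_zero_of_even (hm : 2 ≤ m) (hR : 0 < R) {a b c e : 𝕜}
    (h : a • 1 + b • alpha 𝕜 hmn R + c • beta 𝕜 hmn R +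
      e • (alpha 𝕜 hmn R * beta 𝕜 hmn R) = 0) : a = 0 ∧ b = 0 ∧ c = 0 ∧ e = 0 := by
  have h1 := congrArg (contract (euler 𝕜 m _)) h
  simp only [map_add, map_smul, map_zero, contract_one, contract_alpha, contract_beta,
    contract_alpha_mul, mul_zero, smul_zero, add_zero, zero_add, sub_zero, smul_smul] at h1
  obtain ⟨hb, he⟩ := smul_one_add_smul_beta_eq_zero hm hR h1
  have hb' := (mul_eq_zero.mp hb).resolve_right two_ne_zero
  have he' := (mul_eq_zero.mp he).resolve_right two_ne_zero
  rw [hb', he', zero_smul, zero_smul, add_zero, add_zero] at h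
  obtain ⟨ha, hc⟩ := smul_one_add_smul_beta_eq_zero hm hR h
  exact ⟨ha, hb', hc, he'⟩

end Bases

/-! ### The cohomology algebra -/

section CohomologyAlgebra

variable {𝕜 : Type*} [RCLike 𝕜] {n m : ℕ} {hmn : m ≤ n} {R : ℝ}

/-- The product of generators of an exterior algebra along a list of indices. -/
def generatorProd (𝕜 : Type*) [RCLike 𝕜] {r : ℕ} (l : List (Fin r)) :
    ExteriorAlgebra 𝕜 (Fin r → 𝕜) :=
  (l.map fun i => ExteriorAlgebra.ι 𝕜 (Pi.single i (1 : 𝕜))).prod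

theorem list_prod_mem_degree {r : ℕ} {w : Fin r → ℕ} {τ : Fin r → Forms 𝕜 (compl hmn R)}
    (hw : ∀ i, τ i ∈ Forms.degree 𝕜 (compl hmn R) (w i)) (l : List (Fin r)) :
    (l.map τ).prod ∈ Forms.degree 𝕜 (compl hmn R) (l.map w).sum := by
  induction l with
  | nil => exact tmul_mem_degree 1 SetLike.GradedOne.one_mem
  | cons i l ih =>
    simp only [List.map_cons, List.prod_cons, List.sum_cons]
    exact mul_mem_degree (hw i) ih

/-- Closed forms `τ_i` whose combinations have square zero define a homomorphism from the exterior
algebra to the closed forms. -/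
theorem exists_algHom_closedForms {r : ℕ} (τ : Fin r → Forms 𝕜 (compl hmn R))
    (hτ : ∀ i, τ i ∈ ClosedForms 𝕜 hmn R)
    (hsq : ∀ v : Fin r → 𝕜, (∑ i, v i • τ i) * (∑ i, v i • τ i) = 0) :
    ∃ L : ExteriorAlgebra 𝕜 (Fin r → 𝕜) →ₐ[𝕜] ClosedForms 𝕜 hmn R,
      (∀ i, L (ExteriorAlgebra.ι 𝕜 (Pi.single i 1)) = ⟨τ i, hτ i⟩) ∧
      ∀ l : List (Fin r), (L (generatorProd 𝕜 l)).1 = (l.map τ).prod := by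
  set f : (Fin r → 𝕜) →ₗ[𝕜] ClosedForms 𝕜 hmn R :=
    ∑ i, (LinearMap.proj i : (Fin r → 𝕜) →ₗ[𝕜] 𝕜).smulRight (⟨τ i, hτ i⟩ : ClosedForms 𝕜 hmn R)
  have hf : ∀ v, (f v).1 = ∑ i, v i • τ i := fun v => by
    simp only [f, LinearMap.sum_apply, LinearMap.smulRight_apply, LinearMap.proj_apply,
      AddSubmonoidClass.coe_finsetSum]
    rfl
  have hff : ∀ v, f v * f v = 0 := fun v => Subtype.ext (by
    refine Eq.trans ?_ (hsq v)
    rw [← hf]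
    rfl)
  have hι : ∀ i, ExteriorAlgebra.lift 𝕜 ⟨f, hff⟩ (ExteriorAlgebra.ι 𝕜 (Pi.single i 1)) =
      ⟨τ i, hτ i⟩ := fun i => by
    refine (ExteriorAlgebra.lift_ι_apply 𝕜 f hff _).trans (Subtype.ext ?_)
    rw [hf, Finset.sum_eq_single i]
    · rw [Pi.single_eq_same, one_smul]
    · intro j _ hj
      rw [Pi.single_eq_of_ne hj, zero_smul]
    · exact fun h => absurd (Finset.mem_univ i) h
  refine ⟨ExteriorAlgebra.lift 𝕜 ⟨f, hff⟩, hι, fun l => ?_⟩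
  induction l with
  | nil => exact congrArg Subtype.val (map_one (ExteriorAlgebra.lift 𝕜 ⟨f, hff⟩))
  | cons i l ih =>
    rw [generatorProd, List.map_cons, List.prod_cons, map_mul, hι, List.map_cons, List.prod_cons,
      ← ih]
    rfl

/-- A closed form of degree `k` that is cohomologous to a combination of forms `ζ_s` of degrees
`N_s` is cohomologous to zero after weighting the coefficients with `N_s - k`. -/
theorem exists_d_eq_sum_sub_smul {S : Type*} [Fintype S] {ζ : S → Forms 𝕜 (compl hmn R)}
    {N : S → ℕ} (hN : ∀ s, ζ s ∈ Forms.degree 𝕜 (compl hmn R) (N s)) {c : S → 𝕜} {k : ℕ}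
    {ξ θ : Forms 𝕜 (compl hmn R)} (hξ : ξ ∈ Forms.degree 𝕜 (compl hmn R) k)
    (hθ : θ ∈ PoleForms 𝕜 hmn R) (h : d 𝕜 _ θ = ∑ s, c s • ζ s - ξ) :
    ∃ θ' ∈ PoleForms 𝕜 hmn R, d 𝕜 _ θ' = ∑ s, (((N s : 𝕜) - k) * c s) • ζ s := by
  -- `𝒩 - k` annihilates `ξ`, and `(𝒩 - k) dθ = d (𝒩 + 1 - k) θ`.
  refine ⟨degreeOp θ + θ - (k : 𝕜) • θ, sub_mem (add_mem (degreeOp_mem_poleForms hθ) hθ)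
    (Subalgebra.smul_mem _ hθ _), ?_⟩
  have h1 : degreeOp (d 𝕜 (compl hmn R) θ) - (k : 𝕜) • d 𝕜 (compl hmn R) θ =
      ∑ s, (((N s : 𝕜) - k) * c s) • ζ s := by
    rw [h, map_sub, map_sum, degreeOp_of_mem_degree hξ, smul_sub, sub_sub_sub_cancel_right,
      Finset.smul_sum, ← Finset.sum_sub_distrib]
    refine Finset.sum_congr rfl fun s _ => ?_
    rw [map_smul, degreeOp_of_mem_degree (hN s), sub_mul, sub_smul, mul_smul, mul_smul,
      smul_comm (c s)]
  rw [← h1, map_sub, map_add, map_smul, degreeOp_d]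

theorem exists_mk_eq_of_mem_cohomology_degree {k : ℕ} {x : Cohomology 𝕜 hmn R}
    (h : x ∈ Cohomology.degree 𝕜 hmn R k) :
    ∃ ξ : ClosedForms 𝕜 hmn R, ξ.1 ∈ Forms.degree 𝕜 (compl hmn R) k ∧
      Ideal.Quotient.mkₐ 𝕜 (ExactForms 𝕜 hmn R) ξ = x :=
  Submodule.mem_map.mp h

theorem mk_mem_cohomology_degree {k : ℕ} {ξ : ClosedForms 𝕜 hmn R}
    (h : ξ.1 ∈ Forms.degree 𝕜 (compl hmn R) k) :
    Ideal.Quotient.mkₐ 𝕜 (ExactForms 𝕜 hmn R) ξ ∈ Cohomology.degree 𝕜 hmn R k :=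
  Submodule.mem_map.mpr ⟨ξ, h, rfl⟩

set_option maxHeartbeats 800000 in
/-- If the invariant forms have a basis that consists of products of closed forms `τ_i` which
generate an exterior algebra, then the cohomology is the exterior algebra on the classes of the
`τ_i`. -/
theorem exists_algEquiv_cohomology (hm : 1 ≤ m) (hR : 0 < R) {r : ℕ} (w : Fin r → ℕ)
    (τ : Fin r → Forms 𝕜 (compl hmn R)) (hτ : ∀ i, τ i ∈ ClosedForms 𝕜 hmn R)
    (hw : ∀ i, τ i ∈ Forms.degree 𝕜 (compl hmn R) (w i))
    (hsq : ∀ v : Fin r → 𝕜, (∑ i, v i • τ i) * (∑ i, v i • τ i) = 0)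
    {S : Type*} [Fintype S] (l : S → List (Fin r))
    (hspan : ∀ z : ExteriorAlgebra 𝕜 (Fin r → 𝕜), ∃ c : S → 𝕜,
      z = ∑ s, c s • generatorProd 𝕜 (l s))
    (hli : ∀ c : S → 𝕜, ∑ s, c s • ((l s).map τ).prod = 0 → ∀ s, c s = 0)
    (hinv : ∀ s, IsInvariant ((l s).map τ).prod)
    (hall : ∀ ξ : Forms 𝕜 (compl hmn R), IsInvariant ξ → ∃ c : S → 𝕜,
      ξ = ∑ s, c s • ((l s).map τ).prod) :
    ∃ e : ExteriorAlgebra 𝕜 (Fin r → 𝕜) ≃ₐ[𝕜] Cohomology 𝕜 hmn R,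
      (∀ i, e (ExteriorAlgebra.ι 𝕜 (Pi.single i 1)) = cohomologyClass (τ i) (hτ i)) ∧
      ∀ k : ℕ, (exteriorDegree 𝕜 w k).map e.toLinearMap = Cohomology.degree 𝕜 hmn R k := by
  obtain ⟨L, hLι, hLprod⟩ := exists_algHom_closedForms τ hτ hsq
  have hLsum : ∀ c : S → 𝕜, (L (∑ s, c s • generatorProd 𝕜 (l s))).1 =
      ∑ s, c s • ((l s).map τ).prod := fun c => by
    rw [map_sum, AddSubmonoidClass.coe_finsetSum]
    refine Finset.sum_congr rfl fun s _ => ?_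
    rw [map_smul, ← hLprod]
    rfl
  have hclosed : ∀ c : S → 𝕜, d 𝕜 _ (∑ s, c s • ((l s).map τ).prod) = 0 := fun c => by
    rw [← hLsum]
    exact (L _).2.2
  -- An exact combination is `d` of an invariant form, and these are closed.
  have hexact : ∀ c : S → 𝕜, (∃ θ ∈ PoleForms 𝕜 hmn R, d 𝕜 _ θ = ∑ s, c s • ((l s).map τ).prod) →
      ∀ s, c s = 0 := by
    rintro c ⟨θ, hθ, e⟩
    have hi : IsInvariant (∑ s, c s • ((l s).map τ).prod) :=
      IsInvariant.sum _ fun s _ => (hinv s).smul (c s)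
    obtain ⟨θ', hθ', e'⟩ := hi.exists_d_eq hm hR hθ e
    obtain ⟨c', rfl⟩ := hall θ' hθ'
    rw [hclosed] at e'
    exact hli c e'.symm
  set E : ExteriorAlgebra 𝕜 (Fin r → 𝕜) →ₐ[𝕜] Cohomology 𝕜 hmn R :=
    (Ideal.Quotient.mkₐ 𝕜 (ExactForms 𝕜 hmn R)).comp L
  have hE : ∀ z (y : ClosedForms 𝕜 hmn R), E z = Ideal.Quotient.mkₐ 𝕜 (ExactForms 𝕜 hmn R) y ↔
      ∃ θ ∈ PoleForms 𝕜 hmn R, d 𝕜 _ θ = (L z).1 - y.1 := fun z y => Ideal.Quotient.eq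
  have hinj : Function.Injective E := by
    rw [injective_iff_map_eq_zero]
    intro z hz
    obtain ⟨θ, hθ, e⟩ := Ideal.Quotient.eq_zero_iff_mem.mp hz
    obtain ⟨c, rfl⟩ := hspan z
    exact Finset.sum_eq_zero fun s _ => by rw [hexact c ⟨θ, hθ, e.trans (hLsum c)⟩ s, zero_smul]
  have hsurj : Function.Surjective E := by
    intro x
    obtain ⟨ξ, rfl⟩ := Ideal.Quotient.mk_surjective x
    obtain ⟨θ, hθ, hi⟩ := exists_isInvariant_sub_d hm hR ξ.2.1 ξ.2.2
    obtain ⟨c, hc⟩ := hall _ hi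
    refine ⟨∑ s, c s • generatorProd 𝕜 (l s), (hE _ _).mpr ⟨-θ, neg_mem hθ, ?_⟩⟩
    rw [hLsum, ← hc, map_neg]
    abel
  have hdeg : ∀ l' : List (Fin r),
      E (generatorProd 𝕜 l') ∈ Cohomology.degree 𝕜 hmn R (l'.map w).sum := fun l' => by
    have h : (L (generatorProd 𝕜 l')).1 ∈ Forms.degree 𝕜 (compl hmn R) (l'.map w).sum := by
      rw [hLprod]
      exact list_prod_mem_degree hw l'
    exact mk_mem_cohomology_degree h
  have hmem : ∀ {k : ℕ} {ξ : ClosedForms 𝕜 hmn R} {z}, ξ.1 ∈ Forms.degree 𝕜 (compl hmn R) k →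
      E z = Ideal.Quotient.mkₐ 𝕜 (ExactForms 𝕜 hmn R) ξ → z ∈ exteriorDegree 𝕜 w k := by
    intro k ξ z hξ hz
    obtain ⟨θ, hθ, e⟩ := (hE _ _).mp hz
    obtain ⟨c, rfl⟩ := hspan z
    rw [hLsum] at e
    obtain ⟨θ', hθ', e'⟩ := exists_d_eq_sum_sub_smul (fun s => list_prod_mem_degree hw (l s)) hξ hθ e
    have h3 := hexact _ ⟨θ', hθ', e'⟩
    refine sum_mem fun s _ => ?_
    rcases mul_eq_zero.mp (h3 s) with h | h
    · exact Submodule.smul_mem _ _ (Submodule.subset_span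
        ⟨l s, by exact_mod_cast sub_eq_zero.mp h, rfl⟩)
    · rw [h, zero_smul]
      exact zero_mem _
  have hEι : ∀ i, E (ExteriorAlgebra.ι 𝕜 (Pi.single i 1)) = cohomologyClass (τ i) (hτ i) :=
    fun i => congrArg (Ideal.Quotient.mkₐ 𝕜 (ExactForms 𝕜 hmn R)) (hLι i)
  clear_value E
  refine ⟨AlgEquiv.ofBijective E ⟨hinj, hsurj⟩, fun i => ?_, fun k => le_antisymm ?_ ?_⟩
  · exact hEι i
  · rw [Submodule.map_le_iff_le_comap, exteriorDegree, Submodule.span_le]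
    rintro z ⟨l', hl, rfl⟩
    exact hl ▸ hdeg l'
  · intro x hx
    obtain ⟨ξ, hξ, rfl⟩ := exists_mk_eq_of_mem_cohomology_degree hx
    obtain ⟨z, hz⟩ := hsurj (Ideal.Quotient.mkₐ 𝕜 (ExactForms 𝕜 hmn R) ξ)
    exact ⟨z, hmem hξ hz, hz⟩

end CohomologyAlgebra

/-! ### Exterior algebras on one and on two generators -/

section Generators

variable {𝕜 : Type*} [RCLike 𝕜]

theorem ι_eq_sum_single {r : ℕ} (v : Fin r → 𝕜) : ExteriorAlgebra.ι 𝕜 v =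
    ∑ i, v i • ExteriorAlgebra.ι 𝕜 (Pi.single i (1 : 𝕜)) :=
  ι_eq_sum_dx v

theorem exists_eq_generatorProd_of_fin_one (z : ExteriorAlgebra 𝕜 (Fin 1 → 𝕜)) :
    ∃ c : Fin 2 → 𝕜, z = ∑ s, c s • generatorProd 𝕜 ((![[], [0]] : Fin 2 → List (Fin 1)) s) := by
  set t : ExteriorAlgebra 𝕜 (Fin 1 → 𝕜) := ExteriorAlgebra.ι 𝕜 (Pi.single 0 (1 : 𝕜)) with ht
  have h00 : t * t = 0 := ExteriorAlgebra.ι_sq_zero _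
  have hsum : ∀ c : Fin 2 → 𝕜, ∑ s, c s • generatorProd 𝕜 ((![[], [0]] : Fin 2 → List (Fin 1)) s) =
      c 0 • 1 + c 1 • t := fun c => by
    simp [Fin.sum_univ_two, generatorProd, ht]
  simp only [hsum]
  induction z using CliffordAlgebra.left_induction with
  | algebraMap a => exact ⟨![a, 0], by simp [Algebra.algebraMap_eq_smul_one]⟩
  | add x y hx hy =>
    obtain ⟨c, rfl⟩ := hx
    obtain ⟨c', rfl⟩ := hy
    exact ⟨c + c', by simp only [Pi.add_apply]; module⟩
  | ι_mul x v hx =>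
    obtain ⟨c, rfl⟩ := hx
    refine ⟨![0, v 0 * c 0], ?_⟩
    have hv : CliffordAlgebra.ι (0 : QuadraticForm 𝕜 (Fin 1 → 𝕜)) v = v 0 • t :=
      (ι_eq_sum_single v).trans (Fin.sum_univ_one _)
    rw [hv, mul_add, smul_mul_smul_comm, smul_mul_smul_comm, h00, mul_one]
    simp

theorem exists_eq_generatorProd_of_fin_two (z : ExteriorAlgebra 𝕜 (Fin 2 → 𝕜)) :
    ∃ c : Fin 4 → 𝕜, z =
      ∑ s, c s • generatorProd 𝕜 ((![[], [0], [1], [0, 1]] : Fin 4 → List (Fin 2)) s) := by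
  set t : ExteriorAlgebra 𝕜 (Fin 2 → 𝕜) := ExteriorAlgebra.ι 𝕜 (Pi.single 0 (1 : 𝕜)) with ht
  set u : ExteriorAlgebra 𝕜 (Fin 2 → 𝕜) := ExteriorAlgebra.ι 𝕜 (Pi.single 1 (1 : 𝕜)) with hu
  have htt : t * t = 0 := ExteriorAlgebra.ι_sq_zero _
  have huu : u * u = 0 := ExteriorAlgebra.ι_sq_zero _
  have hut : u * t = -(t * u) := eq_neg_of_add_eq_zero_left (ExteriorAlgebra.ι_add_mul_swap _ _)
  have hsum : ∀ c : Fin 4 → 𝕜,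
      ∑ s, c s • generatorProd 𝕜 ((![[], [0], [1], [0, 1]] : Fin 4 → List (Fin 2)) s) =
      c 0 • 1 + c 1 • t + c 2 • u + c 3 • (t * u) := fun c => by
    simp [Fin.sum_univ_four, generatorProd, ht, hu]
  simp only [hsum]
  induction z using CliffordAlgebra.left_induction with
  | algebraMap a => exact ⟨![a, 0, 0, 0], by simp [Algebra.algebraMap_eq_smul_one]⟩
  | add x y hx hy =>
    obtain ⟨c, rfl⟩ := hx
    obtain ⟨c', rfl⟩ := hy
    exact ⟨c + c', by simp only [Pi.add_apply]; module⟩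
  | ι_mul x v hx =>
    obtain ⟨c, rfl⟩ := hx
    refine ⟨![0, v 0 * c 0, v 1 * c 0, v 0 * c 2 - v 1 * c 1], ?_⟩
    have hv : CliffordAlgebra.ι (0 : QuadraticForm 𝕜 (Fin 2 → 𝕜)) v = v 0 • t + v 1 • u :=
      (ι_eq_sum_single v).trans (Fin.sum_univ_two _)
    have h1 : t * (t * u) = 0 := by rw [← mul_assoc, htt, zero_mul]
    have h2 : u * (t * u) = 0 := by rw [← mul_assoc, hut, neg_mul, mul_assoc, huu, mul_zero, neg_zero]
    rw [hv]
    simp only [add_mul, mul_add, smul_mul_smul_comm, htt, huu, hut, h1, h2, mul_one, smul_zero,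
      smul_neg, Matrix.cons_val]
    module

end Generators

/-! ### The cohomology for odd and for even `m` -/

section CohomologyRing

variable {𝕜 : Type*} [RCLike 𝕜] {n m : ℕ} {hmn : m ≤ n} {R : ℝ}

theorem exists_algEquiv_cohomology_of_odd (hm : 1 ≤ m) (hodd : Odd m) (hR : 0 < R) :
    ∃ e : ExteriorAlgebra 𝕜 (Fin 1 → 𝕜) ≃ₐ[𝕜] Cohomology 𝕜 hmn R,
      e (ExteriorAlgebra.ι 𝕜 (Pi.single 0 1)) =
        cohomologyClass (alpha 𝕜 hmn R) alpha_mem_closedForms ∧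
      ∀ k : ℕ, (exteriorDegree 𝕜 ![1] k).map e.toLinearMap = Cohomology.degree 𝕜 hmn R k := by
  set τ : Fin 1 → Forms 𝕜 (compl hmn R) := ![alpha 𝕜 hmn R]
  set l : Fin 2 → List (Fin 1) := ![[], [0]]
  have h1 : ((l 0).map τ).prod = 1 := rfl
  have hα : ((l 1).map τ).prod = alpha 𝕜 hmn R := List.prod_singleton
  have hsum : ∀ c : Fin 2 → 𝕜, ∑ s, c s • ((l s).map τ).prod = c 0 • 1 + c 1 • alpha 𝕜 hmn R :=
    fun c => by rw [Fin.sum_univ_two, h1, hα]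
  have hαα : alpha 𝕜 hmn R * alpha 𝕜 hmn R = 0 :=
    mul_self_of_mem_degree_odd odd_one alpha_mem_degree
  obtain ⟨e, he, hdeg⟩ := exists_algEquiv_cohomology hm hR ![1] τ
    (fun i => by fin_cases i; exact alpha_mem_closedForms)
    (fun i => by fin_cases i; exact alpha_mem_degree)
    (fun v => by
      rw [Fin.sum_univ_one]
      change v 0 • alpha 𝕜 hmn R * v 0 • alpha 𝕜 hmn R = 0
      rw [smul_mul_smul_comm, hαα, smul_zero])
    l exists_eq_generatorProd_of_fin_one
    (fun c h => by
      obtain ⟨h0, h1⟩ := smul_one_add_smul_alpha_eq_zero hm hR ((hsum c).symm.trans h)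
      intro s
      fin_cases s
      exacts [h0, h1])
    (Fin.forall_fin_two.mpr ⟨isInvariant_one, hα.symm ▸ isInvariant_alpha⟩)
    (fun ξ hξ => by
      obtain ⟨a, b, h⟩ := hξ.exists_eq_of_odd hm hodd hR
      exact ⟨![a, b], by rw [hsum]; exact h⟩)
  exact ⟨e, he 0, hdeg⟩

theorem exists_algEquiv_cohomology_of_even (hm : 1 ≤ m) (heven : Even m) (hR : 0 < R) :
    ∃ e : ExteriorAlgebra 𝕜 (Fin 2 → 𝕜) ≃ₐ[𝕜] Cohomology 𝕜 hmn R,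
      e (ExteriorAlgebra.ι 𝕜 (Pi.single 0 1)) =
        cohomologyClass (alpha 𝕜 hmn R) alpha_mem_closedForms ∧
      e (ExteriorAlgebra.ι 𝕜 (Pi.single 1 1)) =
        cohomologyClass (beta 𝕜 hmn R) (beta_mem_closedForms heven) ∧
      ∀ k : ℕ, (exteriorDegree 𝕜 ![1, m - 1] k).map e.toLinearMap =
        Cohomology.degree 𝕜 hmn R k := by
  have hm2 : 2 ≤ m := by
    obtain ⟨p, rfl⟩ := heven
    omega
  have hodd : Odd (m - 1) := Nat.Even.sub_odd hm heven odd_one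
  set τ : Fin 2 → Forms 𝕜 (compl hmn R) := ![alpha 𝕜 hmn R, beta 𝕜 hmn R]
  set l : Fin 4 → List (Fin 2) := ![[], [0], [1], [0, 1]]
  have h1 : ((l 0).map τ).prod = 1 := rfl
  have hα : ((l 1).map τ).prod = alpha 𝕜 hmn R := List.prod_singleton
  have hβ : ((l 2).map τ).prod = beta 𝕜 hmn R := List.prod_singleton
  have hαβ' : ((l 3).map τ).prod = alpha 𝕜 hmn R * beta 𝕜 hmn R := List.prod_pair
  have hsum : ∀ c : Fin 4 → 𝕜, ∑ s, c s • ((l s).map τ).prod = c 0 • 1 + c 1 • alpha 𝕜 hmn R +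
      c 2 • beta 𝕜 hmn R + c 3 • (alpha 𝕜 hmn R * beta 𝕜 hmn R) :=
    fun c => by rw [Fin.sum_univ_four, h1, hα, hβ, hαβ']
  have hαα : alpha 𝕜 hmn R * alpha 𝕜 hmn R = 0 :=
    mul_self_of_mem_degree_odd odd_one alpha_mem_degree
  have hββ : beta 𝕜 hmn R * beta 𝕜 hmn R = 0 :=
    mul_self_of_mem_degree_odd hodd beta_mem_degree
  have hαβ : alpha 𝕜 hmn R * beta 𝕜 hmn R = -(beta 𝕜 hmn R * alpha 𝕜 hmn R) :=
    mul_comm_of_mem_degree_odd odd_one hodd alpha_mem_degree beta_mem_degree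
  obtain ⟨e, he, hdeg⟩ := exists_algEquiv_cohomology hm hR ![1, m - 1] τ
    (fun i => by
      fin_cases i
      exacts [alpha_mem_closedForms, beta_mem_closedForms heven])
    (fun i => by
      fin_cases i
      exacts [alpha_mem_degree, beta_mem_degree])
    (fun v => by
      rw [Fin.sum_univ_two]
      change (v 0 • alpha 𝕜 hmn R + v 1 • beta 𝕜 hmn R) *
        (v 0 • alpha 𝕜 hmn R + v 1 • beta 𝕜 hmn R) = 0
      rw [add_mul, mul_add, mul_add, smul_mul_smul_comm, smul_mul_smul_comm, smul_mul_smul_comm,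
        smul_mul_smul_comm, hαα, hββ, hαβ, smul_zero, smul_zero, zero_add, add_zero, smul_neg,
        mul_comm (v 1), neg_add_cancel])
    l exists_eq_generatorProd_of_fin_two
    (fun c h => by
      obtain ⟨h0, h1, h2, h3⟩ := linear_combination_eq_zero_of_even hm2 hR ((hsum c).symm.trans h)
      intro s
      fin_cases s
      exacts [h0, h1, h2, h3])
    (fun s => by
      fin_cases s
      exacts [h1.symm ▸ isInvariant_one, hα.symm ▸ isInvariant_alpha,
        hβ.symm ▸ isInvariant_beta heven, hαβ'.symm ▸ (isInvariant_beta heven).alpha_mul])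
    (fun ξ hξ => by
      obtain ⟨a, b, c, f, h⟩ := hξ.exists_eq_of_even hm heven hR
      exact ⟨![a, b, c, f], by rw [hsum]; exact h⟩)
  exact ⟨e, he 0, he 1, hdeg⟩

end CohomologyRing

end LocalDeRham

end

theorem mainTheorem5 (𝕜 : Type*) [RCLike 𝕜] (n m : ℕ) (hm : 1 ≤ m) (hmn : m ≤ n)
    (R : ℝ) (hR : 0 < R) :
    (Odd m →
      ∃ hα : LocalDeRham.alpha 𝕜 hmn R ∈ LocalDeRham.ClosedForms 𝕜 hmn R,
      ∃ e : ExteriorAlgebra 𝕜 (Fin 1 → 𝕜) ≃ₐ[𝕜] LocalDeRham.Cohomology 𝕜 hmn R,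
        e (ExteriorAlgebra.ι 𝕜 (Pi.single 0 1)) =
          LocalDeRham.cohomologyClass (LocalDeRham.alpha 𝕜 hmn R) hα ∧
        ∀ k : ℕ, (LocalDeRham.exteriorDegree 𝕜 ![1] k).map e.toLinearMap =
          LocalDeRham.Cohomology.degree 𝕜 hmn R k) ∧
    (Even m →
      (∃ hα : LocalDeRham.alpha 𝕜 hmn R ∈ LocalDeRham.ClosedForms 𝕜 hmn R,
        ∃ hβ : LocalDeRham.beta 𝕜 hmn R ∈ LocalDeRham.ClosedForms 𝕜 hmn R,
        ∃ e : ExteriorAlgebra 𝕜 (Fin 2 → 𝕜) ≃ₐ[𝕜] LocalDeRham.Cohomology 𝕜 hmn R,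
          e (ExteriorAlgebra.ι 𝕜 (Pi.single 0 1)) =
            LocalDeRham.cohomologyClass (LocalDeRham.alpha 𝕜 hmn R) hα ∧
          e (ExteriorAlgebra.ι 𝕜 (Pi.single 1 1)) =
            LocalDeRham.cohomologyClass (LocalDeRham.beta 𝕜 hmn R) hβ ∧
          ∀ k : ℕ, (LocalDeRham.exteriorDegree 𝕜 ![1, m - 1] k).map e.toLinearMap =
            LocalDeRham.Cohomology.degree 𝕜 hmn R k) ∧
      LocalDeRham.beta 𝕜 hmn R ∈ LocalDeRham.Forms.degree 𝕜 (LocalDeRham.compl hmn R) (m - 1) ∧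
      LocalDeRham.IsBasic (LocalDeRham.beta 𝕜 hmn R) ∧
      LocalDeRham.IsRotationInvariant (LocalDeRham.beta 𝕜 hmn R) ∧
      LocalDeRham.alpha 𝕜 hmn R * LocalDeRham.beta 𝕜 hmn R =
        (2 * LocalDeRham.muInv 𝕜 hmn R ^ (m / 2)) ⊗ₜ[𝕜] LocalDeRham.normalVolume 𝕜 hmn) := by
  refine ⟨fun hodd => ⟨LocalDeRham.alpha_mem_closedForms,
    LocalDeRham.exists_algEquiv_cohomology_of_odd hm hodd hR⟩, fun heven =>
    ⟨⟨LocalDeRham.alpha_mem_closedForms, LocalDeRham.beta_mem_closedForms heven,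
      LocalDeRham.exists_algEquiv_cohomology_of_even hm heven hR⟩,
    LocalDeRham.beta_mem_degree, LocalDeRham.isBasic_beta heven,
    LocalDeRham.isRotationInvariant_beta, LocalDeRham.alpha_mul_beta⟩⟩
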